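/- A \emph{plane embedding} of a finite simple graph draws the vertices as distinct points of the plane and the edges as (polygonal) arcs between their endpoints that meet vertices and each other only in common endpoints. It is \emph{$k$-outerplane} if repeatedly removing all vertices incident to the current outer face removes the last vertex in exactly the $k$-th round. A graph is \emph{$k$-outerplanar} if it has a $k$-outerplane embedding but no $k'$-outerplane embedding with $k'<k$. A \emph{pixel} is a cell of the unit square grid; two pixels are adjacent if they share a side. A \emph{pixel representation} of a graph $G$ assigns to the vertices pairwise disjoint blobs (nonempty, finite, connected sets of pixels) such that two blobs contain adjacent pixels if and only if the two vertices are adjacent in $G$; its \emph{size} is the total number of pixels. It \emph{induces} a plane embedding of $G$ if every vertex lies in the interior of the region of its blob and every edge $uv$ lies in the interior of the union of the regions of the blobs of $u$ and $v$. It is \emph{$k$-outerplane} if it induces a $k$-outerplane embedding. Theorem. (1) For every $k\ge 0$, every $k$-outerplane pixel representation has size at least $4k^2-4k$. (2) For every $A>0$ there is $\delta>0$ such that for every $k\ge1$ the following holds. Let $G$ be a nonempty graph on $n$ vertices with $c$ connected components, each of which is $k$-outerplanar and has at most $Ak$ vertices. Then $G$ is $k$-outerplanar, and every pixel representation of $G$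 has size at least $(4k^2-4k)c$ and at least $\delta kn$. (3) For all $k\ge 2$ and $c\ge 1$, the nested triangle graph with $2k$ triangles ($2k$ disjoint triangles in a sequence, corresponding vertices of consecutive triangles being adjacent) is $k$-outerplanar; the disjoint union of $c$ copies of it has $6kc$ vertices, is $k$-outerplanar, and each of its pixel representations has size at least $(4k^2-4k)c$. (4) Consequently, some $k$-outerplanar graphs require $\Omega(kn)$-size pixel representations: there is $\delta>0$ such that for every $k\ge1$ and every positive multiple $n$ of $6k$ there is a $k$-outerplanar graph on $n$ vertices all of whose pixel representations have size at least $\delta kn$. -/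

import Mathlib

/-- The plane (only its topology, its bounded sets and its line segments are used). -/
abbrev Plane : Type := ℝ × ℝ

/-- `A` is a (simple, polygonal) arc from `a` to `b`: the union of `n ≥ 1` nondegenerate segments
`[p 0, p 1], …, [p (n-1), p n]` with `p 0 = a` and `p n = b`, where consecutive segments share only
their common endpoint and all other pairs of segments are disjoint. -/
def IsPolygonalArc (a b : Plane) (A : Set Plane) : Prop :=
  ∃ (n : ℕ) (p : ℕ → Plane), 1 ≤ n ∧ p 0 = a ∧ p n = b ∧
    A = {x | ∃ i < n, x ∈ segment ℝ (p i) (p (i + 1))} ∧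
    (∀ i < n, p i ≠ p (i + 1)) ∧
    (∀ i j, i < j → j < n → ∀ x, x ∈ segment ℝ (p i) (p (i + 1)) →
      x ∈ segment ℝ (p j) (p (j + 1)) → j = i + 1 ∧ x = p j)

/-- A plane embedding of the graph `G`: distinct vertices are distinct points, an edge is an arc
between its endpoints that contains no other vertex, and two different edges meet only in common
endpoints. Arcs are polygonal, which is the usual textbook definition of a plane graph and
does not restrict the embeddings up to equivalence. The value of `arc` at a pair that is
not an edge of `G` is irrelevant. -/
structure PlaneEmbedding {V : Type*} (G : SimpleGraph V) where
  pt : V → Plane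
  arc : Sym2 V → Set Plane
  pt_injective : Function.Injective pt
  arc_isPolygonalArc : ∀ u v, G.Adj u v → IsPolygonalArc (pt u) (pt v) (arc s(u, v))
  mem_of_pt_mem_arc : ∀ e ∈ G.edgeSet, ∀ w, pt w ∈ arc e → w ∈ e
  arc_inter_arc : ∀ e ∈ G.edgeSet, ∀ f ∈ G.edgeSet, e ≠ f →
    ∀ x, x ∈ arc e → x ∈ arc f → ∃ w, w ∈ e ∧ w ∈ f ∧ x = pt w

namespace PlaneEmbedding

variable {V : Type*} {G : SimpleGraph V}

/-- The point set of the part of the embedding that is left when only the vertices in `S` are kept,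
that is, of the restricted embedding of the subgraph induced by `S`. -/
def carrier (E : PlaneEmbedding G) (S : Set V) : Set Plane :=
  E.pt '' S ∪ {x | ∃ e ∈ G.edgeSet, (∀ v ∈ e, v ∈ S) ∧ x ∈ E.arc e}

/-- The outer face of the embedding restricted to `S`: the unbounded connected component of the
complement of the point set. -/
def outerFace (E : PlaneEmbedding G) (S : Set V) : Set Plane :=
  {x | x ∈ (E.carrier S)ᶜ ∧ ¬ Bornology.IsBounded (connectedComponentIn (E.carrier S)ᶜ x)}

/-- The vertices on (incident to) the outer face of the embedding restricted to `S`. -/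
def outerVertices (E : PlaneEmbedding G) (S : Set V) : Set V :=
  {v | v ∈ S ∧ E.pt v ∈ closure (E.outerFace S)}

/-- Starting from the embedding restricted to `S`, repeatedly removing all vertices on the current
outer face exhausts the vertices after exactly `k` rounds. -/
def PeelsIn (E : PlaneEmbedding G) : ℕ → Set V → Prop
  | 0, S => S = ∅
  | k + 1, S => S.Nonempty ∧ E.PeelsIn k (S \ E.outerVertices S)

/-- The embedding is `k`-outerplane. For `k = 1` this says that there is a vertex and that all
vertices are on the outer face. -/
def IsOuterplane (E : PlaneEmbedding G) (k : ℕ) : Prop :=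
  E.PeelsIn k Set.univ

end PlaneEmbedding

/-- `G` is `k`-outerplanar: it has a `k`-outerplane embedding, but no `k'`-outerplane one with
`k' < k`. -/
def IsOuterplanar {V : Type*} (G : SimpleGraph V) (k : ℕ) : Prop :=
  (∃ E : PlaneEmbedding G, E.IsOuterplane k) ∧
    ∀ k' < k, ¬ ∃ E : PlaneEmbedding G, E.IsOuterplane k'

/-- Pixels are the cells of the unit square grid, named by their lower left corners. -/
abbrev Pixel : Type := ℤ × ℤ

/-- Two pixels are adjacent if they share a side. -/
def pixelGraph : SimpleGraph Pixel where
  Adj p q := |p.1 - q.1| + |p.2 - q.2| = 1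
  symm := ⟨fun p q h => by rw [abs_sub_comm q.1, abs_sub_comm q.2]; exact h⟩
  loopless := ⟨fun p h => by simp at h⟩

/-- The closed unit square that is covered by a pixel. -/
def Pixel.square (p : Pixel) : Set Plane :=
  Set.Icc (p.1 : ℝ) (p.1 + 1) ×ˢ Set.Icc (p.2 : ℝ) (p.2 + 1)

/-- A pixel representation of `G`: pairwise disjoint blobs (nonempty connected finite sets of
pixels), one for each vertex, such that two blobs contain adjacent pixels if and only if the
vertices are adjacent. -/
structure PixelRepresentation {V : Type*} (G : SimpleGraph V) where
  blob : V → Finset Pixel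
  blob_disjoint : ∀ u v, u ≠ v → Disjoint (blob u) (blob v)
  blob_connected : ∀ v, (pixelGraph.induce (blob v : Set Pixel)).Connected
  adj_iff : ∀ u v, u ≠ v → (G.Adj u v ↔ ∃ p ∈ blob u, ∃ q ∈ blob v, pixelGraph.Adj p q)

namespace PixelRepresentation

variable {V : Type*} {G : SimpleGraph V}

/-- The size of a pixel representation: the total number of its pixels. -/
def size [Fintype V] (Γ : PixelRepresentation G) : ℕ :=
  ∑ v, (Γ.blob v).card

/-- The part of the plane that is covered by the blob of `v`. -/
def region (Γ : PixelRepresentation G) (v : V) : Set Plane :=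
  {x | ∃ p ∈ Γ.blob v, x ∈ Pixel.square p}

/-- `Γ` induces the embedding `E` of `G`: every vertex lies inside its blob, and every edge `uv` is
drawn inside the union of the blobs of `u` and `v`, so that it crosses from one blob to the other
where they touch. -/
def Induces (Γ : PixelRepresentation G) (E : PlaneEmbedding G) : Prop :=
  (∀ v, E.pt v ∈ interior (Γ.region v)) ∧
    ∀ u v, G.Adj u v → E.arc s(u, v) ⊆ interior (Γ.region u ∪ Γ.region v)

/-- `Γ` is a `k`-outerplane pixel representation: it induces a `k`-outerplane embedding. -/
def IsOuterplane (Γ : PixelRepresentation G) (k : ℕ) : Prop :=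
  ∃ E : PlaneEmbedding G, Γ.Induces E ∧ E.IsOuterplane k

end PixelRepresentation

/-- The nested triangle graph with `m` triangles: the vertices `(i, 0), (i, 1), (i, 2)` form the
`i`-th triangle, and `(i, a)` is joined to `(i + 1, a)`. -/
def nestedTriangles (m : ℕ) : SimpleGraph (Fin m × Fin 3) where
  Adj x y := (x.1 = y.1 ∧ x.2 ≠ y.2) ∨
    (x.2 = y.2 ∧ (x.1.val + 1 = y.1.val ∨ y.1.val + 1 = x.1.val))
  symm := ⟨fun x y h => by
    rcases h with ⟨h, h'⟩ | ⟨h, h'⟩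
    · exact Or.inl ⟨h.symm, h'.symm⟩
    · exact Or.inr ⟨h.symm, h'.symm⟩⟩
  loopless := ⟨fun x h => by
    rcases h with ⟨_, h⟩ | ⟨_, h⟩
    · exact h rfl
    · omega⟩

/-- The disjoint union of `c` copies of the graph `H`. -/
def disjointCopies {W : Type*} (c : ℕ) (H : SimpleGraph W) : SimpleGraph (Fin c × W) where
  Adj x y := x.1 = y.1 ∧ H.Adj x.2 y.2
  symm := ⟨fun _ _ h => ⟨h.1.symm, h.2.symm⟩⟩
  loopless := ⟨fun _ h => h.2.ne rfl⟩

/-! ### Polygonal arcs -/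

/-! The size bound is an isoperimetric argument. The blobs of the vertices removed in one round of
peeling surround the blobs that remain, diagonal neighbours included: a king walk that comes from
far away and avoids the removed blobs never leaves the outer face (`exists_enclosed`). A finite
pixel set with `a` columns and `b` rows can only be surrounded by at least `2a + 2b + 4` pixels,
which span two more columns and two more rows (`card_of_encloses`). Summing from the innermost round
outwards gives `4k² - 4k`. The topological point is that a blob touching the outer face belongs to a
vertex on the outer face. It rests on `arc_subset_closure`: a face whose closure contains an inner
point of an edge has the whole edge in its closure.

Every pixel representation induces some plane embedding (`exists_induces`), obtained by drawing
stars inside the blobs. An embedding of a `k`-outerplanar graph peels in at least `k` rounds, so the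
bound holds for all representations of the graph. The bounds of the components add up, and
components with at most `Ak` vertices turn `ck²` into a multiple of `kn`. Drawings of the components
placed side by side peel simultaneously, while restricting a drawing never increases the number of
rounds, so a nonempty graph whose components are all `k`-outerplanar is `k`-outerplanar.

For the nested triangles, both directions of `k`-outerplanarity are needed. An intact triangle
separates the triangles before it from those after it. If both sides reached the outer face, a
connection through that face would complete a drawing of a `K₅` minor (`false_of_triangle_between`),
which a mod 2 count of crossings forbids (`false_of_connected_sets`). Hence triangles on each side
of an initially outer vertex can only be eaten one per round, and one of the two sides is long
(`le_of_isOuterplane`). Conversely, two towers of `k` concentric rings of blobs, joined at their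
outermost rings, form a pixel representation all of whose induced embeddings peel in at most `k`
rounds (`add_le_of_peelsIn`). -/

theorem polygonalChain_isCompact (n : ℕ) (p : ℕ → Plane) :
    IsCompact {x | ∃ i < n, x ∈ segment ℝ (p i) (p (i + 1))} := by
  have : {x | ∃ i < n, x ∈ segment ℝ (p i) (p (i + 1))} =
      ⋃ i ∈ Finset.range n, segment ℝ (p i) (p (i + 1)) := by
    ext x; simp
  rw [this]
  refine (Finset.range n).isCompact_biUnion fun i _ => ?_
  rw [segment_eq_image]
  exact isCompact_Icc.image (by fun_prop)

theorem polygonalChain_isConnected {n : ℕ} (hn : 1 ≤ n) (p : ℕ → Plane) :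
    IsConnected {x | ∃ i < n, x ∈ segment ℝ (p i) (p (i + 1))} := by
  induction n, hn using Nat.le_induction with
  | base =>
    have : {x | ∃ i < 1, x ∈ segment ℝ (p i) (p (i + 1))} = segment ℝ (p 0) (p 1) := by
      ext x; simp
    rw [this]
    exact ⟨⟨_, left_mem_segment ℝ _ _⟩, (convex_segment _ _).isPreconnected⟩
  | succ n hn ih =>
    have : {x | ∃ i < n + 1, x ∈ segment ℝ (p i) (p (i + 1))} =
        {x | ∃ i < n, x ∈ segment ℝ (p i) (p (i + 1))} ∪ segment ℝ (p n) (p (n + 1)) := by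
      ext x; simp only [Nat.lt_succ_iff_lt_or_eq, or_and_right, exists_or, exists_eq_left,
        Set.mem_ofPred_eq, Set.mem_union]
    rw [this]
    refine IsConnected.union ⟨p n, ⟨n - 1, by omega, ?_⟩, left_mem_segment ℝ _ _⟩ ih
      ⟨⟨_, left_mem_segment ℝ _ _⟩, (convex_segment _ _).isPreconnected⟩
    rw [show n - 1 + 1 = n by omega]
    exact right_mem_segment ℝ _ _

namespace IsPolygonalArc

variable {a b c : Plane} {A B : Set Plane}

theorem isCompact (h : IsPolygonalArc a b A) : IsCompact A := by
  obtain ⟨n, p, hn, h0, h1, rfl, h2, h3⟩ := h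
  exact polygonalChain_isCompact n p

theorem isConnected (h : IsPolygonalArc a b A) : IsConnected A := by
  obtain ⟨n, p, hn, h0, h1, rfl, h2, h3⟩ := h
  exact polygonalChain_isConnected hn p

theorem left_mem (h : IsPolygonalArc a b A) : a ∈ A := by
  obtain ⟨n, p, hn, rfl, h1, rfl, h2, h3⟩ := h
  exact ⟨0, hn, left_mem_segment ℝ _ _⟩

theorem of_ne (h : a ≠ b) : IsPolygonalArc a b (segment ℝ a b) := by
  refine ⟨1, fun i => if i = 0 then a else b, le_rfl, by simp, by simp, ?_, ?_, ?_⟩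
  · ext x; simp
  · intro i hi
    obtain rfl : i = 0 := by omega
    simpa using h
  · intro i j hij hj
    omega

theorem symm (h : IsPolygonalArc a b A) : IsPolygonalArc b a A := by
  obtain ⟨n, p, hn, h0, h1, rfl, h2, h3⟩ := h
  have key : ∀ i < n, segment ℝ (p (n - i)) (p (n - (i + 1))) =
      segment ℝ (p (n - 1 - i)) (p (n - 1 - i + 1)) := by
    intro i hi
    rw [segment_symm, show n - (i + 1) = n - 1 - i by omega, show n - i = n - 1 - i + 1 by omega]
  refine ⟨n, fun i => p (n - i), hn, by simpa using h1, by simpa using h0, ?_, ?_, ?_⟩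
  · ext x
    constructor
    · rintro ⟨i, hi, hx⟩
      refine ⟨n - 1 - i, by omega, ?_⟩
      simp only
      rw [key _ (by omega), show n - 1 - (n - 1 - i) = i by omega]
      exact hx
    · rintro ⟨i, hi, hx⟩
      refine ⟨n - 1 - i, by omega, ?_⟩
      rw [← key _ hi]
      exact hx
  · intro i hi
    have := h2 (n - 1 - i) (by omega)
    simp only
    rw [show n - (i + 1) = n - 1 - i by omega, show n - i = n - 1 - i + 1 by omega]
    exact this.symm
  · intro i j hij hj x hx hx'
    simp only at hx hx'
    rw [key _ (by omega)] at hx hx'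
    obtain ⟨h4, h5⟩ := h3 (n - 1 - j) (n - 1 - i) (by omega) (by omega) x hx' hx
    refine ⟨by omega, ?_⟩
    simp only
    rw [h5]
    congr 1
    omega

theorem trans (hA : IsPolygonalArc a b A) (hB : IsPolygonalArc b c B) (hAB : A ∩ B ⊆ {b}) :
    IsPolygonalArc a c (A ∪ B) := by
  obtain ⟨n, p, hn, h0, h1, rfl, h2, h3⟩ := hA
  obtain ⟨m, q, hm, g0, g1, rfl, g2, g3⟩ := hB
  let r : ℕ → Plane := fun i => if i ≤ n then p i else q (i - n)
  have r1 : ∀ i ≤ n, r i = p i := fun i hi => if_pos hi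
  have r2 : ∀ i, r (n + i) = q i := by
    intro i
    by_cases hi : i = 0
    · subst hi; simp [r, h1, g0]
    · simp [r, hi]
  refine ⟨n + m, r, by omega, by rw [r1 _ (by omega), h0], by rw [r2, g1], ?_, ?_, ?_⟩
  · ext x
    constructor
    · rintro (⟨i, hi, hx⟩ | ⟨i, hi, hx⟩)
      · exact ⟨i, by omega, by rwa [r1 _ hi.le, r1 _ hi]⟩
      · exact ⟨n + i, by omega, by rwa [add_assoc, r2, r2]⟩
    · rintro ⟨i, hi, hx⟩
      by_cases hin : i < n
      · rw [r1 _ hin.le, r1 _ hin] at hx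
        exact Or.inl ⟨i, hin, hx⟩
      · obtain ⟨j, rfl⟩ := Nat.exists_eq_add_of_le (not_lt.1 hin)
        rw [add_assoc, r2, r2] at hx
        exact Or.inr ⟨j, by omega, hx⟩
  · intro i hi
    by_cases hin : i < n
    · rw [r1 _ hin.le, r1 _ hin]
      exact h2 i hin
    · obtain ⟨j, rfl⟩ := Nat.exists_eq_add_of_le (not_lt.1 hin)
      rw [add_assoc, r2, r2]
      exact g2 j (by omega)
  · intro i j hij hj x hx hx'
    by_cases hjn : j < n
    · rw [r1 _ (by omega), r1 _ (by omega)] at hx hx'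
      rw [r1 _ (by omega)]
      exact h3 i j hij hjn x hx hx'
    · obtain ⟨j, rfl⟩ := Nat.exists_eq_add_of_le (not_lt.1 hjn)
      rw [add_assoc, r2, r2] at hx'
      rw [r2]
      by_cases hin : i < n
      · rw [r1 _ hin.le, r1 _ hin] at hx
        have hxb : x = b := hAB ⟨⟨i, hin, hx⟩, ⟨j, by omega, hx'⟩⟩
        -- Another segment through the joint `b` would meet the last segment at its starting point,
        -- so the last segment would be degenerate. The same reasoning with the first segment of the
        -- second arc gives `j = 0`.
        have hi' : i = n - 1 := by
          by_contra hne
          obtain ⟨h4, h5⟩ := h3 i (n - 1) (by omega) (by omega) x hx (by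
            rw [show n - 1 + 1 = n by omega, hxb, ← h1]; exact right_mem_segment ℝ _ _)
          refine h2 (n - 1) (by omega) ?_
          rw [← h5, hxb, ← h1, show n - 1 + 1 = n by omega]
        have hj' : j = 0 := by
          by_contra hne
          obtain ⟨h4, h5⟩ := g3 0 j (by omega) (by omega) x (by
            rw [hxb, ← g0]; exact left_mem_segment ℝ _ _) hx'
          refine g2 0 (by omega) ?_
          rw [g0, ← hxb, h5, h4]
        subst hj'
        exact ⟨by omega, by rw [hxb, g0]⟩
      · obtain ⟨i, rfl⟩ := Nat.exists_eq_add_of_le (not_lt.1 hin)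
        rw [add_assoc, r2, r2] at hx
        obtain ⟨h4, h5⟩ := g3 i j (by omega) (by omega) x hx hx'
        exact ⟨by omega, h5⟩

end IsPolygonalArc

/-! ### Faces -/

/-- `F` is a union of connected components of the complement of `K`. -/
structure IsFaceUnion (F K : Set Plane) : Prop where
  isOpen : IsOpen F
  disjoint : Disjoint F K
  closure_subset : closure F ⊆ F ∪ K

theorem IsFaceUnion.subset_of_isPreconnected {F K C : Set Plane} (h : IsFaceUnion F K)
    (hC : IsPreconnected C) (hCK : Disjoint C K) (hCF : (C ∩ F).Nonempty) : C ⊆ F := by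
  refine hC.subset_left_of_subset_union h.isOpen isClosed_closure.isOpen_compl
    (Set.disjoint_left.2 fun x hx hx' => hx' (subset_closure hx)) ?_ hCF
  intro x hx
  by_cases hxF : x ∈ closure F
  · rcases h.closure_subset hxF with h' | h'
    · exact Or.inl h'
    · exact (Set.disjoint_left.1 hCK hx h').elim
  · exact Or.inr hxF

/-- The local hypothesis makes `s ∩ t` open in `s`, and it is closed anyway. This spreads membership
in the closure of a face along an open segment. -/
theorem IsPreconnected.subset_of_isClosed_of_eventually {s t : Set Plane} (hs : IsPreconnected s)
    (ht : IsClosed t) (h : ∀ x ∈ s, x ∈ t → ∀ᶠ y in nhdsWithin x s, y ∈ t)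
    (hne : (s ∩ t).Nonempty) : s ⊆ t := by
  obtain ⟨x, hxs, hxt⟩ := hne
  intro y hy
  refine hs.induction₂' (fun x y => x ∈ t → y ∈ t) ?_ (fun _ _ _ _ _ _ h1 h2 h3 => h2 (h1 h3))
    hxs hy hxt
  intro x hx
  by_cases hxt : x ∈ t
  · filter_upwards [h x hx hxt] with y hy using ⟨fun _ => hy, fun _ => hxt⟩
  · filter_upwards [nhdsWithin_le_nhds (ht.isOpen_compl.mem_nhds hxt)] with y hy
    exact ⟨fun h => absurd h hxt, fun h => absurd h hy⟩

/-! ### The drawing of a vertex set, its outer face, and monotonicity of peeling -/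

namespace PlaneEmbedding

variable {V : Type*} {G : SimpleGraph V} (E : PlaneEmbedding G)

theorem arc_isCompact {e : Sym2 V} (he : e ∈ G.edgeSet) : IsCompact (E.arc e) := by
  induction e with | h u v => exact (E.arc_isPolygonalArc u v he).isCompact

theorem arc_isConnected {e : Sym2 V} (he : e ∈ G.edgeSet) : IsConnected (E.arc e) := by
  induction e with | h u v => exact (E.arc_isPolygonalArc u v he).isConnected

theorem pt_mem_arc {e : Sym2 V} (he : e ∈ G.edgeSet) {v : V} (hv : v ∈ e) : E.pt v ∈ E.arc e := by
  obtain ⟨w, rfl⟩ := Sym2.mem_iff_exists.1 hv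
  exact (E.arc_isPolygonalArc v w he).left_mem

theorem pt_mem_carrier {S : Set V} {v : V} (hv : v ∈ S) : E.pt v ∈ E.carrier S :=
  Or.inl ⟨v, hv, rfl⟩

theorem arc_subset_carrier {S : Set V} {u v : V} (h : G.Adj u v) (hu : u ∈ S) (hv : v ∈ S) :
    E.arc s(u, v) ⊆ E.carrier S := fun x hx => by
  refine Or.inr ⟨s(u, v), h, ?_, hx⟩
  simp [hu, hv]

theorem carrier_mono {S T : Set V} (h : S ⊆ T) : E.carrier S ⊆ E.carrier T := by
  rintro x (⟨v, hv, rfl⟩ | ⟨e, he, hv, hx⟩)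
  · exact Or.inl ⟨v, h hv, rfl⟩
  · exact Or.inr ⟨e, he, fun v hve => h (hv v hve), hx⟩

theorem mem_of_pt_mem_carrier {S : Set V} {v : V} (h : E.pt v ∈ E.carrier S) : v ∈ S := by
  rcases h with ⟨w, hw, h⟩ | ⟨e, he, hS, hx⟩
  · exact E.pt_injective h ▸ hw
  · exact hS _ (E.mem_of_pt_mem_arc e he v hx)

/-- This is how planarity enters the `K₅` argument: a common point of two drawings would be a vertex
of one lying on the other, or a common endpoint of two edges. -/
theorem carrier_disjoint {S T : Set V} (h : Disjoint S T) :
    Disjoint (E.carrier S) (E.carrier T) := by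
  rw [Set.disjoint_left] at h ⊢
  rintro x hx hx'
  rcases id hx with ⟨v, hv, rfl⟩ | ⟨e, he, hS, hxe⟩
  · exact h hv (E.mem_of_pt_mem_carrier hx')
  · rcases id hx' with ⟨v, hv, rfl⟩ | ⟨f, hf, hT, hxf⟩
    · exact h (E.mem_of_pt_mem_carrier hx) hv
    · by_cases hef : e = f
      · subst hef
        induction e with | h u v => exact h (hS u (by simp)) (hT u (by simp))
      · obtain ⟨w, hw, hw', _⟩ := E.arc_inter_arc e he f hf hef x hxe hxf
        exact h (hS w hw) (hT w hw')

theorem carrier_isCompact [Finite V] (S : Set V) : IsCompact (E.carrier S) := by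
  have : E.carrier S = E.pt '' S ∪ ⋃ e ∈ {e ∈ G.edgeSet | ∀ v ∈ e, v ∈ S}, E.arc e := by
    ext x; simp [carrier, and_assoc]
  rw [this]
  refine (S.toFinite.image _).isCompact.union ?_
  exact (Set.toFinite _).isCompact_biUnion fun e he => E.arc_isCompact he.1

theorem exists_carrier_bound [Finite V] (S : Set V) :
    ∃ M : ℝ, 0 < M ∧ ∀ x ∈ E.carrier S, |x.1| < M ∧ |x.2| < M := by
  obtain ⟨M, hM, h⟩ := (E.carrier_isCompact S).isBounded.exists_pos_norm_lt
  exact ⟨M, hM, fun x hx => max_lt_iff.1 (h x hx)⟩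

theorem carrier_isClosed [Finite V] (S : Set V) : IsClosed (E.carrier S) :=
  (E.carrier_isCompact S).isClosed

theorem carrier_isPreconnected {S : Set V} (h : (G.induce S).Preconnected) :
    IsPreconnected (E.carrier S) := by
  have key : ∀ u v : S, ∃ t ⊆ E.carrier S, E.pt u ∈ t ∧ E.pt v ∈ t ∧ IsPreconnected t := by
    intro u v
    have := (SimpleGraph.reachable_iff_reflTransGen _ _).1 (h u v)
    induction this with
    | refl =>
      exact ⟨{E.pt u}, by simpa using E.pt_mem_carrier u.2, rfl, rfl, isPreconnected_singleton⟩
    | @tail w x _ hwx ih =>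
      obtain ⟨t, ht, hu, hw, ht'⟩ := ih
      have hadj : G.Adj w x := hwx
      exact ⟨t ∪ E.arc s(w.1, x.1), Set.union_subset ht (E.arc_subset_carrier hadj w.2 x.2),
        Or.inl hu, Or.inr (E.pt_mem_arc hadj (by simp)),
        ht'.union _ hw (E.pt_mem_arc hadj (by simp)) (E.arc_isConnected hadj).isPreconnected⟩
  have key2 : ∀ x ∈ E.carrier S, ∃ u : S, ∃ t ⊆ E.carrier S, x ∈ t ∧ E.pt u ∈ t ∧
      IsPreconnected t := by
    rintro x (⟨v, hv, rfl⟩ | ⟨e, he, hS, hxe⟩)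
    · exact ⟨⟨v, hv⟩, {E.pt v}, by simpa using E.pt_mem_carrier hv, rfl, rfl,
        isPreconnected_singleton⟩
    · induction e with
      | h u v =>
        have hu : u ∈ S := hS u (by simp)
        exact ⟨⟨u, hu⟩, _, E.arc_subset_carrier he hu (hS v (by simp)), hxe,
          E.pt_mem_arc he (by simp), (E.arc_isConnected he).isPreconnected⟩
  refine isPreconnected_of_forall_pair fun x hx y hy => ?_
  obtain ⟨u, s, hs, hxs, hus, hs'⟩ := key2 x hx
  obtain ⟨v, t, ht, hyt, hvt, ht'⟩ := key2 y hy
  obtain ⟨r, hr, hur, hvr, hr'⟩ := key u v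
  exact ⟨s ∪ r ∪ t, Set.union_subset (Set.union_subset hs hr) ht, Or.inl (Or.inl hxs), Or.inr hyt,
    (hs'.union _ hus hur hr').union _ (Or.inr hvr) hvt ht'⟩

/-- Belonging to the outer face depends only on the component of the complement, and the components
of an open set of the plane are open. -/
theorem outerFace_isFaceUnion [Finite V] (S : Set V) :
    IsFaceUnion (E.outerFace S) (E.carrier S) := by
  have hop : IsOpen (E.carrier S)ᶜ := (E.carrier_isClosed S).isOpen_compl
  have hcomp : ∀ x ∈ (E.carrier S)ᶜ, ∀ y ∈ connectedComponentIn (E.carrier S)ᶜ x,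
      y ∈ E.outerFace S ↔ x ∈ E.outerFace S := by
    intro x hx y hy
    have h1 : y ∈ (E.carrier S)ᶜ := connectedComponentIn_subset _ _ hy
    simp only [outerFace, Set.mem_ofPred_eq, hx, h1, true_and, connectedComponentIn_eq hy]
  refine ⟨?_, Set.disjoint_left.2 fun x hx => hx.1, ?_⟩
  · rw [isOpen_iff_mem_nhds]
    intro x hx
    filter_upwards [hop.connectedComponentIn.mem_nhds (mem_connectedComponentIn hx.1)] with y hy
    exact (hcomp x hx.1 y hy).2 hx
  · intro x hx
    by_cases hxK : x ∈ E.carrier S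
    · exact Or.inr hxK
    · left
      obtain ⟨y, hy, hyF⟩ := mem_closure_iff.1 hx _ hop.connectedComponentIn
        (mem_connectedComponentIn hxK)
      exact (hcomp x hxK y hy).1 hyF

theorem mem_outerFace_of_ray {S : Set V} {x d : Plane} (hd : d ≠ 0)
    (h : ∀ t : ℝ, 0 ≤ t → x + t • d ∉ E.carrier S) : x ∈ E.outerFace S := by
  refine ⟨by simpa using h 0 le_rfl, fun hb => ?_⟩
  have hconn : IsPreconnected ((fun t : ℝ => x + t • d) '' Set.Ici 0) :=
    isPreconnected_Ici.image _ (by fun_prop)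
  have hsub := hconn.subset_connectedComponentIn (F := (E.carrier S)ᶜ) (x := x)
    ⟨0, by simp, by simp⟩ (by rintro _ ⟨t, ht, rfl⟩; exact h t ht)
  obtain ⟨M, hM⟩ := (hb.subset hsub).exists_norm_le
  have hd' : 0 < ‖d‖ := norm_pos_iff.2 hd
  have h0 : ‖x‖ ≤ M := hM x ⟨0, by simp, by simp⟩
  have hM0 : 0 ≤ M := (norm_nonneg x).trans h0
  have h2 := hM (x + ((2 * M + 1) / ‖d‖) • d) ⟨_, Set.mem_Ici.2 (by positivity), rfl⟩
  have h3 : ‖((2 * M + 1) / ‖d‖) • d‖ = 2 * M + 1 := by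
    rw [norm_smul, Real.norm_of_nonneg (by positivity), div_mul_cancel₀ _ hd'.ne']
  have h4 := norm_sub_le (x + ((2 * M + 1) / ‖d‖) • d) x
  rw [add_sub_cancel_left, h3] at h4
  linarith

theorem mem_outerFace_of_lt {S : Set V} {M : ℝ}
    (hM : ∀ x ∈ E.carrier S, |x.1| < M ∧ |x.2| < M) {x : Plane} (hx : M ≤ |x.1| ∨ M ≤ |x.2|) :
    x ∈ E.outerFace S := by
  rcases hx with hx | hx <;> rcases le_abs'.1 hx with hx | hx
  · refine E.mem_outerFace_of_ray (d := (-1, 0)) (by simp) fun t ht hc => ?_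
    have := (abs_lt.1 (hM _ hc).1).1
    simp at this; linarith
  · refine E.mem_outerFace_of_ray (d := (1, 0)) (by simp) fun t ht hc => ?_
    have := (abs_lt.1 (hM _ hc).1).2
    simp at this; linarith
  · refine E.mem_outerFace_of_ray (d := (0, -1)) (by simp) fun t ht hc => ?_
    have := (abs_lt.1 (hM _ hc).2).1
    simp at this; linarith
  · refine E.mem_outerFace_of_ray (d := (0, 1)) (by simp) fun t ht hc => ?_
    have := (abs_lt.1 (hM _ hc).2).2
    simp at this; linarith

theorem outerFace_nonempty [Finite V] (S : Set V) : (E.outerFace S).Nonempty := by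
  obtain ⟨M, hM, h⟩ := E.exists_carrier_bound S
  exact ⟨(M, 0), E.mem_outerFace_of_lt h (Or.inl (le_abs_self M))⟩

theorem isPreconnected_box_compl {M : ℝ} (_ : 0 ≤ M) :
    IsPreconnected {x : Plane | M < |x.1| ∨ M < |x.2|} := by
  have hset : {x : Plane | M < |x.1| ∨ M < |x.2|} =
      ({x | M < x.1} ∪ {x | M < x.2}) ∪ ({x | x.1 < -M} ∪ {x | x.2 < -M}) := by
    ext x
    simp only [lt_abs, Set.mem_ofPred_eq, Set.mem_union, lt_neg]
    tauto
  have h1 : IsPreconnected {x : Plane | M < x.1} :=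
    (convex_halfSpace_gt (f := fun x : Plane => x.1) ⟨by simp, by simp⟩ M).isPreconnected
  have h2 : IsPreconnected {x : Plane | M < x.2} :=
    (convex_halfSpace_gt (f := fun x : Plane => x.2) ⟨by simp, by simp⟩ M).isPreconnected
  have h3 : IsPreconnected {x : Plane | x.1 < -M} :=
    (convex_halfSpace_lt (f := fun x : Plane => x.1) ⟨by simp, by simp⟩ (-M)).isPreconnected
  have h4 : IsPreconnected {x : Plane | x.2 < -M} :=
    (convex_halfSpace_lt (f := fun x : Plane => x.2) ⟨by simp, by simp⟩ (-M)).isPreconnected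
  rw [hset]
  refine (h1.union (M + 1, M + 1) ?_ ?_ h2).union (M + 1, -M - 1) ?_ ?_
    (h3.union (-M - 1, -M - 1) ?_ ?_ h4) <;> simp

/-- The outer face is defined by unboundedness alone, so uniqueness needs a reason: every unbounded
component leaves a box around the drawing, and the outside of a box is connected. -/
theorem outerFace_isPreconnected [Finite V] (S : Set V) : IsPreconnected (E.outerFace S) := by
  obtain ⟨M, hM, h⟩ := E.exists_carrier_bound S
  have hF := E.outerFace_isFaceUnion S
  have key : ∀ x ∈ E.outerFace S, ∃ y : Plane, (M < |y.1| ∨ M < |y.2|) ∧ ∃ t ⊆ E.outerFace S,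
      x ∈ t ∧ y ∈ t ∧ IsPreconnected t := by
    intro x hx
    have : ∃ y ∈ connectedComponentIn (E.carrier S)ᶜ x, M < |y.1| ∨ M < |y.2| := by
      by_contra! hcon
      refine hx.2 (isBounded_iff_forall_norm_le.2 ⟨M, fun y hy => ?_⟩)
      exact max_le_iff.2 (hcon y hy)
    obtain ⟨y, hy, hy'⟩ := this
    refine ⟨y, hy', _, ?_, mem_connectedComponentIn hx.1, hy, isPreconnected_connectedComponentIn⟩
    exact hF.subset_of_isPreconnected isPreconnected_connectedComponentIn
      (Set.disjoint_left.2 fun z hz => connectedComponentIn_subset _ _ hz)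
      ⟨x, mem_connectedComponentIn hx.1, hx⟩
  refine isPreconnected_of_forall_pair fun x hx y hy => ?_
  obtain ⟨x', hx', s, hs, hxs, hxs', hs'⟩ := key x hx
  obtain ⟨y', hy', t, ht, hyt, hyt', ht'⟩ := key y hy
  refine ⟨s ∪ {x : Plane | M < |x.1| ∨ M < |x.2|} ∪ t, ?_, Or.inl (Or.inl hxs), Or.inr hyt,
    (hs'.union _ hxs' hx' (isPreconnected_box_compl hM.le)).union _ (Or.inr hy') hyt' ht'⟩
  refine Set.union_subset (Set.union_subset hs ?_) ht
  exact fun z hz => E.mem_outerFace_of_lt h (hz.imp le_of_lt le_of_lt)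

/-- Deleting parts of the drawing enlarges the components of the complement. All monotonicity of
peeling comes from this. -/
theorem outerFace_anti [Finite V] {S T : Set V} (h : S ⊆ T) : E.outerFace T ⊆ E.outerFace S := by
  intro x hx
  have hsub := Set.compl_subset_compl.2 (E.carrier_mono h)
  exact ⟨hsub hx.1, fun hb => hx.2 (hb.subset (connectedComponentIn_mono x hsub))⟩

theorem mem_outerVertices_of_subset [Finite V] {S T : Set V} (h : S ⊆ T) {v : V} (hv : v ∈ S)
    (hvT : v ∈ E.outerVertices T) : v ∈ E.outerVertices S :=
  ⟨hv, closure_mono (E.outerFace_anti h) hvT.2⟩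

theorem diff_outerVertices_mono [Finite V] {S T : Set V} (h : S ⊆ T) :
    S \ E.outerVertices S ⊆ T \ E.outerVertices T :=
  fun _ hv => ⟨h hv.1, fun hvT => hv.2 (E.mem_outerVertices_of_subset h hv.1 hvT)⟩

theorem PeelsIn.exists_le [Finite V] {k : ℕ} {S T : Set V} (hT : E.PeelsIn k T) (h : S ⊆ T) :
    ∃ j ≤ k, E.PeelsIn j S := by
  induction k generalizing S T with
  | zero => exact ⟨0, le_rfl, Set.subset_eq_empty h hT⟩
  | succ k ih =>
    obtain ⟨j, hj, hS⟩ := ih hT.2 (E.diff_outerVertices_mono h)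
    rcases S.eq_empty_or_nonempty with rfl | hne
    · exact ⟨0, by omega, rfl⟩
    · exact ⟨j + 1, by omega, hne, hS⟩

end PlaneEmbedding

/-! ### Faces along a polygonal arc -/

/-- The determinant of two vectors of the plane. -/
def Plane.det (a b : Plane) : ℝ := a.1 * b.2 - a.2 * b.1

namespace IsFaceUnion

open Topology Filter

variable {F K : Set Plane}

theorem tendsto_add_smul (x w : Plane) : Tendsto (fun ε : ℝ => x + ε • w) (𝓝[>] 0) (𝓝 x) := by
  have : Tendsto (fun ε : ℝ => x + ε • w) (𝓝 0) (𝓝 (x + (0 : ℝ) • w)) :=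
    (by fun_prop : Continuous fun ε : ℝ => x + ε • w).tendsto 0
  simpa using this.mono_left nhdsWithin_le_nhds

theorem mem_closure_of_eventually {C : Set Plane} {x w : Plane}
    (h : ∀ᶠ ε : ℝ in 𝓝[>] 0, x + ε • w ∈ C) : x ∈ closure C :=
  mem_closure_of_tendsto (tendsto_add_smul x w) h

theorem eventually_affine_ne (c : ℝ) {d : ℝ} (hd : d ≠ 0) :
    ∀ᶠ ε : ℝ in 𝓝[>] 0, c + ε * d ≠ 0 := by
  rcases eq_or_ne c 0 with rfl | hc
  · filter_upwards [self_mem_nhdsWithin] with ε hε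
    simpa [hd] using (Set.mem_Ioi.1 hε).ne'
  · have : Tendsto (fun ε : ℝ => c + ε * d) (𝓝 0) (𝓝 (c + 0 * d)) :=
      (by fun_prop : Continuous fun ε : ℝ => c + ε * d).tendsto 0
    rw [zero_mul, add_zero] at this
    exact (this.mono_left nhdsWithin_le_nhds).eventually_ne hc

theorem convex_det_pos (d z : Plane) (c : ℝ) : Convex ℝ {x : Plane | 0 < c * Plane.det d (x - z)} := by
  intro x hx y hy s t hs ht hst
  simp only [Set.mem_ofPred_eq, Plane.det, Prod.fst_sub, Prod.snd_sub, Prod.fst_add, Prod.snd_add,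
    Prod.smul_fst, Prod.smul_snd, smul_eq_mul] at hx hy ⊢
  have : c * (d.1 * (s * x.2 + t * y.2 - z.2) - d.2 * (s * x.1 + t * y.1 - z.1)) =
      s * (c * (d.1 * (x.2 - z.2) - d.2 * (x.1 - z.1))) +
      t * (c * (d.1 * (y.2 - z.2) - d.2 * (y.1 - z.1))) := by
    have : t = 1 - s := by linarith
    subst this; ring
  rw [this]
  rcases hs.eq_or_lt with rfl | hs'
  · obtain rfl : t = 1 := by linarith
    simpa using hy
  · have := mul_pos hs' hx
    have := mul_nonneg ht hy.le
    linarith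

/-- Near the common endpoint `z` of two segments, the closure of a face that contains `z` contains
both segments. -/
theorem eventually_mem_closure_of_corner (h : IsFaceUnion F K) {z a b w : Plane} {D : Set Plane}
    (hD : IsClosed D) (hzD : z ∉ D) (hK : K = segment ℝ z (z + a) ∪ segment ℝ z (z + b) ∪ D)
    (hab : 0 ≤ Plane.det a b) (haw : Plane.det a w < 0) (hbw : 0 < Plane.det b w)
    (hz : z ∈ closure F) :
    ∀ᶠ x in 𝓝 z, x ∈ segment ℝ z (z + a) ∪ segment ℝ z (z + b) → x ∈ closure F := by
  obtain ⟨r, hr, hB⟩ := Metric.isOpen_iff.1 hD.isOpen_compl z hzD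
  set B := Metric.ball z r with hBdef
  have hBo : IsOpen B := Metric.isOpen_ball
  have hBc : Convex ℝ B := convex_ball z r
  -- Near `z` the complement of the two segments consists of two sectors. `C1` is the sector swept
  -- counterclockwise from `a` to `b`. The other one need not be convex, and it is covered by the
  -- half-discs `C2` and `C3`, which overlap in the direction `w`. A face near `z` therefore
  -- contains `C1` or both half-discs, and in either case it can be reached from both segments by
  -- moving along `-w` or `w`.
  let C1 : Set Plane := B ∩ ({x | 0 < 1 * Plane.det a (x - z)} ∩ {x | 0 < (-1) * Plane.det b (x - z)})
  let C2 : Set Plane := B ∩ {x | 0 < 1 * Plane.det b (x - z)}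
  let C3 : Set Plane := B ∩ {x | 0 < (-1) * Plane.det a (x - z)}
  have hC1 : Convex ℝ C1 := hBc.inter ((convex_det_pos _ _ _).inter (convex_det_pos _ _ _))
  have hC2 : Convex ℝ C2 := hBc.inter (convex_det_pos _ _ _)
  have hC3 : Convex ℝ C3 := hBc.inter (convex_det_pos _ _ _)
  have haa : ∀ d : Plane, Plane.det d d = 0 := fun d => by simp [Plane.det]; ring
  have hneg : ∀ c d : Plane, Plane.det c d = - Plane.det d c := fun c d => by simp [Plane.det]; ring
  have hseg : ∀ c x : Plane, x ∈ segment ℝ z (z + c) → ∃ t : ℝ, 0 ≤ t ∧ x = z + t • c := by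
    intro c x hx
    rw [segment_eq_image'] at hx
    obtain ⟨t, ht, rfl⟩ := hx
    exact ⟨t, ht.1, by simp⟩
  have hdet : ∀ (d c e : Plane) (t ε : ℝ),
      Plane.det d (z + t • c + ε • e - z) = t * Plane.det d c + ε * Plane.det d e := by
    intro d c e t ε; simp [Plane.det]; ring
  have hdet' : ∀ (d c : Plane) (t : ℝ), Plane.det d (z + t • c - z) = t * Plane.det d c := by
    intro d c t; simp [Plane.det]; ring
  have hdisj : ∀ C : Set Plane, C ⊆ B → (∀ t : ℝ, 0 ≤ t → z + t • a ∉ C) →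
      (∀ t : ℝ, 0 ≤ t → z + t • b ∉ C) → Disjoint C K := by
    intro C hCB ha hb
    rw [Set.disjoint_left]
    intro x hx hxK
    rw [hK] at hxK
    rcases hxK with (hx' | hx') | hx'
    · obtain ⟨t, ht, rfl⟩ := hseg _ _ hx'; exact ha t ht hx
    · obtain ⟨t, ht, rfl⟩ := hseg _ _ hx'; exact hb t ht hx
    · exact hB (hCB hx) hx'
  have hd1 : Disjoint C1 K := by
    refine hdisj _ (fun x hx => hx.1) ?_ ?_
    · rintro t ht ⟨_, hx, _⟩
      simp only [Set.mem_ofPred_eq, hdet', haa] at hx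
      linarith
    · rintro t ht ⟨_, _, hx⟩
      simp only [Set.mem_ofPred_eq, hdet', haa] at hx
      linarith
  have hd2 : Disjoint C2 K := by
    refine hdisj _ (fun x hx => hx.1) ?_ ?_
    · rintro t ht ⟨_, hx⟩
      simp only [Set.mem_ofPred_eq, hdet', hneg b a] at hx
      nlinarith
    · rintro t ht ⟨_, hx⟩
      simp only [Set.mem_ofPred_eq, hdet', haa] at hx
      linarith
  have hd3 : Disjoint C3 K := by
    refine hdisj _ (fun x hx => hx.1) ?_ ?_
    · rintro t ht ⟨_, hx⟩
      simp only [Set.mem_ofPred_eq, hdet', haa] at hx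
      linarith
    · rintro t ht ⟨_, hx⟩
      simp only [Set.mem_ofPred_eq, hdet'] at hx
      nlinarith
  have hpos : ∀ᶠ ε : ℝ in 𝓝[>] 0, 0 < ε := self_mem_nhdsWithin
  have hmemB : ∀ x ∈ B, ∀ e : Plane, ∀ᶠ ε : ℝ in 𝓝[>] 0, x + ε • e ∈ B := fun x hx e =>
    (tendsto_add_smul x e).eventually (hBo.mem_nhds hx)
  have hwm : ∀ c : Plane, Plane.det c (-w) = - Plane.det c w := fun c => by
    simp [Plane.det]; ring
  have hzB : z ∈ B := Metric.mem_ball_self hr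
  -- `C2` and `C3` lie in the same faces
  have h23 : (C2 ∩ C3).Nonempty := by
    obtain ⟨ε, h1, h2⟩ := ((hmemB z hzB w).and hpos).exists
    refine ⟨z + ε • w, ⟨h1, ?_⟩, ⟨h1, ?_⟩⟩
    · simp only [Set.mem_ofPred_eq, hdet']; nlinarith
    · simp only [Set.mem_ofPred_eq, hdet']; nlinarith
  -- a point of the face off the two lines
  have hf : C1 ⊆ F ∨ (C2 ⊆ F ∧ C3 ⊆ F) := by
    obtain ⟨f, hfB, hfF⟩ := mem_closure_iff.1 hz B hBo hzB
    have e1 : ∀ᶠ ε : ℝ in 𝓝[>] 0, f + ε • w ∈ F :=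
      (tendsto_add_smul f w).eventually (h.isOpen.mem_nhds hfF)
    have hd : ∀ (d : Plane) (ε : ℝ), Plane.det d (f + ε • w - z) =
        Plane.det d (f - z) + ε * Plane.det d w := by
      intro d ε; simp [Plane.det]; ring
    obtain ⟨ε, h1, h2, h3, h4⟩ := (e1.and ((hmemB f hfB w).and
      ((eventually_affine_ne (Plane.det a (f - z)) haw.ne).and
      (eventually_affine_ne (Plane.det b (f - z)) hbw.ne')))).exists
    rw [← hd] at h3 h4
    have c2 : (C2 ∩ F).Nonempty → C2 ⊆ F := h.subset_of_isPreconnected hC2.isPreconnected hd2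
    have c3 : (C3 ∩ F).Nonempty → C3 ⊆ F := h.subset_of_isPreconnected hC3.isPreconnected hd3
    have key2 : C2 ⊆ F → C3 ⊆ F := fun hsub => c3 (h23.mono fun x hx => ⟨hx.2, hsub hx.1⟩)
    have key3 : C3 ⊆ F → C2 ⊆ F := fun hsub => c2 (h23.mono fun x hx => ⟨hx.1, hsub hx.2⟩)
    rcases h4.lt_or_gt with h4 | h4
    · rcases h3.lt_or_gt with h3 | h3
      · have h5 := c3 ⟨_, ⟨h2, by simp only [Set.mem_ofPred_eq]; linarith⟩, h1⟩
        exact Or.inr ⟨key3 h5, h5⟩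
      · left
        exact h.subset_of_isPreconnected hC1.isPreconnected hd1
          ⟨_, ⟨h2, by simp only [Set.mem_ofPred_eq]; linarith,
            by simp only [Set.mem_ofPred_eq]; linarith⟩, h1⟩
    · have h5 := c2 ⟨_, ⟨h2, by simp only [Set.mem_ofPred_eq]; linarith⟩, h1⟩
      exact Or.inr ⟨h5, key2 h5⟩
  filter_upwards [hBo.mem_nhds hzB] with x hxB hx
  rcases hx with hx | hx <;> obtain ⟨t, ht, rfl⟩ := hseg _ _ hx <;>
    rcases ht.eq_or_lt with rfl | ht
  · simpa using hz
  · rcases hf with hf | ⟨hf2, hf3⟩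
    · refine closure_mono hf (mem_closure_of_eventually (w := -w) ?_)
      filter_upwards [hmemB _ hxB (-w), hpos] with ε h1 h2
      refine ⟨h1, ?_, ?_⟩
      · simp only [Set.mem_ofPred_eq, hdet, haa, hwm]; nlinarith
      · simp only [Set.mem_ofPred_eq, hdet, hneg b a, hwm]; nlinarith
    · refine closure_mono hf3 (mem_closure_of_eventually (w := w) ?_)
      filter_upwards [hmemB _ hxB w, hpos] with ε h1 h2
      refine ⟨h1, ?_⟩
      simp only [Set.mem_ofPred_eq, hdet, haa]; nlinarith
  · simpa using hz
  · rcases hf with hf | ⟨hf2, hf3⟩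
    · refine closure_mono hf (mem_closure_of_eventually (w := -w) ?_)
      filter_upwards [hmemB _ hxB (-w), hpos] with ε h1 h2
      refine ⟨h1, ?_, ?_⟩
      · simp only [Set.mem_ofPred_eq, hdet, hwm]; nlinarith
      · simp only [Set.mem_ofPred_eq, hdet, haa, hwm]; nlinarith
    · refine closure_mono hf2 (mem_closure_of_eventually (w := w) ?_)
      filter_upwards [hmemB _ hxB w, hpos] with ε h1 h2
      refine ⟨h1, ?_⟩
      simp only [Set.mem_ofPred_eq, hdet, haa]; nlinarith

/-- The corner lemma applies after ordering the two directions by the sign of their determinant. In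
the collinear case they are opposite, because the segments share only `z`, and a perpendicular
vector serves as `w`. -/
theorem eventually_mem_closure_of_segments (h : IsFaceUnion F K) {z u v : Plane} {D : Set Plane}
    (hD : IsClosed D) (hzD : z ∉ D) (hK : K = segment ℝ z u ∪ segment ℝ z v ∪ D)
    (hu : z ≠ u) (hv : z ≠ v) (huv : segment ℝ z u ∩ segment ℝ z v ⊆ {z})
    (hz : z ∈ closure F) :
    ∀ᶠ x in 𝓝 z, x ∈ segment ℝ z u ∪ segment ℝ z v → x ∈ closure F := by
  obtain ⟨a, rfl⟩ : ∃ a, u = z + a := ⟨u - z, by simp⟩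
  obtain ⟨b, rfl⟩ : ∃ b, v = z + b := ⟨v - z, by simp⟩
  have ha : a ≠ 0 := by simpa using hu
  have hb : b ≠ 0 := by simpa using hv
  rcases lt_trichotomy (Plane.det a b) 0 with hab | hab | hab
  · rw [Set.union_comm (segment ℝ z (z + a))] at hK ⊢
    refine h.eventually_mem_closure_of_corner (w := -(a + b)) hD hzD hK ?_ ?_ ?_ hz <;>
      simp [Plane.det] at hab ⊢ <;> linarith
  · have hsq : 0 < a.1 * a.1 + a.2 * a.2 := by
      by_contra! hle
      refine ha (Prod.ext ?_ ?_)
      · show a.1 = 0; nlinarith [mul_self_nonneg a.1, mul_self_nonneg a.2]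
      · show a.2 = 0; nlinarith [mul_self_nonneg a.1, mul_self_nonneg a.2]
    obtain ⟨l, rfl⟩ : ∃ l : ℝ, b = l • a := by
      refine ⟨(a.1 * b.1 + a.2 * b.2) / (a.1 * a.1 + a.2 * a.2), Prod.ext ?_ ?_⟩
      · simp only [Plane.det] at hab
        simp only [Prod.smul_fst, smul_eq_mul]
        rw [div_mul_eq_mul_div, eq_div_iff hsq.ne']
        linear_combination (-a.2) * hab
      · simp only [Plane.det] at hab
        simp only [Prod.smul_snd, smul_eq_mul]
        rw [div_mul_eq_mul_div, eq_div_iff hsq.ne']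
        linear_combination a.1 * hab
    have hl : l < 0 := by
      by_contra! hl
      have hl' : 0 < l := lt_of_le_of_ne hl (by rintro rfl; simp at hb)
      have hm : z + (min 1 l) • a ∈ segment ℝ z (z + a) ∩ segment ℝ z (z + l • a) := by
        rw [segment_eq_image', segment_eq_image']
        refine ⟨⟨min 1 l, ⟨by positivity, min_le_left _ _⟩, by simp⟩,
          ⟨min 1 l / l, ⟨by positivity, ?_⟩, ?_⟩⟩
        · rw [div_le_one hl']; exact min_le_right _ _
        · simp only [add_sub_cancel_left, smul_smul]
          rw [div_mul_cancel₀ _ hl'.ne']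
      have := huv hm
      simp only [Set.mem_singleton_iff, add_eq_left, smul_eq_zero, ha, or_false] at this
      have : 0 < min 1 l := by positivity
      linarith
    refine h.eventually_mem_closure_of_corner (w := (a.2, -a.1)) hD hzD hK hab.ge ?_ ?_ hz
    · simp only [Plane.det]; linarith
    · simp only [Plane.det, Prod.smul_fst, Prod.smul_snd, smul_eq_mul]; nlinarith
  · refine h.eventually_mem_closure_of_corner (w := -(a + b)) hD hzD hK hab.le ?_ ?_ hz <;>
      simp [Plane.det] at hab ⊢ <;> linarith

theorem segment_union_segment {u v y : Plane} (hy : y ∈ segment ℝ u v) :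
    segment ℝ y u ∪ segment ℝ y v = segment ℝ u v := by
  refine Set.Subset.antisymm (Set.union_subset ?_ ?_) ?_
  · exact (convex_segment u v).segment_subset hy (left_mem_segment ℝ _ _)
  · exact (convex_segment u v).segment_subset hy (right_mem_segment ℝ _ _)
  · rw [segment_eq_image'] at hy
    obtain ⟨s, hs, rfl⟩ := hy
    intro x hx
    rw [segment_eq_image'] at hx
    obtain ⟨t, ht, rfl⟩ := hx
    rcases le_total t s with hts | hts
    · left
      rcases hs.1.eq_or_lt with rfl | hs0
      · obtain rfl : t = 0 := le_antisymm hts ht.1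
        simp
      rw [segment_symm, segment_eq_image']
      refine ⟨t / s, ⟨div_nonneg ht.1 hs.1, (div_le_one hs0).2 hts⟩, ?_⟩
      simp only [add_sub_cancel_left, smul_smul, div_mul_cancel₀ _ hs0.ne']
    · right
      rcases hs.2.eq_or_lt with rfl | hs1
      · obtain rfl : t = 1 := le_antisymm ht.2 hts
        simp
      have h1 : 0 < 1 - s := by linarith
      rw [segment_eq_image']
      refine ⟨(t - s) / (1 - s), ⟨div_nonneg (by linarith) h1.le,
        (div_le_one h1).2 (by linarith [ht.2])⟩, ?_⟩
      have e1 : v - (u + s • (v - u)) = (1 - s) • (v - u) := by module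
      have e2 : u + t • (v - u) = u + s • (v - u) + (t - s) • (v - u) := by module
      simp only [e1, e2, smul_smul, div_mul_cancel₀ _ h1.ne']

theorem segment_inter_segment {u v y : Plane} (hy : y ∈ openSegment ℝ u v) :
    segment ℝ y u ∩ segment ℝ y v ⊆ {y} := by
  rcases eq_or_ne u v with rfl | huv
  · rw [openSegment_same] at hy
    obtain rfl := hy
    simp
  rw [openSegment_eq_image'] at hy
  obtain ⟨s, hs, rfl⟩ := hy
  rintro x ⟨hx, hx'⟩
  rw [segment_eq_image'] at hx hx'
  obtain ⟨a, ha, rfl⟩ := hx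
  obtain ⟨b, hb, h⟩ := hx'
  have e1 : u + s • (v - u) + b • (v - (u + s • (v - u))) -
    (u + s • (v - u) + a • (u - (u + s • (v - u)))) = (b * (1 - s) + a * s) • (v - u) := by module
  have e2 : (b * (1 - s) + a * s) • (v - u) = 0 := by
    rw [← e1, sub_eq_zero]; exact h
  rw [smul_eq_zero, sub_eq_zero, or_iff_left huv.symm] at e2
  have h1 : 0 ≤ b * (1 - s) := mul_nonneg hb.1 (by linarith [hs.2])
  have h2 : a * s = 0 := by nlinarith [mul_nonneg ha.1 hs.1.le]
  obtain rfl : a = 0 := by simpa [hs.1.ne'] using h2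
  simp

theorem segment_subset_closure {u v : Plane} (hF : openSegment ℝ u v ⊆ closure F) :
    segment ℝ u v ⊆ closure F := by
  rw [← closure_openSegment]
  exact closure_minimal hF isClosed_closure

/-- If the closure of a face contains an inner point of an arc, it contains the whole arc. -/
theorem arc_subset_closure (h : IsFaceUnion F K) {a b : Plane} {A D : Set Plane}
    (hA : IsPolygonalArc a b A) (hD : IsClosed D) (hK : K = A ∪ D) (hAD : A ∩ D ⊆ {a, b})
    {z : Plane} (hzA : z ∈ A) (hza : z ≠ a) (hzb : z ≠ b) (hz : z ∈ closure F) :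
    A ⊆ closure F := by
  obtain ⟨n, p, hn, rfl, rfl, rfl, h2, h3⟩ := hA
  have hother : ∀ s : Set ℕ, IsClosed
      (⋃ i ∈ {i | i < n ∧ i ∉ s}, segment ℝ (p i) (p (i + 1))) := by
    intro s
    refine ((Set.finite_lt_nat n).subset fun i hi => hi.1).isClosed_biUnion fun i _ => ?_
    rw [segment_eq_image]
    exact (isCompact_Icc.image (by fun_prop)).isClosed
  have hinj : ∀ i < n, ∀ j ≤ n, p i = p j → i = j := by
    have aux : ∀ i j, i < j → j ≤ n → p i ≠ p j := by
      intro i j hij hjn he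
      rcases Nat.lt_or_ge (i + 1) j with h' | h'
      · have := (h3 i (j - 1) (by omega) (by omega) (p i) (left_mem_segment ℝ _ _) (by
          rw [show j - 1 + 1 = j by omega, he]; exact right_mem_segment ℝ _ _))
        have h4 : j - 1 = i + 1 := this.1
        exact h2 (j - 1) (by omega) (by rw [← this.2, show j - 1 + 1 = j by omega, he])
      · obtain rfl : j = i + 1 := by omega
        exact h2 i (by omega) he
    intro i hi j hj he
    rcases lt_trichotomy i j with h' | h' | h'
    · exact (aux i j h' hj he).elim
    · exact h'
    · exact (aux j i h' hi.le he.symm).elim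
  -- an open segment that meets the closure is contained in it
  have hopen : ∀ i < n, ∀ x ∈ openSegment ℝ (p i) (p (i + 1)), x ∈ closure F →
      segment ℝ (p i) (p (i + 1)) ⊆ closure F := by
    intro i hi x hx hxF
    refine segment_subset_closure ?_
    refine IsPreconnected.subset_of_isClosed_of_eventually (convex_openSegment _ _).isPreconnected
      isClosed_closure ?_ ⟨x, hx, hxF⟩
    intro y hy hyF
    have hyl : y ≠ p i := fun he => h2 i hi (left_mem_openSegment_iff.1 (he ▸ hy))
    have hyr : y ≠ p (i + 1) := fun he => h2 i hi (right_mem_openSegment_iff.1 (he ▸ hy))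
    have hys := openSegment_subset_segment ℝ _ _ hy
    have hsplit : segment ℝ y (p i) ∪ segment ℝ y (p (i + 1)) = segment ℝ (p i) (p (i + 1)) :=
      segment_union_segment hys
    have hcap : segment ℝ y (p i) ∩ segment ℝ y (p (i + 1)) ⊆ {y} :=
      segment_inter_segment hy
    have hyo : ∀ j < n, j ≠ i → y ∉ segment ℝ (p j) (p (j + 1)) := by
      intro j hj hji hyj
      rcases hji.lt_or_gt with h' | h'
      · exact hyl (h3 j i h' hi y hyj hys).2
      · obtain ⟨h4, h5⟩ := h3 i j h' hj y hys hyj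
        exact hyr (by rw [h5, h4])
    have := h.eventually_mem_closure_of_segments (z := y) (u := p i) (v := p (i + 1))
      (D := D ∪ ⋃ j ∈ {j | j < n ∧ j ∉ ({i} : Set ℕ)}, segment ℝ (p j) (p (j + 1)))
      (hD.union (hother _)) ?_ ?_ hyl hyr hcap hyF
    · filter_upwards [nhdsWithin_le_nhds this, self_mem_nhdsWithin] with x hx hx'
      exact hx (by rw [hsplit]; exact openSegment_subset_segment ℝ _ _ hx')
    · rintro (h' | h')
      · rcases hAD ⟨⟨i, hi, hys⟩, h'⟩ with he | he
        · rcases Nat.eq_zero_or_pos i with rfl | hi0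
          · exact hyl he
          · exact hyo 0 (by omega) hi0.ne (by rw [he]; exact left_mem_segment ℝ _ _)
        · rcases eq_or_ne (i + 1) n with hin | hin
          · exact hyr (by rw [hin]; exact he)
          · refine hyo (n - 1) (by omega) (by omega) ?_
            rw [he, show n - 1 + 1 = n by omega]
            exact right_mem_segment ℝ _ _
      · simp only [Set.mem_iUnion] at h'
        obtain ⟨j, ⟨hj, hji⟩, hyj⟩ := h'
        exact hyo j hj hji hyj
    · rw [hK, hsplit]
      ext x'
      simp only [Set.mem_union, Set.mem_ofPred_eq, Set.mem_iUnion, Set.mem_singleton_iff]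
      constructor
      · rintro (⟨j, hj, hx'⟩ | hx')
        · by_cases hji : j = i
          · subst hji; exact Or.inl hx'
          · exact Or.inr (Or.inr ⟨j, ⟨hj, hji⟩, hx'⟩)
        · exact Or.inr (Or.inl hx')
      · rintro (hx' | hx' | ⟨j, ⟨hj, -⟩, hx'⟩)
        · exact Or.inl ⟨i, hi, hx'⟩
        · exact Or.inr hx'
        · exact Or.inl ⟨j, hj, hx'⟩
  -- the two segments at a joint in the closure are contained in it
  have hjoint : ∀ i, i + 1 < n → p (i + 1) ∈ closure F →
      segment ℝ (p i) (p (i + 1)) ⊆ closure F ∧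
      segment ℝ (p (i + 1)) (p (i + 1 + 1)) ⊆ closure F := by
    intro i hi hF
    have hcap : segment ℝ (p (i + 1)) (p i) ∩ segment ℝ (p (i + 1)) (p (i + 1 + 1)) ⊆
        {p (i + 1)} := by
      rintro x ⟨hx, hx'⟩
      rw [segment_symm] at hx
      exact (h3 i (i + 1) (by omega) hi x hx hx').2
    have hl : p (i + 1) ≠ p i := (h2 i (by omega)).symm
    have hr : p (i + 1) ≠ p (i + 1 + 1) := h2 (i + 1) hi
    have := h.eventually_mem_closure_of_segments (z := p (i + 1)) (u := p i) (v := p (i + 1 + 1))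
      (D := D ∪ ⋃ j ∈ {j | j < n ∧ j ∉ ({i, i + 1} : Set ℕ)}, segment ℝ (p j) (p (j + 1)))
      (hD.union (hother _)) ?_ ?_ hl hr hcap hF
    · have aux : ∀ v, p (i + 1) ≠ v → (segment ℝ (p (i + 1)) v ⊆
          segment ℝ (p (i + 1)) (p i) ∪ segment ℝ (p (i + 1)) (p (i + 1 + 1))) →
          ∃ x ∈ openSegment ℝ (p (i + 1)) v, x ∈ closure F := by
        intro v hv hsub
        have ht := (tendsto_add_smul (p (i + 1)) (v - p (i + 1))).eventually this
        have h1 : ∀ᶠ ε : ℝ in 𝓝[>] 0, ε ∈ Set.Ioo (0 : ℝ) 1 := Ioo_mem_nhdsGT one_pos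
        obtain ⟨ε, hε, hε1⟩ := (ht.and h1).exists
        have hmem : p (i + 1) + ε • (v - p (i + 1)) ∈ openSegment ℝ (p (i + 1)) v := by
          rw [openSegment_eq_image']
          exact ⟨ε, hε1, rfl⟩
        exact ⟨_, hmem, hε (hsub (openSegment_subset_segment ℝ _ _ hmem))⟩
      obtain ⟨x, hx, hxF⟩ := aux _ hl Set.subset_union_left
      obtain ⟨y, hy, hyF⟩ := aux _ hr Set.subset_union_right
      rw [openSegment_symm] at hx
      exact ⟨hopen i (by omega) x hx hxF, hopen (i + 1) hi y hy hyF⟩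
    · rintro (h' | h')
      · rcases hAD ⟨⟨i, by omega, right_mem_segment ℝ _ _⟩, h'⟩ with he | he
        · exact absurd (hinj (i + 1) (by omega) 0 (by omega) he) (by omega)
        · exact absurd (hinj (i + 1) (by omega) n le_rfl he) (by omega)
      · simp only [Set.mem_iUnion, Set.mem_insert_iff, Set.mem_singleton_iff, not_or] at h'
        obtain ⟨j, ⟨hj, hji, hji'⟩, hyj⟩ := h'
        rcases Nat.lt_or_gt_of_ne hji with hlt | hlt
        · have := (h3 j i hlt (by omega) _ hyj (right_mem_segment ℝ _ _)).2
          exact hl this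
        · have := (h3 (i + 1) j (by omega) hj _ (left_mem_segment ℝ _ _) hyj).2
          exact hji' (hinj _ (by omega) _ (by omega) this).symm
    · rw [hK]
      ext x
      simp only [Set.mem_union, Set.mem_ofPred_eq, Set.mem_iUnion, Set.mem_singleton_iff,
        Set.mem_insert_iff, not_or]
      rw [segment_symm ℝ (p (i + 1)) (p i)]
      constructor
      · rintro (⟨j, hj, hx⟩ | hx)
        · by_cases hji : j = i
          · subst hji; exact Or.inl (Or.inl hx)
          · by_cases hji' : j = i + 1
            · subst hji'; exact Or.inl (Or.inr hx)
            · exact Or.inr (Or.inr ⟨j, ⟨hj, hji, hji'⟩, hx⟩)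
        · exact Or.inr (Or.inl hx)
      · rintro ((hx | hx) | hx | ⟨j, ⟨hj, -⟩, hx⟩)
        · exact Or.inl ⟨i, by omega, hx⟩
        · exact Or.inl ⟨i + 1, hi, hx⟩
        · exact Or.inr hx
        · exact Or.inl ⟨j, hj, hx⟩
  have hstart : ∃ i < n, segment ℝ (p i) (p (i + 1)) ⊆ closure F := by
    obtain ⟨i, hi, hzi⟩ := hzA
    by_cases hl : z = p i
    · obtain ⟨i, rfl⟩ : ∃ j, i = j + 1 := Nat.exists_eq_add_one_of_ne_zero (by
        rintro rfl; exact hza hl)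
      exact ⟨i + 1, hi, (hjoint i hi (hl ▸ hz)).2⟩
    · by_cases hr : z = p (i + 1)
      · exact ⟨i, hi, (hjoint i (lt_of_le_of_ne hi (by rintro rfl; exact hzb hr)) (hr ▸ hz)).1⟩
      · exact ⟨i, hi, hopen i hi z (mem_openSegment_of_ne_left_right (Ne.symm hl) (Ne.symm hr) hzi)
          hz⟩
  obtain ⟨i, hi, hiF⟩ := hstart
  have hup : ∀ j, i + j < n → segment ℝ (p (i + j)) (p (i + j + 1)) ⊆ closure F := by
    intro j
    induction j with
    | zero => exact fun _ => hiF
    | succ j ih =>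
      intro hj
      exact (hjoint (i + j) hj (ih (by omega) (right_mem_segment ℝ _ _))).2
  have hdown : ∀ j ≤ i, segment ℝ (p (i - j)) (p (i - j + 1)) ⊆ closure F := by
    intro j
    induction j with
    | zero => exact fun _ => hiF
    | succ j ih =>
      intro hj
      have := ih (by omega)
      rw [show i - j = i - (j + 1) + 1 by omega] at this
      exact (hjoint (i - (j + 1)) (by omega) (this (left_mem_segment ℝ _ _))).1
  rintro x ⟨j, hj, hx⟩
  rcases le_total i j with h' | h'
  · have := hup (j - i) (by omega)
    rw [show i + (j - i) = j by omega] at this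
    exact this hx
  · have := hdown (i - j) (by omega)
    rw [show i - (i - j) = j by omega] at this
    exact this hx

end IsFaceUnion

/-! ### Existence of outer vertices and termination of peeling -/

namespace PlaneEmbedding

variable {V : Type*} [Finite V] {G : SimpleGraph V} (E : PlaneEmbedding G)

/-- If the closure of the outer face contains an inner point of an edge, it contains the edge. -/
theorem arc_subset_closure_outerFace {S : Set V} {u v : V} (huv : G.Adj u v) (hu : u ∈ S)
    (hv : v ∈ S) {z : Plane} (hzA : z ∈ E.arc s(u, v)) (hzu : z ≠ E.pt u) (hzv : z ≠ E.pt v)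
    (hz : z ∈ closure (E.outerFace S)) : E.arc s(u, v) ⊆ closure (E.outerFace S) := by
  refine (E.outerFace_isFaceUnion S).arc_subset_closure (E.arc_isPolygonalArc u v huv)
    (D := E.pt '' S ∪ ⋃ e ∈ {e ∈ G.edgeSet | (∀ v ∈ e, v ∈ S) ∧ e ≠ s(u, v)}, E.arc e)
    ?_ ?_ ?_ hzA hzu hzv hz
  · refine (S.toFinite.image _).isClosed.union ?_
    exact (Set.toFinite _).isClosed_biUnion fun e he => (E.arc_isCompact he.1).isClosed
  · ext x
    simp only [carrier, Set.mem_union, Set.mem_iUnion, Set.mem_ofPred_eq]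
    constructor
    · rintro (h | ⟨e, he, hS, hx⟩)
      · exact Or.inr (Or.inl h)
      · by_cases h' : e = s(u, v)
        · subst h'; exact Or.inl hx
        · exact Or.inr (Or.inr ⟨e, ⟨he, hS, h'⟩, hx⟩)
    · rintro (h | h | ⟨e, ⟨he, hS, -⟩, hx⟩)
      · exact Or.inr ⟨_, huv, by simp [hu, hv], h⟩
      · exact Or.inl h
      · exact Or.inr ⟨e, he, hS, hx⟩
  · rintro x ⟨hx, hx' | hx'⟩
    · obtain ⟨w, hw, rfl⟩ := hx'
      have := E.mem_of_pt_mem_arc _ huv w hx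
      rcases Sym2.mem_iff.1 this with rfl | rfl <;> simp
    · simp only [Set.mem_iUnion] at hx'
      obtain ⟨e, ⟨he, -, hne⟩, hxe⟩ := hx'
      obtain ⟨w, hw, -, rfl⟩ := E.arc_inter_arc _ huv e he hne.symm x hx hxe
      rcases Sym2.mem_iff.1 hw with rfl | rfl <;> simp

/-- The outer face is neither empty nor the whole plane, so it has a frontier point, which lies on
the drawing. If that point is inside an edge, the edge and hence its endpoints are in the closure of
the outer face. -/
theorem outerVertices_nonempty {S : Set V} (hS : S.Nonempty) : (E.outerVertices S).Nonempty := by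
  have hF := E.outerFace_isFaceUnion S
  have hne : E.outerFace S ≠ Set.univ := by
    obtain ⟨v, hv⟩ := hS
    intro h
    exact Set.disjoint_left.1 hF.disjoint (h ▸ Set.mem_univ (E.pt v)) (E.pt_mem_carrier hv)
  obtain ⟨x, hx⟩ := nonempty_frontier_iff.2 ⟨E.outerFace_nonempty S, hne⟩
  rw [hF.isOpen.frontier_eq] at hx
  rcases (hF.closure_subset hx.1).resolve_left hx.2 with ⟨v, hv, rfl⟩ | ⟨e, he, hS', hxe⟩
  · exact ⟨v, hv, hx.1⟩
  · induction e with
    | h u v =>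
      have hu : u ∈ S := hS' u (by simp)
      have hv : v ∈ S := hS' v (by simp)
      by_cases hxu : x = E.pt u
      · subst hxu; exact ⟨u, hu, hx.1⟩
      by_cases hxv : x = E.pt v
      · subst hxv; exact ⟨v, hv, hx.1⟩
      exact ⟨u, hu, E.arc_subset_closure_outerFace he hu hv hxe hxu hxv hx.1
        (E.pt_mem_arc he (by simp))⟩

theorem exists_peelsIn (S : Set V) : ∃ k ≤ S.ncard, E.PeelsIn k S := by
  induction h : S.ncard using Nat.strong_induction_on generalizing S with
  | _ n ih =>
    rcases S.eq_empty_or_nonempty with rfl | hS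
    · exact ⟨0, by omega, rfl⟩
    · obtain ⟨v, hv⟩ := E.outerVertices_nonempty hS
      have hlt : (S \ E.outerVertices S).ncard < n := by
        rw [← h]
        refine Set.ncard_lt_ncard ⟨Set.sdiff_subset, fun hsub => ?_⟩ S.toFinite
        exact (hsub hv.1).2 hv
      obtain ⟨k, hk, hP⟩ := ih _ hlt _ rfl
      exact ⟨k + 1, by omega, hS, hP⟩

end PlaneEmbedding

/-! ### The discrete isoperimetric inequality -/

namespace Pixel

/-- Two pixels share at least a corner, or are equal. -/
def KingAdj (p q : Pixel) : Prop := |p.1 - q.1| ≤ 1 ∧ |p.2 - q.2| ≤ 1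

theorem card_add_two_le {s t : Finset ℤ} (hs : s.Nonempty) (hst : s ⊆ t)
    (hlt : ∀ x ∈ s, ∃ y ∈ t, x < y) (hgt : ∀ x ∈ s, ∃ y ∈ t, y < x) : s.card + 2 ≤ t.card := by
  obtain ⟨a, hat, ha⟩ := hlt _ (s.max'_mem hs)
  obtain ⟨b, hbt, hb⟩ := hgt _ (s.min'_mem hs)
  have ha' : a ∉ s := fun h => (s.le_max' a h).not_gt ha
  have hb' : b ∉ insert a s := by
    rw [Finset.mem_insert, not_or]
    refine ⟨?_, fun h => (s.min'_le b h).not_gt hb⟩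
    have := s.min'_le _ (s.max'_mem hs)
    omega
  have hsub : insert b (insert a s) ⊆ t := by
    simp [Finset.insert_subset_iff, hat, hbt, hst]
  have := Finset.card_le_card hsub
  rwa [Finset.card_insert_of_notMem hb', Finset.card_insert_of_notMem ha'] at this

/-- `T` has two pixels per occupied row of `X`: the one just right of the rightmost pixel and the
one just left of the leftmost pixel. -/
theorem exists_row_ends (X : Finset Pixel) : ∃ T : Finset Pixel, Disjoint X T ∧
    T.card = 2 * (X.image Prod.snd).card ∧
    (∀ p ∈ T, (p.1 - 1, p.2) ∈ X ∨ (p.1 + 1, p.2) ∈ X) ∧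
    (∀ p ∈ X, ∃ q ∈ T, q.2 = p.2 ∧ p.1 < q.1) ∧ (∀ p ∈ X, ∃ q ∈ T, q.2 = p.2 ∧ q.1 < p.1) := by
  have hmax : ∀ r ∈ X.image Prod.snd, ∃ x, (x, r) ∈ X ∧ ∀ p ∈ X, p.2 = r → p.1 ≤ x := by
    intro r hr
    obtain ⟨q, hq, rfl⟩ := Finset.mem_image.1 hr
    obtain ⟨m, hm, hm'⟩ := (X.filter (·.2 = q.2)).exists_max_image Prod.fst ⟨q, by simp [hq]⟩
    rw [Finset.mem_filter] at hm
    exact ⟨m.1, by rw [← hm.2]; exact hm.1, fun p hp hpr => hm' p (by simp [hp, hpr])⟩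
  have hmin : ∀ r ∈ X.image Prod.snd, ∃ x, (x, r) ∈ X ∧ ∀ p ∈ X, p.2 = r → x ≤ p.1 := by
    intro r hr
    obtain ⟨q, hq, rfl⟩ := Finset.mem_image.1 hr
    obtain ⟨m, hm, hm'⟩ := (X.filter (·.2 = q.2)).exists_min_image Prod.fst ⟨q, by simp [hq]⟩
    rw [Finset.mem_filter] at hm
    exact ⟨m.1, by rw [← hm.2]; exact hm.1, fun p hp hpr => hm' p (by simp [hp, hpr])⟩
  choose! R hR hR' using hmax
  choose! L hL hL' using hmin
  let rows := X.image Prod.snd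
  have hrow : ∀ p ∈ X, p.2 ∈ rows := fun p hp => Finset.mem_image_of_mem _ hp
  refine ⟨rows.image (fun r => (R r + 1, r)) ∪ rows.image (fun r => (L r - 1, r)), ?_, ?_, ?_, ?_,
    ?_⟩
  · rw [Finset.disjoint_left]
    intro p hp hpT
    simp only [Finset.mem_union, Finset.mem_image (s := rows)] at hpT
    rcases hpT with ⟨r, hr, rfl⟩ | ⟨r, hr, rfl⟩
    · have := hR' r hr _ hp rfl
      simp at this
    · have := hL' r hr _ hp rfl
      simp at this
  · have hinj : ∀ f : ℤ → ℤ, (rows.image fun r => (f r, r)).card = rows.card := fun f =>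
      Finset.card_image_of_injective _ fun a b h => (Prod.ext_iff.1 h).2
    rw [Finset.card_union_of_disjoint, hinj fun r => R r + 1, hinj fun r => L r - 1, two_mul]
    · rw [Finset.disjoint_left]
      intro p hp hp'
      rw [Finset.mem_image] at hp hp'
      obtain ⟨r, hr, rfl⟩ := hp
      obtain ⟨s, hs, h⟩ := hp'
      obtain ⟨h1, rfl⟩ := Prod.ext_iff.1 h
      have := hL' s hs _ (hR s hs) rfl
      simp at h1 this
      omega
  · intro p hp
    simp only [Finset.mem_union, Finset.mem_image (s := rows)] at hp
    rcases hp with ⟨r, hr, rfl⟩ | ⟨r, hr, rfl⟩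
    · left; simpa using hR r hr
    · right; simpa using hL r hr
  · intro p hp
    refine ⟨(R p.2 + 1, p.2), Finset.mem_union_left _ (Finset.mem_image_of_mem _ (hrow p hp)), rfl,
      ?_⟩
    have := hR' _ (hrow p hp) p hp rfl
    simp; omega
  · intro p hp
    refine ⟨(L p.2 - 1, p.2), Finset.mem_union_right _ (Finset.mem_image_of_mem _ (hrow p hp)), rfl,
      ?_⟩
    have := hL' _ (hrow p hp) p hp rfl
    simp; omega

theorem exists_column_ends (X : Finset Pixel) : ∃ T : Finset Pixel, Disjoint X T ∧
    T.card = 2 * (X.image Prod.fst).card ∧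
    (∀ p ∈ T, (p.1, p.2 - 1) ∈ X ∨ (p.1, p.2 + 1) ∈ X) ∧
    (∀ p ∈ X, ∃ q ∈ T, q.1 = p.1 ∧ p.2 < q.2) ∧ (∀ p ∈ X, ∃ q ∈ T, q.1 = p.1 ∧ q.2 < p.2) := by
  obtain ⟨T, h1, h2, h3, h4, h5⟩ := exists_row_ends (X.image Prod.swap)
  have hX : ∀ a b : ℤ, (a, b) ∈ X.image Prod.swap ↔ (b, a) ∈ X := by simp
  have hT : ∀ a b : ℤ, (a, b) ∈ T.image Prod.swap ↔ (b, a) ∈ T := by simp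
  refine ⟨T.image Prod.swap, ?_, ?_, ?_, ?_, ?_⟩
  · rw [Finset.disjoint_left] at h1 ⊢
    rintro ⟨a, b⟩ hp hp'
    exact h1 ((hX b a).2 hp) ((hT a b).1 hp')
  · rw [Finset.card_image_of_injective _ Prod.swap_injective, h2, Finset.image_image]
    rfl
  · rintro ⟨a, b⟩ hp
    have := h3 _ ((hT a b).1 hp)
    simpa only [hX] using this
  · rintro ⟨a, b⟩ hp
    obtain ⟨⟨c, d⟩, hq, h⟩ := h4 _ ((hX b a).2 hp)
    exact ⟨(d, c), (hT d c).2 hq, h⟩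
  · rintro ⟨a, b⟩ hp
    obtain ⟨⟨c, d⟩, hq, h⟩ := h5 _ ((hX b a).2 hp)
    exact ⟨(d, c), (hT d c).2 hq, h⟩

/-- A set of pixels that contains all outer neighbours (also the diagonal ones) of `X` is large. -/
theorem card_of_encloses {X O : Finset Pixel} (hX : X.Nonempty)
    (h : ∀ p ∈ X, ∀ q, KingAdj p q → q ∉ X → q ∈ O) :
    2 * (X.image Prod.fst).card + 2 * (X.image Prod.snd).card + 4 ≤ O.card ∧
    (X.image Prod.fst).card + 2 ≤ (O.image Prod.fst).card ∧
    (X.image Prod.snd).card + 2 ≤ (O.image Prod.snd).card := by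
  obtain ⟨T, hT1, hT2, hT3, hT4, hT5⟩ := exists_row_ends X
  -- Taking the column ends of `X ∪ T` instead of `X` makes `U` disjoint from `T` and counts two
  -- additional columns, which produces the summand 4. A pixel of `U` above or below a pixel of `T`
  -- is in general only a diagonal neighbour of `X`, hence the use of king adjacency.
  obtain ⟨U, hU1, hU2, hU3, hU4, hU5⟩ := exists_column_ends (X ∪ T)
  rw [Finset.disjoint_union_left] at hU1
  have hTO : T ⊆ O := by
    intro p hp
    have hpX : p ∉ X := Finset.disjoint_right.1 hT1 hp
    rcases hT3 p hp with h' | h' <;> exact h _ h' p (by simp [KingAdj]) hpX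
  have hUO : U ⊆ O := by
    intro p hp
    have hpX : p ∉ X := Finset.disjoint_right.1 hU1.1 hp
    have hstep : ∀ q ∈ X ∪ T, q.1 = p.1 → |q.2 - p.2| ≤ 1 → p ∈ O := by
      intro q hq hqp1 hqp2
      rcases Finset.mem_union.1 hq with hq | hq
      · exact h q hq p (by simp [KingAdj, hqp1, hqp2]) hpX
      · rcases hT3 q hq with h' | h' <;>
          exact h _ h' p (by simp [KingAdj, hqp1, hqp2]) hpX
    rcases hU3 p hp with h' | h' <;> exact hstep _ h' rfl (by simp)
  have hTU : Disjoint T U := hU1.2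
  have hcol : (X.image Prod.fst).card + 2 ≤ ((X ∪ T).image Prod.fst).card := by
    refine card_add_two_le (hX.image _) (Finset.image_subset_image Finset.subset_union_left) ?_ ?_
    · intro x hx
      obtain ⟨p, hp, rfl⟩ := Finset.mem_image.1 hx
      obtain ⟨q, hq, -, hlt⟩ := hT4 p hp
      exact ⟨q.1, Finset.mem_image_of_mem _ (Finset.mem_union_right _ hq), hlt⟩
    · intro x hx
      obtain ⟨p, hp, rfl⟩ := Finset.mem_image.1 hx
      obtain ⟨q, hq, -, hlt⟩ := hT5 p hp
      exact ⟨q.1, Finset.mem_image_of_mem _ (Finset.mem_union_right _ hq), hlt⟩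
  refine ⟨?_, ?_, ?_⟩
  · have := Finset.card_le_card (Finset.union_subset hTO hUO)
    rw [Finset.card_union_of_disjoint hTU] at this
    omega
  · refine hcol.trans (Finset.card_le_card ?_)
    intro x hx
    obtain ⟨p, hp, rfl⟩ := Finset.mem_image.1 hx
    obtain ⟨q, hq, h', -⟩ := hU4 p hp
    exact h' ▸ Finset.mem_image_of_mem _ (hUO hq)
  · refine card_add_two_le (hX.image _) ?_ ?_ ?_
    · intro x hx
      obtain ⟨p, hp, rfl⟩ := Finset.mem_image.1 hx
      obtain ⟨q, hq, h', -⟩ := hT4 p hp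
      exact h' ▸ Finset.mem_image_of_mem _ (hTO hq)
    · intro x hx
      obtain ⟨p, hp, rfl⟩ := Finset.mem_image.1 hx
      obtain ⟨q, hq, -, h'⟩ := hU4 p (Finset.mem_union_left _ hp)
      exact ⟨q.2, Finset.mem_image_of_mem _ (hUO hq), h'⟩
    · intro x hx
      obtain ⟨p, hp, rfl⟩ := Finset.mem_image.1 hx
      obtain ⟨q, hq, -, h'⟩ := hU5 p (Finset.mem_union_left _ hp)
      exact ⟨q.2, Finset.mem_image_of_mem _ (hUO hq), h'⟩

/-! ### Squares -/

theorem convex_square (p : Pixel) : Convex ℝ p.square := (convex_Icc _ _).prod (convex_Icc _ _)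

theorem isClosed_square (p : Pixel) : IsClosed p.square := isClosed_Icc.prod isClosed_Icc

theorem interior_square (p : Pixel) :
    interior p.square = Set.Ioo (p.1 : ℝ) (p.1 + 1) ×ˢ Set.Ioo (p.2 : ℝ) (p.2 + 1) := by
  rw [square, interior_prod_eq, interior_Icc, interior_Icc]

theorem closure_interior_square (p : Pixel) : closure (interior p.square) = p.square := by
  rw [interior_square, closure_prod_eq, closure_Ioo (by simp), closure_Ioo (by simp), square]

theorem eq_of_mem_interior_square {p q : Pixel} {x : Plane} (hp : x ∈ interior p.square)
    (hq : x ∈ q.square) : p = q := by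
  rw [interior_square] at hp
  obtain ⟨⟨h1, h2⟩, h3, h4⟩ := hp
  obtain ⟨⟨h5, h6⟩, h7, h8⟩ := hq
  have a1 : (p.1 : ℝ) < q.1 + 1 := by linarith
  have a2 : (q.1 : ℝ) < p.1 + 1 := by linarith
  have a3 : (p.2 : ℝ) < q.2 + 1 := by linarith
  have a4 : (q.2 : ℝ) < p.2 + 1 := by linarith
  norm_cast at a1 a2 a3 a4
  ext <;> omega

/-- A square is the closure of its interior, so an open set that meets it contains one of its inner
points, and those lie in no other square. -/
theorem square_disjoint_interior {B : Set Pixel} {p : Pixel} (hp : p ∉ B) :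
    Disjoint p.square (interior {x | ∃ q ∈ B, x ∈ q.square}) := by
  rw [Set.disjoint_left]
  intro x hx hx'
  rw [← closure_interior_square] at hx
  obtain ⟨y, hy, hy'⟩ := mem_closure_iff.1 hx _ isOpen_interior hx'
  obtain ⟨q, hq, hyq⟩ := interior_subset hy
  exact hp (eq_of_mem_interior_square hy' hyq ▸ hq)

theorem KingAdj.square_inter {p q : Pixel} (h : KingAdj p q) : (p.square ∩ q.square).Nonempty := by
  obtain ⟨h1, h2⟩ := h
  rw [abs_le] at h1 h2
  refine ⟨(((max p.1 q.1 : ℤ) : ℝ), ((max p.2 q.2 : ℤ) : ℝ)), ⟨⟨?_, ?_⟩, ⟨?_, ?_⟩⟩,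
    ⟨⟨?_, ?_⟩, ⟨?_, ?_⟩⟩⟩ <;> simp only <;> norm_cast <;> omega

theorem kingAdj_of_adj {p q : Pixel} (h : pixelGraph.Adj p q) : KingAdj p q := by
  have h : |p.1 - q.1| + |p.2 - q.2| = 1 := h
  have := abs_nonneg (p.1 - q.1)
  have := abs_nonneg (p.2 - q.2)
  constructor <;> omega

theorem isPreconnected_region {B : Set Pixel} (hB : (pixelGraph.induce B).Preconnected) :
    IsPreconnected {x | ∃ q ∈ B, x ∈ q.square} := by
  have : {x | ∃ q ∈ B, x ∈ q.square} = ⋃ q ∈ B, q.square := by ext; simp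
  rw [this]
  refine IsPreconnected.biUnion_of_reflTransGen (fun p _ => p.convex_square.isPreconnected) ?_
  intro p hp q hq
  have := (SimpleGraph.reachable_iff_reflTransGen _ _).1 (hB ⟨p, hp⟩ ⟨q, hq⟩)
  refine this.lift (fun x => x.1) (fun a b hab => ?_)
  exact ⟨(kingAdj_of_adj hab).square_inter, a.2⟩

end Pixel

/-! ### Peeling an induced embedding and counting pixels -/

namespace PixelRepresentation

variable {V : Type*} {G : SimpleGraph V} (Γ : PixelRepresentation G) {E : PlaneEmbedding G}

theorem Induces.disjoint_square {Γ : PixelRepresentation G} (h : Γ.Induces E) {u v : V}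
    (huv : G.Adj u v) {p : Pixel} (hu : p ∉ Γ.blob u) (hv : p ∉ Γ.blob v) :
    Disjoint p.square (E.arc s(u, v)) := by
  have : Γ.region u ∪ Γ.region v = {x | ∃ q ∈ {q | q ∈ Γ.blob u ∨ q ∈ Γ.blob v}, x ∈ q.square} := by
    ext x
    simp only [region, Set.mem_union, Set.mem_ofPred_eq]
    grind
  have h' := h.2 u v huv
  rw [this] at h'
  exact (Pixel.square_disjoint_interior (by simp [hu, hv])).mono_right h'

theorem Induces.pt_notMem_square {Γ : PixelRepresentation G} (h : Γ.Induces E) {v : V} {p : Pixel}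
    (hp : p ∉ Γ.blob v) : E.pt v ∉ p.square :=
  Set.disjoint_right.1 (Pixel.square_disjoint_interior (B := Γ.blob v) hp) (h.1 v)

theorem Induces.carrier_disjoint_square {Γ : PixelRepresentation G} (h : Γ.Induces E) {S : Set V}
    {p : Pixel} (hp : ∀ v ∈ S, p ∉ Γ.blob v) : Disjoint p.square (E.carrier S) := by
  rw [Set.disjoint_left]
  rintro x hx (⟨v, hv, rfl⟩ | ⟨e, he, hS, hxe⟩)
  · exact h.pt_notMem_square (hp v hv) hx
  · induction e with
    | h u v =>
      have := h.disjoint_square he (hp u (hS u (by simp))) (hp v (hS v (by simp)))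
      exact Set.disjoint_left.1 this hx hxe

theorem isPreconnected_region (v : V) : IsPreconnected (Γ.region v) :=
  Pixel.isPreconnected_region (Γ.blob_connected v).preconnected

theorem notMem_blob_of_ne {Γ : PixelRepresentation G} {u v : V} (huv : u ≠ v) {p : Pixel}
    (hp : p ∈ Γ.blob u) : p ∉ Γ.blob v :=
  Finset.disjoint_left.1 (Γ.blob_disjoint u v huv) hp

/-- A vertex whose blob touches the outer face is on the outer face. -/
theorem Induces.mem_outerVertices [Finite V] {Γ : PixelRepresentation G} (h : Γ.Induces E)
    {S : Set V} {v : V} (hv : v ∈ S) {p : Pixel} (hp : p ∈ Γ.blob v)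
    (hpF : (p.square ∩ E.outerFace S).Nonempty) : v ∈ E.outerVertices S := by
  by_contra hcon
  have hvF : E.pt v ∉ closure (E.outerFace S) := fun h' => hcon ⟨hv, h'⟩
  have hF := E.outerFace_isFaceUnion S
  -- Inside the region of `v` the drawing consists of `v` and parts of edges at `v`. If a point of
  -- it were in the closure of the outer face, then so would be the point of `v`, through the edge.
  -- Thus the connected region does not meet the frontier of the outer face and lies inside that
  -- face, although it contains a point of the drawing.
  have hsub : Γ.region v ⊆ E.outerFace S := by
    refine (Γ.isPreconnected_region v).subset_left_of_subset_union hF.isOpen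
      isClosed_closure.isOpen_compl
      (Set.disjoint_left.2 fun x hx hx' => hx' (subset_closure hx)) ?_ ?_
    · rintro x ⟨q, hq, hxq⟩
      by_cases hxF : x ∈ closure (E.outerFace S)
      · refine (hF.closure_subset hxF).imp_right fun hxK => ?_
        exfalso
        rcases hxK with ⟨w, hw, rfl⟩ | ⟨e, he, hS, hxe⟩
        · rcases eq_or_ne v w with rfl | hvw
          · exact hvF hxF
          · exact h.pt_notMem_square (notMem_blob_of_ne hvw hq) hxq
        · by_cases hve : v ∈ e
          · obtain ⟨u, rfl⟩ := Sym2.mem_iff_exists.1 hve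
            have hvu : G.Adj v u := he
            have hxv : x ≠ E.pt v := fun h' => hvF (h' ▸ hxF)
            have hxu : x ≠ E.pt u := by
              rintro rfl
              exact h.pt_notMem_square (notMem_blob_of_ne hvu.ne hq) hxq
            exact hvF (E.arc_subset_closure_outerFace hvu hv (hS u (by simp)) hxe hxv hxu hxF
              (E.pt_mem_arc he hve))
          · induction e with
            | h a b =>
              simp only [Sym2.mem_iff, not_or] at hve
              exact Set.disjoint_left.1 (h.disjoint_square he (notMem_blob_of_ne hve.1 hq)
                (notMem_blob_of_ne hve.2 hq)) hxq hxe
      · exact Or.inr hxF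
    · obtain ⟨x, hx, hxF⟩ := hpF
      exact ⟨x, ⟨p, hp, hx⟩, hxF⟩
  exact Set.disjoint_left.1 hF.disjoint (hsub (interior_subset (h.1 v))) (E.pt_mem_carrier hv)

/-- A pixel outside all blobs of `S` whose square touches the outer face belongs to it. -/
theorem Induces.square_subset_outerFace [Finite V] {Γ : PixelRepresentation G} (h : Γ.Induces E)
    {S : Set V} {p : Pixel} (hp : ∀ v ∈ S, p ∉ Γ.blob v)
    (hpF : (p.square ∩ E.outerFace S).Nonempty) : p.square ⊆ E.outerFace S :=
  (E.outerFace_isFaceUnion S).subset_of_isPreconnected p.convex_square.isPreconnected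
    (h.carrier_disjoint_square hp) hpF

open Classical in
/-- The pixels of the blobs of the vertices in `S`. -/
noncomputable def pixels [Fintype V] (S : Set V) : Finset Pixel :=
  (Finset.univ.filter (· ∈ S)).biUnion Γ.blob

theorem mem_pixels [Fintype V] {S : Set V} {p : Pixel} :
    p ∈ Γ.pixels S ↔ ∃ v ∈ S, p ∈ Γ.blob v := by
  simp [pixels]

theorem card_pixels [Fintype V] : (Γ.pixels Set.univ).card = Γ.size := by
  classical
  rw [pixels, Finset.card_biUnion fun u _ v _ h => Γ.blob_disjoint u v h, size]
  simp

/-- The blobs of the vertices that are removed in one round enclose the remaining ones. -/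
theorem Induces.exists_enclosed [Fintype V] {Γ : PixelRepresentation G} (h : Γ.Induces E)
    (S : Set V) : ∃ X : Finset Pixel, Γ.pixels (S \ E.outerVertices S) ⊆ X ∧
      ∀ p ∈ X, ∀ q, Pixel.KingAdj p q → q ∉ X → q ∈ Γ.pixels (E.outerVertices S) := by
  set O := Γ.pixels (E.outerVertices S) with hO
  obtain ⟨M, hM, hb⟩ := E.exists_carrier_bound S
  obtain ⟨N, hN⟩ := exists_nat_ge (M + 1)
  -- The pixels reached by king walks that start far away and avoid `O`; inductively, their squares
  -- lie in the outer face. `X` is the set of pixels in neither `O` nor `W`, that is, `O` excluded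
  -- and all its holes included. It is closed under king steps that avoid `O`, because a step into
  -- `W` could be reversed.
  let W : Set Pixel := {p | ∃ p₀ : Pixel, ((N : ℤ) ≤ |p₀.1| ∨ (N : ℤ) ≤ |p₀.2|) ∧ p₀ ∉ O ∧
    Relation.ReflTransGen (fun p q => Pixel.KingAdj p q ∧ q ∉ O) p₀ p}
  have hfar : ∀ p : Pixel, ((N : ℤ) ≤ |p.1| ∨ (N : ℤ) ≤ |p.2|) → p.square ⊆ E.outerFace S := by
    intro p hp x hx
    refine E.mem_outerFace_of_lt hb ?_
    obtain ⟨⟨h1, h2⟩, h3, h4⟩ := hx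
    refine hp.imp (fun hp => ?_) (fun hp => ?_)
    · rcases le_abs'.1 hp with hp | hp
      · have : (p.1 : ℝ) ≤ -N := by exact_mod_cast hp
        exact le_abs'.2 (Or.inl (by linarith))
      · have : (N : ℝ) ≤ p.1 := by exact_mod_cast hp
        exact le_abs'.2 (Or.inr (by linarith))
    · rcases le_abs'.1 hp with hp | hp
      · have : (p.2 : ℝ) ≤ -N := by exact_mod_cast hp
        exact le_abs'.2 (Or.inl (by linarith))
      · have : (N : ℝ) ≤ p.2 := by exact_mod_cast hp
        exact le_abs'.2 (Or.inr (by linarith))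
  have hnot : ∀ p : Pixel, p ∉ O → (p.square ∩ E.outerFace S).Nonempty →
      ∀ v ∈ S, p ∉ Γ.blob v := by
    intro p hp hpF v hv hpv
    exact hp (Γ.mem_pixels.2 ⟨v, h.mem_outerVertices hv hpv hpF, hpv⟩)
  have hne : ∀ p : Pixel, p.square.Nonempty := fun p => ⟨(p.1, p.2), by simp [Pixel.square]⟩
  have hWF : ∀ p ∈ W, p ∉ O ∧ p.square ⊆ E.outerFace S := by
    rintro p ⟨p₀, hp₀, hp₀', hr⟩
    induction hr with
    | refl => exact ⟨hp₀', hfar _ hp₀⟩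
    | tail _ hstep ih =>
      obtain ⟨x, hx⟩ := hstep.1.square_inter
      have hmeet : (Set.Nonempty (_ ∩ E.outerFace S)) := ⟨x, hx.2, ih.2 hx.1⟩
      exact ⟨hstep.2, h.square_subset_outerFace (hnot _ hstep.2 hmeet) hmeet⟩
  have hfin : {p : Pixel | p ∉ O ∧ p ∉ W}.Finite := by
    refine ((Set.finite_Icc (-N : ℤ) N).prod (Set.finite_Icc (-N : ℤ) N)).subset ?_
    rintro p ⟨hp, hp'⟩
    have : ¬ ((N : ℤ) ≤ |p.1| ∨ (N : ℤ) ≤ |p.2|) := fun hp₀ => hp' ⟨p, hp₀, hp, .refl⟩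
    push Not at this
    rw [abs_lt, abs_lt] at this
    simp only [Set.mem_prod, Set.mem_Icc]
    omega
  refine ⟨hfin.toFinset, ?_, ?_⟩
  · intro p hp
    obtain ⟨v, hv, hpv⟩ := Γ.mem_pixels.1 hp
    rw [Set.Finite.mem_toFinset]
    refine ⟨fun hpO => ?_, fun hpW => ?_⟩
    · obtain ⟨w, hw, hpw⟩ := Γ.mem_pixels.1 hpO
      exact notMem_blob_of_ne (by rintro rfl; exact hv.2 hw) hpv hpw
    · have := hWF p hpW
      obtain ⟨x, hx⟩ := hne p
      exact hnot p this.1 ⟨x, hx, this.2 hx⟩ v hv.1 hpv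
  · intro p hp q hpq hq
    by_contra hqO
    rw [Set.Finite.mem_toFinset] at hp hq
    have hqW : q ∈ W := by
      by_contra hqW
      exact hq ⟨hqO, hqW⟩
    obtain ⟨p₀, hp₀, hp₀', hr⟩ := hqW
    refine hp.2 ⟨p₀, hp₀, hp₀', hr.tail ⟨?_, hp.1⟩⟩
    exact ⟨by rw [abs_sub_comm]; exact hpq.1, by rw [abs_sub_comm]; exact hpq.2⟩

/-- The numbers of occupied columns and rows have to be carried through the induction, since they
determine how many pixels the next surrounding layer needs. -/
theorem Induces.card_pixels_of_peelsIn [Fintype V] {Γ : PixelRepresentation G} (h : Γ.Induces E)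
    (k : ℕ) (S : Set V) (hS : E.PeelsIn (k + 1) S) :
    4 * k * (k + 1) ≤ (Γ.pixels S).card ∧ 2 * k + 1 ≤ ((Γ.pixels S).image Prod.fst).card ∧
      2 * k + 1 ≤ ((Γ.pixels S).image Prod.snd).card := by
  induction k generalizing S with
  | zero =>
    obtain ⟨v, hv⟩ := hS.1
    obtain ⟨p, hp⟩ := (Γ.blob_connected v).nonempty
    have hne : (Γ.pixels S).Nonempty := ⟨p, Γ.mem_pixels.2 ⟨v, hv, hp⟩⟩
    refine ⟨by simp, ?_, ?_⟩ <;>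
    · rw [mul_zero, zero_add, Nat.one_le_iff_ne_zero, ← Nat.pos_iff_ne_zero]
      exact Finset.card_pos.2 (hne.image _)
  | succ k ih =>
    obtain ⟨h1, h2, h3⟩ := ih _ hS.2
    obtain ⟨X, hX, hXO⟩ := h.exists_enclosed S
    set Q' := Γ.pixels (S \ E.outerVertices S) with hQ'
    set O := Γ.pixels (E.outerVertices S) with hO
    have hXne : X.Nonempty := by
      have : 0 < (Q'.image Prod.fst).card := by omega
      exact (Finset.image_nonempty.1 (Finset.card_pos.1 this)).mono hX
    obtain ⟨h4, h5, h6⟩ := Pixel.card_of_encloses hXne hXO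
    have h7 := Finset.card_le_card (Finset.image_subset_image (f := Prod.fst) hX)
    have h8 := Finset.card_le_card (Finset.image_subset_image (f := Prod.snd) hX)
    have hOS : O ⊆ Γ.pixels S := fun p hp => by
      obtain ⟨v, hv, hpv⟩ := Γ.mem_pixels.1 hp
      exact Γ.mem_pixels.2 ⟨v, hv.1, hpv⟩
    have hQS : Q' ⊆ Γ.pixels S := fun p hp => by
      obtain ⟨v, hv, hpv⟩ := Γ.mem_pixels.1 hp
      exact Γ.mem_pixels.2 ⟨v, hv.1, hpv⟩
    have hdisj : Disjoint Q' O := by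
      rw [Finset.disjoint_left]
      intro p hp hp'
      obtain ⟨v, hv, hpv⟩ := Γ.mem_pixels.1 hp
      obtain ⟨w, hw, hpw⟩ := Γ.mem_pixels.1 hp'
      exact notMem_blob_of_ne (by rintro rfl; exact hv.2 hw) hpv hpw
    have h9 := Finset.card_le_card (Finset.union_subset hQS hOS)
    rw [Finset.card_union_of_disjoint hdisj] at h9
    have h10 := Finset.card_le_card (Finset.image_subset_image (f := Prod.fst) hOS)
    have h11 := Finset.card_le_card (Finset.image_subset_image (f := Prod.snd) hOS)
    refine ⟨?_, by omega, by omega⟩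
    -- The new layer surrounds at least `2k + 1` columns and rows, so it has at least `4(2k + 1) + 4
    -- = 8(k + 1)` pixels.
    have : 4 * (k + 1) * (k + 1 + 1) = 4 * k * (k + 1) + 8 * (k + 1) := by ring
    omega

/-- A `k`-outerplane pixel representation has at least `4k² - 4k` pixels. -/
theorem IsOuterplane.le_size [Fintype V] {Γ : PixelRepresentation G} {k : ℕ}
    (h : Γ.IsOuterplane k) : 4 * k ^ 2 - 4 * k ≤ Γ.size := by
  obtain ⟨E, hE, hk⟩ := h
  rcases k with _ | k
  · simp
  · have := (hE.card_pixels_of_peelsIn k _ hk).1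
    rw [card_pixels] at this
    refine le_trans (le_of_eq ?_) this
    rw [Nat.sub_eq_iff_eq_add (by nlinarith)]
    ring

end PixelRepresentation

/-! ### Every pixel representation induces an embedding -/

/-- Two rays from an inner point to different boundary points of a convex set meet only at their
origin. -/
theorem segment_inter_segment_of_mem_interior {C : Set Plane} (hC : Convex ℝ C) {o x y : Plane}
    (ho : o ∈ interior C) (hx : x ∈ C) (hy : y ∈ C) (hx' : x ∉ interior C) (hy' : y ∉ interior C)
    (hxy : x ≠ y) : segment ℝ o x ∩ segment ℝ o y ⊆ {o} := by
  have key : ∀ x y : Plane, y ∈ C → x ∉ interior C → ∀ s t : ℝ, 0 < s → 0 ≤ t → t < s →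
      o + s • (x - o) = o + t • (y - o) → False := by
    intro x y hy hx' s t hs ht hts h
    have hx : x = (1 - t / s) • o + (t / s) • y := by
      have h1 : x - o = (t / s) • (y - o) := by
        have := congrArg (fun z => s⁻¹ • (z - o)) h
        simp only [add_sub_cancel_left, smul_smul, inv_mul_cancel₀ hs.ne', one_smul] at this
        rw [this, inv_mul_eq_div]
      rw [← sub_add_cancel x o, h1]; module
    refine hx' (hx ▸ hC.combo_interior_self_mem_interior ho hy ?_ (div_nonneg ht hs.le) (by ring))
    rw [sub_pos, div_lt_one hs]; exact hts
  rintro z ⟨hz, hz'⟩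
  rw [segment_eq_image'] at hz hz'
  obtain ⟨s, hs, rfl⟩ := hz
  obtain ⟨t, ht, h⟩ := hz'
  simp only at h
  rcases lt_trichotomy t s with hts | rfl | hts
  · exact (key x y hy hx' s t (ht.1.trans_lt hts) ht.1 hts h.symm).elim
  · rcases ht.1.eq_or_lt with rfl | ht0
    · simp
    · refine absurd ?_ hxy
      have := smul_right_injective Plane ht0.ne' (add_left_cancel h)
      exact (sub_left_inj.1 this).symm
  · exact (key y x hx hy' t s (hs.1.trans_lt hts) hs.1 hts h).elim

/-! ### Stars of arcs inside a blob -/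

namespace Pixel

/-- The part of the plane that is covered by a set of pixels. -/
def cover (B : Set Pixel) : Set Plane := {x | ∃ p ∈ B, x ∈ p.square}

/-- The centre of a pixel. -/
noncomputable def center (p : Pixel) : Plane := ((p.1 : ℝ) + 1 / 2, (p.2 : ℝ) + 1 / 2)

theorem center_mem_interior (p : Pixel) : p.center ∈ interior p.square := by
  rw [interior_square]
  refine ⟨⟨?_, ?_⟩, ⟨?_, ?_⟩⟩ <;> simp only [center] <;> linarith

theorem square_subset_cover {B : Set Pixel} {p : Pixel} (hp : p ∈ B) : p.square ⊆ cover B :=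
  fun _ hx => ⟨p, hp, hx⟩

theorem notMem_interior_cover {B : Set Pixel} {p : Pixel} (hp : p ∉ B) {x : Plane}
    (hx : x ∈ p.square) : x ∉ interior (cover B) :=
  Set.disjoint_left.1 (square_disjoint_interior hp) hx

theorem interior_cover_disjoint {B C : Set Pixel} (h : Disjoint B C) {x : Plane}
    (hx : x ∈ interior (cover B)) : x ∉ cover C := by
  rintro ⟨p, hp, hxp⟩
  exact notMem_interior_cover (Set.disjoint_right.1 h hp) hxp hx

theorem cover_pair (p q : Pixel) : cover {p, q} = p.square ∪ q.square := by
  ext x; simp [cover]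

theorem cases_of_adj {p q : Pixel} (h : pixelGraph.Adj p q) :
    (q.1 = p.1 + 1 ∧ q.2 = p.2) ∨ (p.1 = q.1 + 1 ∧ q.2 = p.2) ∨
    (q.2 = p.2 + 1 ∧ q.1 = p.1) ∨ (p.2 = q.2 + 1 ∧ q.1 = p.1) := by
  have h : |p.1 - q.1| + |p.2 - q.2| = 1 := h
  rcases abs_cases (p.1 - q.1) with h1 | h1 <;> rcases abs_cases (p.2 - q.2) with h2 | h2 <;> omega

theorem convex_union_square {p q : Pixel} (h : pixelGraph.Adj p q) :
    Convex ℝ (p.square ∪ q.square) := by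
  have hor : ∀ a b : ℤ, Convex ℝ (square (a, b) ∪ square (a + 1, b)) := by
    intro a b
    simp only [square]
    rw [← Set.union_prod, Int.cast_add, Int.cast_one, Set.Icc_union_Icc_eq_Icc (by simp) (by simp)]
    exact (convex_Icc _ _).prod (convex_Icc _ _)
  have ver : ∀ a b : ℤ, Convex ℝ (square (a, b) ∪ square (a, b + 1)) := by
    intro a b
    simp only [square]
    rw [← Set.prod_union, Int.cast_add, Int.cast_one, Set.Icc_union_Icc_eq_Icc (by simp) (by simp)]
    exact (convex_Icc _ _).prod (convex_Icc _ _)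
  obtain ⟨a, b⟩ := p
  obtain ⟨c, d⟩ := q
  rcases cases_of_adj h with ⟨h1, h2⟩ | ⟨h1, h2⟩ | ⟨h1, h2⟩ | ⟨h1, h2⟩ <;> simp only at h1 h2 <;>
    subst h1 <;> subst h2
  · exact hor _ _
  · rw [Set.union_comm]; exact hor _ _
  · exact ver _ _
  · rw [Set.union_comm]; exact ver _ _

/-- `x` is an inner point of the common side of the adjacent pixels `p` and `q`. -/
structure IsPort (p q : Pixel) (x : Plane) : Prop where
  adj : pixelGraph.Adj p q
  left : x ∈ p.square
  right : x ∈ q.square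
  interior : x ∈ interior (cover {p, q})

theorem IsPort.symm {p q : Pixel} {x : Plane} (h : IsPort p q x) : IsPort q p x :=
  ⟨h.adj.symm, h.right, h.left, by rw [Set.pair_comm]; exact h.interior⟩

theorem IsPort.eq_or_eq {p q r : Pixel} {x : Plane} (h : IsPort p q x) (hx : x ∈ r.square) :
    r = p ∨ r = q := by
  by_contra hr
  exact notMem_interior_cover (B := {p, q}) (by simpa using hr) hx h.interior

theorem exists_isPort {p q : Pixel} (h : pixelGraph.Adj p q) : ∃ x, IsPort p q x := by
  have hmid : midpoint ℝ p.center q.center = (((p.1 : ℝ) + q.1 + 1) / 2, ((p.2 : ℝ) + q.2 + 1) / 2) := by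
    ext <;> simp [midpoint_eq_smul_add, center] <;> ring
  refine ⟨midpoint ℝ p.center q.center, h, ?_, ?_, ?_⟩
  · rw [hmid]
    rcases cases_of_adj h with ⟨h1, h2⟩ | ⟨h1, h2⟩ | ⟨h1, h2⟩ | ⟨h1, h2⟩ <;>
      refine ⟨⟨?_, ?_⟩, ⟨?_, ?_⟩⟩ <;> simp [h1, h2] <;> linarith
  · rw [hmid]
    rcases cases_of_adj h with ⟨h1, h2⟩ | ⟨h1, h2⟩ | ⟨h1, h2⟩ | ⟨h1, h2⟩ <;>
      refine ⟨⟨?_, ?_⟩, ⟨?_, ?_⟩⟩ <;> simp [h1, h2] <;> linarith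
  · rw [cover_pair]
    refine (convex_union_square h).interior.segment_subset ?_ ?_ (midpoint_mem_segment _ _)
    · exact interior_mono Set.subset_union_left p.center_mem_interior
    · exact interior_mono Set.subset_union_right q.center_mem_interior

theorem openSegment_subset_interior_of_convex {C : Set Plane} (hC : Convex ℝ C) {o x : Plane}
    (ho : o ∈ interior C) (hx : x ∈ C) : segment ℝ o x ⊆ insert x (interior C) := by
  rintro z ⟨a, b, ha, hb, hab, rfl⟩
  rcases ha.eq_or_lt with rfl | ha'
  · left
    obtain rfl : b = 1 := by linarith
    simp
  · exact Or.inr (hC.combo_interior_self_mem_interior ho hx ha' hb hab)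

/-- Arcs from a point inside `B` to the points of `X`, which meet only in that point and run
inside `B` up to their other endpoints. -/
structure StarIn (B : Set Pixel) (X : Set Plane) (o : Plane) (A : Plane → Set Plane) : Prop where
  mem : o ∈ interior (cover B)
  arc : ∀ x ∈ X, IsPolygonalArc o x (A x)
  subset : ∀ x ∈ X, A x ⊆ insert x (interior (cover B))
  inter : ∀ x ∈ X, ∀ y ∈ X, x ≠ y → A x ∩ A y ⊆ {o}

theorem exists_starIn_singleton (p : Pixel) {X : Set Plane}
    (hX : ∀ x ∈ X, ∃ q, q ≠ p ∧ IsPort p q x) :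
    ∃ A, StarIn {p} X p.center A := by
  have hcov : cover {p} = p.square := by ext; simp [cover]
  have hx' : ∀ x ∈ X, x ∉ interior p.square := by
    intro x hx
    obtain ⟨q, hq, h⟩ := hX x hx
    rw [← hcov]
    exact notMem_interior_cover (by simpa using hq) h.right
  have hxp : ∀ x ∈ X, x ∈ p.square := fun x hx => (hX x hx).choose_spec.2.left
  refine ⟨fun x => segment ℝ p.center x, ?_, ?_, ?_, ?_⟩
  · rw [hcov]; exact p.center_mem_interior
  · intro x hx
    exact IsPolygonalArc.of_ne fun h => hx' x hx (h ▸ p.center_mem_interior)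
  · intro x hx
    rw [hcov]
    exact openSegment_subset_interior_of_convex p.convex_square p.center_mem_interior (hxp x hx)
  · intro x hx y hy hxy
    exact segment_inter_segment_of_mem_interior p.convex_square p.center_mem_interior
      (hxp x hx) (hxp y hy) (hx' x hx) (hx' y hy) hxy

/-- Inductive step of the star construction. Ports on the outer sides of the new pixel `p` are
pulled back along rays from the centre of the neighbour `q`. Since the domino `p ∪ q` is convex,
these rays meet only in that centre, which is outside `p`. They cross the common side of `p` and `q`
at distinct points `Y x`, which become ports of `B`; the star of `B` is then prolonged by the pieces
of the rays in `p`. -/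
theorem exists_starIn_insert {B : Set Pixel} {p q : Pixel} (hq : q ∈ B) (hp : p ∉ B)
    (hpq : pixelGraph.Adj p q)
    (ih : ∀ X : Set Plane, X.Finite → (∀ x ∈ X, ∃ r ∈ B, ∃ s ∉ B, IsPort r s x) →
      ∃ o A, StarIn B X o A)
    {X : Set Plane} (hXf : X.Finite) (hX : ∀ x ∈ X, ∃ r ∈ insert p B, ∃ s ∉ insert p B, IsPort r s x) :
    ∃ o A, StarIn (insert p B) X o A := by
  set D := p.square ∪ q.square with hD
  have hDc : Convex ℝ D := convex_union_square hpq
  have hne : p ≠ q := hpq.ne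
  have hcD : q.center ∈ interior D := interior_mono Set.subset_union_right q.center_mem_interior
  have hDcov : D ⊆ cover (insert p B) := by
    rw [hD, ← cover_pair]
    rintro x ⟨r, hr, hx⟩
    refine ⟨r, ?_, hx⟩
    rcases hr with rfl | rfl
    · simp
    · simp [hq]
  have hcp : q.center ∉ p.square := fun h =>
    hne (eq_of_mem_interior_square q.center_mem_interior h).symm
  -- the ports on the sides of `p`
  have hP : ∀ x ∈ X, x ∈ p.square → x ∉ q.square ∧ x ∉ interior D := by
    intro x hx hxp
    obtain ⟨r, hr, s, hs, h⟩ := hX x hx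
    have hps : p ≠ s := by rintro rfl; simp at hs
    have hqs : q ≠ s := by rintro rfl; simp [hq] at hs
    have hpr : p = r := (h.eq_or_eq hxp).resolve_right hps
    refine ⟨fun hxq => ?_, ?_⟩
    · rcases h.eq_or_eq hxq with h' | h'
      · exact hne (hpr.trans h'.symm)
      · exact hqs h'
    · rw [hD, ← cover_pair]
      exact notMem_interior_cover (by simp [hps.symm, hqs.symm]) h.right
  have hY : ∀ x : Plane, x ∈ X → x ∈ p.square →
      ∃ y ∈ segment ℝ q.center x, y ∈ p.square ∧ y ∈ q.square := by
    intro x hx hxp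
    have hsub : segment ℝ q.center x ⊆ p.square ∪ q.square :=
      hDc.segment_subset (interior_subset hcD) (Or.inl hxp)
    obtain ⟨y, hy, hy'⟩ := isPreconnected_closed_iff.1
      (convex_segment (𝕜 := ℝ) q.center x).isPreconnected
      _ _ p.isClosed_square q.isClosed_square hsub ⟨x, right_mem_segment ℝ _ _, hxp⟩
      ⟨q.center, left_mem_segment ℝ _ _, interior_subset q.center_mem_interior⟩
    exact ⟨y, hy, hy'.1, hy'.2⟩
  choose! Y hYs hYp hYq using hY
  have hYint : ∀ x ∈ X, x ∈ p.square → Y x ∈ interior D := by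
    intro x hx hxp
    rcases openSegment_subset_interior_of_convex hDc hcD (Or.inl hxp) (hYs x hx hxp) with h | h
    · exact ((hP x hx hxp).1 (h ▸ hYq x hx hxp)).elim
    · exact h
  have hYseg : ∀ x ∈ X, x ∈ p.square → segment ℝ (Y x) x ⊆ segment ℝ q.center x ∩ p.square := by
    intro x hx hxp
    exact Set.subset_inter ((convex_segment _ _).segment_subset (hYs x hx hxp)
      (right_mem_segment ℝ _ _)) (p.convex_square.segment_subset (hYp x hx hxp) hxp)
  have hsegs : ∀ x ∈ X, ∀ y ∈ X, x ∈ p.square → y ∈ p.square → x ≠ y → ∀ z ∈ p.square,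
      z ∈ segment ℝ q.center x → z ∈ segment ℝ q.center y → False := by
    intro x hx y hy hxp hyp hxy z hz hzx hzy
    have := segment_inter_segment_of_mem_interior hDc hcD (Or.inl hxp) (Or.inl hyp) (hP x hx hxp).2
      (hP y hy hyp).2 hxy ⟨hzx, hzy⟩
    exact hcp (this ▸ hz)
  -- The ports for the smaller set `B`: those in the square of `p` are replaced by crossing points
  -- on the side shared with `q`, and the others are kept.
  let X' : Set Plane := Y '' {x ∈ X | x ∈ p.square} ∪ {x ∈ X | x ∉ p.square}
  have hYX' : ∀ x ∈ X, x ∈ p.square → Y x ∈ X' := fun x hx hxp => Or.inl ⟨x, ⟨hx, hxp⟩, rfl⟩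
  have hXX' : ∀ x ∈ X, x ∉ p.square → x ∈ X' := fun x hx hxp => Or.inr ⟨hx, hxp⟩
  obtain ⟨o, A, h1, h2, h3, h4⟩ := ih X' (((hXf.subset (Set.sep_subset _ _)).image _).union
    (hXf.subset (Set.sep_subset _ _))) (by
      rintro _ (⟨x, ⟨hx, hxp⟩, rfl⟩ | ⟨hx, hxp⟩)
      · refine ⟨q, hq, p, hp, hpq.symm, hYq x hx hxp, hYp x hx hxp, ?_⟩
        rw [Set.pair_comm, cover_pair]
        exact hYint x hx hxp
      · obtain ⟨r, hr, s, hs, h⟩ := hX _ hx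
        refine ⟨r, ?_, s, fun h' => hs (Set.mem_insert_of_mem _ h'), h⟩
        rcases hr with rfl | hr
        · exact (hxp h.left).elim
        · exact hr)
  have hmono : interior (cover B) ⊆ interior (cover (insert p B)) := by
    refine interior_mono ?_
    rintro x ⟨r, hr, hx⟩
    exact ⟨r, Set.mem_insert_of_mem _ hr, hx⟩
  have hpB : ∀ z ∈ p.square, z ∉ interior (cover B) := fun z hz => notMem_interior_cover hp hz
  classical
  refine ⟨o, fun x => if x ∈ p.square then A (Y x) ∪ segment ℝ (Y x) x else A x, hmono h1, ?_, ?_,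
    ?_⟩
  · intro x hx
    by_cases hxp : x ∈ p.square
    · simp only [if_pos hxp]
      refine (h2 _ (hYX' x hx hxp)).trans (IsPolygonalArc.of_ne ?_) ?_
      · intro h
        exact (hP x hx hxp).1 (h ▸ hYq x hx hxp)
      · rintro z ⟨hz, hz'⟩
        rcases h3 _ (hYX' x hx hxp) hz with h | h
        · exact h
        · exact (hpB z (hYseg x hx hxp hz').2 h).elim
    · simp only [if_neg hxp]
      exact h2 x (hXX' x hx hxp)
  · intro x hx
    by_cases hxp : x ∈ p.square
    · simp only [if_pos hxp]
      refine Set.union_subset (fun z hz => ?_) fun z hz => ?_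
      · rcases h3 _ (hYX' x hx hxp) hz with rfl | h
        · exact Or.inr (interior_mono hDcov (hYint x hx hxp))
        · exact Or.inr (hmono h)
      · exact (openSegment_subset_interior_of_convex hDc hcD (Or.inl hxp) (hYseg x hx hxp hz).1).imp_right
          fun h => interior_mono hDcov h
    · simp only [if_neg hxp]
      exact (h3 x (hXX' x hx hxp)).trans (Set.insert_subset_insert hmono)
  · have hmix : ∀ x ∈ X, ∀ y ∈ X, x ∈ p.square → y ∉ p.square →
        (A (Y x) ∪ segment ℝ (Y x) x) ∩ A y ⊆ {o} := by
      rintro x hx y hy hxp hyp z ⟨hz | hz, hz'⟩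
      · refine h4 _ (hYX' x hx hxp) _ (hXX' y hy hyp) ?_ ⟨hz, hz'⟩
        intro h
        exact hyp (h ▸ hYp x hx hxp)
      · have hzp := (hYseg x hx hxp hz).2
        rcases h3 _ (hXX' y hy hyp) hz' with rfl | h
        · exact (hyp hzp).elim
        · exact (hpB z hzp h).elim
    intro x hx y hy hxy
    by_cases hxp : x ∈ p.square <;> by_cases hyp : y ∈ p.square <;>
      simp only [hxp, hyp, if_true, if_false]
    · have hcross : ∀ x ∈ X, ∀ y ∈ X, x ∈ p.square → y ∈ p.square → x ≠ y → ∀ z ∈ A (Y x),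
          z ∈ segment ℝ (Y y) y → False := by
        intro x hx y hy hxp hyp hxy z hz hz'
        obtain ⟨hz1, hz2⟩ := hYseg y hy hyp hz'
        rcases h3 _ (hYX' x hx hxp) hz with rfl | h
        · exact hsegs x hx y hy hxp hyp hxy _ hz2 (hYs x hx hxp) hz1
        · exact hpB z hz2 h
      rintro z ⟨hz | hz, hz' | hz'⟩
      · refine h4 _ (hYX' x hx hxp) _ (hYX' y hy hyp) ?_ ⟨hz, hz'⟩
        intro h
        exact hsegs x hx y hy hxp hyp hxy _ (hYp x hx hxp) (hYs x hx hxp) (h ▸ hYs y hy hyp)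
      · exact (hcross x hx y hy hxp hyp hxy z hz hz').elim
      · exact (hcross y hy x hx hyp hxp hxy.symm z hz' hz).elim
      · obtain ⟨hz1, hz2⟩ := hYseg x hx hxp hz
        exact (hsegs x hx y hy hxp hyp hxy z hz2 hz1 (hYseg y hy hyp hz').1).elim
    · exact hmix x hx y hy hxp hyp
    · rw [Set.inter_comm]
      exact hmix y hy x hx hyp hxp
    · exact h4 _ (hXX' x hx hxp) _ (hXX' y hy hyp) hxy

/-- Induction on the number of pixels: a connected set with more than one pixel has a pixel whose
removal keeps it connected. -/
theorem exists_starIn (B : Finset Pixel) (hB : (pixelGraph.induce (B : Set Pixel)).Connected)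
    {X : Set Plane} (hXf : X.Finite)
    (hX : ∀ x ∈ X, ∃ r ∈ (B : Set Pixel), ∃ s ∉ (B : Set Pixel), IsPort r s x) :
    ∃ o A, StarIn (B : Set Pixel) X o A := by
  induction hn : B.card using Nat.strong_induction_on generalizing B X with
  | _ n ih =>
    by_cases hnt : Nontrivial (B : Set Pixel)
    · obtain ⟨⟨p, hpB⟩, hp⟩ := hB.exists_connected_induce_compl_singleton_of_finite_nontrivial
      have hB' : (pixelGraph.induce ((B.erase p : Finset Pixel) : Set Pixel)).Connected := by
        let f : ((B.erase p : Finset Pixel) : Set Pixel) ≃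
            (({⟨p, hpB⟩}ᶜ : Set (B : Set Pixel))) :=
          { toFun := fun x => ⟨⟨x.1, Finset.mem_of_mem_erase x.2⟩, fun h =>
              Finset.ne_of_mem_erase x.2 (congrArg Subtype.val h)⟩
            invFun := fun x => ⟨x.1.1, Finset.mem_erase.2
              ⟨fun h => x.2 (Subtype.ext h), x.1.2⟩⟩
            left_inv := fun x => rfl
            right_inv := fun x => rfl }
        let g : pixelGraph.induce ((B.erase p : Finset Pixel) : Set Pixel) ≃g
            (pixelGraph.induce (B : Set Pixel)).induce ({⟨p, hpB⟩}ᶜ : Set (B : Set Pixel)) :=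
          { f with map_rel_iff' := Iff.rfl }
        exact g.connected_iff.2 hp
      obtain ⟨q, hq, hpq⟩ : ∃ q ∈ B, pixelGraph.Adj p q := by
        obtain ⟨⟨r, hr⟩, hrp⟩ := exists_ne (⟨p, hpB⟩ : (B : Set Pixel))
        have := (SimpleGraph.reachable_iff_reflTransGen _ _).1
          (hB.preconnected ⟨p, hpB⟩ ⟨r, hr⟩)
        rcases Relation.ReflTransGen.cases_head this with h | ⟨c, hc, -⟩
        · exact (hrp h.symm).elim
        · exact ⟨c.1, c.2, hc⟩
      have hpB' : p ∈ B := hpB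
      have hins : (B : Set Pixel) = insert p ((B.erase p : Finset Pixel) : Set Pixel) := by
        rw [← Finset.coe_insert, Finset.insert_erase hpB']
      rw [hins] at hX ⊢
      refine exists_starIn_insert (q := q) ?_ ?_ hpq ?_ hXf hX
      · exact Finset.mem_erase.2 ⟨hpq.ne', hq⟩
      · simp
      · intro X' hX'f hX'
        exact ih _ (by rw [← hn]; exact Finset.card_erase_lt_of_mem hpB') (B.erase p) hB' hX'f hX' rfl
    · rw [not_nontrivial_iff_subsingleton, Set.subsingleton_coe] at hnt
      obtain ⟨⟨p, hp⟩⟩ := hB.nonempty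
      have hBp : (B : Set Pixel) = {p} := hnt.eq_singleton_of_mem hp
      rw [hBp] at hX ⊢
      obtain ⟨A, hA⟩ := exists_starIn_singleton p (X := X) fun x hx => by
        obtain ⟨r, rfl, s, hs, h⟩ := hX x hx
        exact ⟨s, by simpa using hs, h⟩
      exact ⟨_, A, hA⟩

end Pixel

namespace PixelRepresentation

variable {V : Type*} [Finite V] {G : SimpleGraph V}

/-- Each edge gets one port on a side shared by its two blobs. A port lies in just two squares, so
it determines its edge. A star in each blob joins an inner point to the ports of the incident edges,
and an edge is drawn as the two star arcs that end at its port. Arcs of different blobs can meet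
only at ports, and arcs of one star only at its centre. -/
theorem exists_induces (Γ : PixelRepresentation G) : ∃ E : PlaneEmbedding G, Γ.Induces E := by
  have hport : ∀ e ∈ G.edgeSet, ∃ (x : Plane) (u v : V) (p q : Pixel), e = s(u, v) ∧
      p ∈ Γ.blob u ∧ q ∈ Γ.blob v ∧ Pixel.IsPort p q x := by
    intro e he
    induction e with
    | h u v =>
      have huv : G.Adj u v := he
      obtain ⟨p, hp, q, hq, hpq⟩ := (Γ.adj_iff u v huv.ne).1 huv
      obtain ⟨x, hx⟩ := Pixel.exists_isPort hpq
      exact ⟨x, u, v, p, q, rfl, hp, hq, hx⟩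
  choose! port hport using hport
  have hport' : ∀ e ∈ G.edgeSet, ∀ u ∈ e, ∃ v p q, e = s(u, v) ∧
      p ∈ Γ.blob u ∧ q ∈ Γ.blob v ∧ Pixel.IsPort p q (port e) := by
    intro e he w hw
    obtain ⟨u, v, p, q, rfl, hp, hq, hx⟩ := hport e he
    rcases Sym2.mem_iff.1 hw with rfl | rfl
    · exact ⟨v, p, q, rfl, hp, hq, hx⟩
    · exact ⟨u, q, p, Sym2.eq_swap, hq, hp, hx.symm⟩
  have hinj : ∀ e ∈ G.edgeSet, ∀ f ∈ G.edgeSet, port e = port f → e = f := by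
    intro e he f hf hef
    obtain ⟨u, v, p, q, rfl, hp, hq, hx⟩ := hport e he
    obtain ⟨u', v', p', q', rfl, hp', hq', hx'⟩ := hport f hf
    rw [hef] at hx
    have key : ∀ {a b : V} {r : Pixel}, r ∈ Γ.blob a → r ∈ Γ.blob b → a = b := by
      intro a b r ha hb
      by_contra hab
      exact notMem_blob_of_ne hab ha hb
    rcases hx'.eq_or_eq hx.left with rfl | rfl <;> rcases hx'.eq_or_eq hx.right with rfl | rfl
    · exact (hx.adj.ne rfl).elim
    · rw [key hp hp', key hq hq']
    · rw [key hp hq', key hq hp', Sym2.eq_swap]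
    · exact (hx.adj.ne rfl).elim
  have hstar : ∀ v, ∃ o A, Pixel.StarIn (Γ.blob v : Set Pixel) (port '' {e ∈ G.edgeSet | v ∈ e}) o A := by
    intro v
    refine Pixel.exists_starIn _ (Γ.blob_connected v) ((Set.toFinite _).image _) ?_
    rintro _ ⟨e, ⟨he, hve⟩, rfl⟩
    obtain ⟨u, p, q, rfl, hp, hq, hx⟩ := hport' e he v hve
    exact ⟨p, hp, q, notMem_blob_of_ne (G.ne_of_adj he).symm hq, hx⟩
  choose o A hA using hstar
  have hblob : ∀ {u v : V}, u ≠ v → Disjoint (Γ.blob u : Set Pixel) (Γ.blob v) := fun huv =>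
    Finset.disjoint_coe.2 (Γ.blob_disjoint _ _ huv)
  have hint : ∀ {u v : V} {x : Plane}, x ∈ interior (Pixel.cover (Γ.blob u)) →
      x ∈ interior (Pixel.cover (Γ.blob v)) → u = v := by
    intro u v x hu hv
    by_contra huv
    exact Pixel.interior_cover_disjoint (hblob huv) hu (interior_subset hv)
  have hportint : ∀ e ∈ G.edgeSet, ∀ w, port e ∉ interior (Pixel.cover (Γ.blob w)) := by
    intro e he w hw
    obtain ⟨u, v, p, q, rfl, hp, hq, hx⟩ := hport e he
    have huv : u ≠ v := G.ne_of_adj he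
    rcases eq_or_ne u w with rfl | huw
    · exact Pixel.notMem_interior_cover (notMem_blob_of_ne huv.symm hq) hx.right hw
    · exact Pixel.notMem_interior_cover (notMem_blob_of_ne huw hp) hx.left hw
  have hAsub : ∀ e ∈ G.edgeSet, ∀ v ∈ e, A v (port e) ⊆
      insert (port e) (interior (Pixel.cover (Γ.blob v))) := fun e he v hv =>
    (hA v).subset _ ⟨e, ⟨he, hv⟩, rfl⟩
  have harc : ∀ u v : V, {x | ∃ w ∈ s(u, v), x ∈ A w (port s(u, v))} =
      A u (port s(u, v)) ∪ A v (port s(u, v)) := by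
    intro u v; ext x; simp
  let E : PlaneEmbedding G :=
    { pt := o
      arc := fun e => {x | ∃ v ∈ e, x ∈ A v (port e)}
      pt_injective := fun u v huv => hint (hA u).mem (huv ▸ (hA v).mem)
      arc_isPolygonalArc := by
        intro u v huv
        simp only [harc]
        refine ((hA u).arc _ ⟨_, ⟨huv, by simp⟩, rfl⟩).trans
          ((hA v).arc _ ⟨_, ⟨huv, by simp⟩, rfl⟩).symm ?_
        rintro x ⟨hx, hx'⟩
        rcases hAsub _ huv u (by simp) hx with h | h
        · exact h
        · rcases hAsub _ huv v (by simp) hx' with h' | h'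
          · exact h'
          · exact (huv.ne (hint h h')).elim
      mem_of_pt_mem_arc := by
        rintro e he w ⟨v, hv, hx⟩
        rcases hAsub e he v hv hx with h | h
        · exact (hportint e he w (h ▸ (hA w).mem)).elim
        · exact hint h (hA w).mem ▸ hv
      arc_inter_arc := by
        rintro e he f hf hef x ⟨u, hu, hx⟩ ⟨v, hv, hx'⟩
        rcases eq_or_ne u v with rfl | huv
        · refine ⟨u, hu, hv, ?_⟩
          exact (hA u).inter _ ⟨e, ⟨he, hu⟩, rfl⟩ _ ⟨f, ⟨hf, hv⟩, rfl⟩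
            (fun h => hef (hinj e he f hf h)) ⟨hx, hx'⟩
        · exfalso
          rcases hAsub e he u hu hx with h | h <;> rcases hAsub f hf v hv hx' with h' | h'
          · exact hef (hinj e he f hf (h.symm.trans h'))
          · exact hportint e he v (h ▸ h')
          · exact hportint f hf u (h' ▸ h)
          · exact huv (hint h h') }
  refine ⟨E, fun v => (hA v).mem, fun u v huv => ?_⟩
  have hsub : ∀ w ∈ s(u, v), interior (Pixel.cover (Γ.blob w)) ⊆
      interior (Γ.region u ∪ Γ.region v) := by
    intro w hw
    refine interior_mono ?_
    rcases Sym2.mem_iff.1 hw with rfl | rfl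
    · exact Set.subset_union_left
    · exact Set.subset_union_right
  rintro x ⟨w, hw, hx⟩
  rcases hAsub _ huv w hw hx with rfl | h
  · obtain ⟨v', p, q, h', hp, hq, hx⟩ := hport' s(u, v) huv u (by simp)
    obtain rfl : v = v' := Sym2.congr_right.1 h'
    refine interior_mono ?_ hx.interior
    rw [Pixel.cover_pair]
    exact Set.union_subset_union (Pixel.square_subset_cover hp) (Pixel.square_subset_cover hq)
  · exact hsub w hw h

end PixelRepresentation

/-! ### A van Kampen–Flores theorem for the complete graph on five vertices -/

namespace Plane

/-- The signed area that tells on which side of the line `ab` the point `c` is. -/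
def orient (a b c : Plane) : ℝ := Plane.det (b - a) (c - a)

open Classical in
/-- The sign of a nonzero real number, as a bit. -/
noncomputable def signBit (x : ℝ) : ZMod 2 := if x < 0 then 1 else 0

theorem signBit_neg {x : ℝ} (hx : x ≠ 0) : signBit (-x) = signBit x + 1 := by
  rcases hx.lt_or_gt with h | h
  · rw [signBit, signBit, if_neg (by linarith), if_pos h]; rfl
  · rw [signBit, signBit, if_pos (by linarith), if_neg (by linarith)]; rfl

theorem signBit_mul {x y : ℝ} (hx : x ≠ 0) (hy : y ≠ 0) :
    signBit (x * y) = signBit x + signBit y := by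
  rcases hx.lt_or_gt with h | h <;> rcases hy.lt_or_gt with h' | h'
  · rw [signBit, signBit, signBit, if_neg (mul_pos_of_neg_of_neg h h').not_gt, if_pos h, if_pos h']
    rfl
  · rw [signBit, signBit, signBit, if_pos (mul_neg_of_neg_of_pos h h'), if_pos h, if_neg h'.not_gt]
    rfl
  · rw [signBit, signBit, signBit, if_pos (mul_neg_of_pos_of_neg h h'), if_neg h.not_gt, if_pos h']
    rfl
  · rw [signBit, signBit, signBit, if_neg (mul_pos h h').not_gt, if_neg h.not_gt, if_neg h'.not_gt]
    rfl

/-- The terms `x`, `-y`, `z` add up to zero, so they cannot all have the same sign. -/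
theorem signBit_three_term {x y z : ℝ} (h : x - y + z = 0) (hx : x ≠ 0) (hy : y ≠ 0) :
    signBit x = signBit y + 1 → signBit y + 1 ≠ signBit z := by
  intro h1 h2
  rcases hx.lt_or_gt with hx | hx <;> rcases hy.lt_or_gt with hy | hy
  · rw [signBit, signBit, if_pos hx, if_pos hy] at h1; revert h1; decide
  · rw [signBit, signBit, if_neg hy.not_gt, if_neg (by linarith)] at h2; revert h2; decide
  · rw [signBit, signBit, if_pos hy, if_pos (by linarith)] at h2; revert h2; decide
  · rw [signBit, signBit, if_neg hx.not_gt, if_neg hy.not_gt] at h1; revert h1; decide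

/-- The side of the line `ab` on which `c` lies, as a bit. -/
noncomputable def side (a b c : Plane) : ZMod 2 := signBit (orient a b c)

/-- The parity of the number of crossings of the segments `ab` and `cd`, for points in general
position. -/
noncomputable def crossing (a b c d : Plane) : ZMod 2 :=
  (side a b c + side a b d) * (side c d a + side c d b)

/-- Whether `x` is inside the triangle `abc`, as a bit. -/
noncomputable def inside (x a b c : Plane) : ZMod 2 :=
  (side x a b + side x b c + 1) * (side x b c + side x c a + 1)

theorem crossing_comm (a b c d : Plane) : crossing a b c d = crossing c d a b := by
  simp only [crossing]; ring

theorem side_perm {a b c : Plane} (h : orient a b c ≠ 0) :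
    side b c a = side a b c ∧ side c a b = side a b c ∧ side b a c = side a b c + 1 ∧
    side a c b = side a b c + 1 ∧ side c b a = side a b c + 1 := by
  have e1 : orient b c a = orient a b c := by simp [orient, Plane.det]; ring
  have e2 : orient c a b = orient a b c := by simp [orient, Plane.det]; ring
  have e3 : orient b a c = - orient a b c := by simp [orient, Plane.det]; ring
  have e4 : orient a c b = - orient a b c := by simp [orient, Plane.det]; ring
  have e5 : orient c b a = - orient a b c := by simp [orient, Plane.det]; ring
  simp only [side, e1, e2, e3, e4, e5, signBit_neg h, and_self]

/-- Any three of the points with different indices are not on a line. -/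
def GeneralPosition {ι : Type*} (q : ι → Plane) : Prop :=
  ∀ i j k, i ≠ j → i ≠ k → j ≠ k → orient (q i) (q j) (q k) ≠ 0

/-- What the three-term relation `[ijk][ilm] - [ijl][ikm] + [ijm][ikl] = 0` between orientations
says about signs. -/
theorem grassmann_pluecker {ι : Type*} {q : ι → Plane} (hq : GeneralPosition q) {i j k l m : ι}
    (h : [i, j, k, l, m].Nodup) :
    side (q i) (q j) (q k) + side (q i) (q l) (q m) =
      side (q i) (q j) (q l) + side (q i) (q k) (q m) + 1 →
    side (q i) (q j) (q l) + side (q i) (q k) (q m) + 1 ≠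
      side (q i) (q j) (q m) + side (q i) (q k) (q l) := by
  simp only [List.nodup_cons, List.mem_cons, List.not_mem_nil, or_false, not_or] at h
  obtain ⟨⟨ij, ik, il, im⟩, ⟨jk, jl, jm⟩, ⟨kl, km⟩, lm, -⟩ := h
  have o1 := hq i j k ij ik jk
  have o2 := hq i l m il im lm
  have o3 := hq i j l ij il jl
  have o4 := hq i k m ik im km
  have o5 := hq i j m ij im jm
  have o6 := hq i k l ik il kl
  simp only [side]
  rw [← signBit_mul o1 o2, ← signBit_mul o3 o4, ← signBit_mul o5 o6]
  refine signBit_three_term ?_ (mul_ne_zero o1 o2) (mul_ne_zero o3 o4)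
  simp only [orient, Plane.det, Prod.fst_sub, Prod.snd_sub]
  ring

/-- The two geometric facts behind the parity argument: a segment crosses the boundary of a triangle
an odd number of times exactly when one of its ends is inside, and a straight-line drawing of `K₅`
has an odd number of crossings among its 15 pairs of disjoint edges. After normalising the order of
the points, everything depends on ten orientation bits. The five Grassmann–Plücker constraints
suffice, and the assignments are checked exhaustively. -/
theorem five_points {ι : Type*} {q : ι → Plane} (hq : GeneralPosition q) {i j k l m : ι}
    (h : [i, j, k, l, m].Nodup) :
    (crossing (q i) (q j) (q k) (q l) + crossing (q i) (q j) (q k) (q m) +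
      crossing (q i) (q j) (q l) (q m) = inside (q i) (q k) (q l) (q m) + inside (q j) (q k) (q l) (q m)) ∧
    (crossing (q i) (q j) (q k) (q l) + crossing (q i) (q j) (q k) (q m) +
      crossing (q i) (q j) (q l) (q m) + (crossing (q i) (q k) (q j) (q l) +
      crossing (q i) (q k) (q j) (q m) + crossing (q i) (q k) (q l) (q m)) +
      (crossing (q i) (q l) (q j) (q k) + crossing (q i) (q l) (q j) (q m) +
      crossing (q i) (q l) (q k) (q m)) + (crossing (q i) (q m) (q j) (q k) +
      crossing (q i) (q m) (q j) (q l) + crossing (q i) (q m) (q k) (q l)) +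
      (crossing (q j) (q k) (q l) (q m) + crossing (q j) (q l) (q k) (q m) +
      crossing (q j) (q m) (q k) (q l)) = 1) := by
  have g1 := grassmann_pluecker hq h
  simp only [List.nodup_cons, List.mem_cons, List.not_mem_nil, or_false, not_or] at h
  obtain ⟨⟨ij, ik, il, im⟩, ⟨jk, jl, jm⟩, ⟨kl, km⟩, lm, -⟩ := h
  have g2 := grassmann_pluecker hq (i := j) (j := i) (k := k) (l := l) (m := m)
    (by simp [ik, il, im, jk, jl, jm, kl, km, lm, Ne.symm ij])
  have g3 := grassmann_pluecker hq (i := k) (j := i) (k := j) (l := l) (m := m)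
    (by simp [ij, il, im, jl, jm, kl, km, lm, Ne.symm ik, Ne.symm jk])
  have g4 := grassmann_pluecker hq (i := l) (j := i) (k := j) (l := k) (m := m)
    (by simp [ij, ik, im, jk, jm, km, lm, Ne.symm il, Ne.symm jl, Ne.symm kl])
  have g5 := grassmann_pluecker hq (i := m) (j := i) (k := j) (l := k) (m := l)
    (by simp [ij, ik, il, jk, jl, kl, Ne.symm im, Ne.symm jm, Ne.symm km, Ne.symm lm])
  have o1 := side_perm (hq i j k ij ik jk)
  have o2 := side_perm (hq i j l ij il jl)
  have o3 := side_perm (hq i j m ij im jm)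
  have o4 := side_perm (hq i k l ik il kl)
  have o5 := side_perm (hq i k m ik im km)
  have o6 := side_perm (hq i l m il im lm)
  have o7 := side_perm (hq j k l jk jl kl)
  have o8 := side_perm (hq j k m jk jm km)
  have o9 := side_perm (hq j l m jl jm lm)
  have o10 := side_perm (hq k l m kl km lm)
  simp only [crossing, inside, o1, o2, o3, o4, o5, o6, o7, o8, o9, o10] at g1 g2 g3 g4 g5 ⊢
  clear o1 o2 o3 o4 o5 o6 o7 o8 o9 o10
  generalize side (q i) (q j) (q k) = s1 at *
  generalize side (q i) (q j) (q l) = s2 at *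
  generalize side (q i) (q j) (q m) = s3 at *
  generalize side (q i) (q k) (q l) = s4 at *
  generalize side (q i) (q k) (q m) = s5 at *
  generalize side (q i) (q l) (q m) = s6 at *
  generalize side (q j) (q k) (q l) = s7 at *
  generalize side (q j) (q k) (q m) = s8 at *
  generalize side (q j) (q l) (q m) = s9 at *
  generalize side (q k) (q l) (q m) = s10 at *
  clear hq ij ik il im jk jl jm kl km lm
  revert s1 s2 s3 s4 s5 s6 s7 s8 s9 s10
  set_option synthInstance.maxHeartbeats 400000 in
  set_option synthInstance.maxSize 4000 in
  decide +kernel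

/-- If each segment has its ends on both sides of the line through the other, the ratios of the
signed areas locate a common point. -/
theorem crossing_eq_zero_of_disjoint {a b c d : Plane} (h1 : orient a b c ≠ 0)
    (h2 : orient a b d ≠ 0) (h3 : orient c d a ≠ 0) (h4 : orient c d b ≠ 0)
    (h : Disjoint (segment ℝ a b) (segment ℝ c d)) : crossing a b c d = 0 := by
  have hsep : ∀ {x y : ℝ}, x ≠ 0 → y ≠ 0 → signBit x + signBit y ≠ 0 →
      0 ≤ x / (x - y) ∧ x / (x - y) ≤ 1 ∧ x - y ≠ 0 := by
    intro x y hx hy hxy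
    rcases hx.lt_or_gt with hx | hx <;> rcases hy.lt_or_gt with hy | hy
    · rw [signBit, signBit, if_pos hx, if_pos hy] at hxy; exact (hxy rfl).elim
    · have : x - y < 0 := by linarith
      exact ⟨div_nonneg_of_nonpos hx.le this.le, (div_le_one_of_neg this).2 (by linarith), this.ne⟩
    · have : 0 < x - y := by linarith
      exact ⟨div_nonneg hx.le this.le, (div_le_one this).2 (by linarith), this.ne'⟩
    · rw [signBit, signBit, if_neg hx.not_gt, if_neg hy.not_gt] at hxy; exact (hxy (by simp)).elim
  by_contra hne
  have hne1 : side a b c + side a b d ≠ 0 := fun h0 => hne (by rw [crossing, h0, zero_mul])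
  have hne2 : side c d a + side c d b ≠ 0 := fun h0 => hne (by rw [crossing, h0, mul_zero])
  obtain ⟨s0, s1, s2⟩ := hsep h1 h2 hne1
  obtain ⟨t0, t1, t2⟩ := hsep h3 h4 hne2
  have e : c + (orient a b c / (orient a b c - orient a b d)) • (d - c) =
      a + (orient c d a / (orient c d a - orient c d b)) • (b - a) := by
    have e1 : orient c d a - orient c d b = -(orient a b c - orient a b d) := by
      simp [orient, Plane.det]; ring
    rw [e1] at t2 ⊢
    ext
    · simp only [Prod.fst_add, Prod.smul_fst, Prod.fst_sub, smul_eq_mul]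
      rw [div_neg]
      field_simp
      simp only [orient, Plane.det, Prod.fst_sub, Prod.snd_sub]
      ring
    · simp only [Prod.snd_add, Prod.smul_snd, Prod.snd_sub, smul_eq_mul]
      rw [div_neg]
      field_simp
      simp only [orient, Plane.det, Prod.fst_sub, Prod.snd_sub]
      ring
  have hmem : c + (orient a b c / (orient a b c - orient a b d)) • (d - c) ∈ segment ℝ c d := by
    rw [segment_eq_image']; exact ⟨_, ⟨s0, s1⟩, rfl⟩
  refine Set.disjoint_left.1 h ?_ hmem
  rw [e, segment_eq_image']; exact ⟨_, ⟨t0, t1⟩, rfl⟩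

/-! #### Chains of segments -/

section Chain

variable {ι : Type*} (q : ι → Plane)

/-- The parity of the number of crossings of two chains of segments. -/
noncomputable def chainCrossing (L M : List (ι × ι)) : ZMod 2 :=
  (L.map fun s => (M.map fun t => crossing (q s.1) (q s.2) (q t.1) (q t.2)).sum).sum

/-- The chain has the endpoints `a` and `b`. -/
def IsChain (a b : ι) (L : List (ι × ι)) : Prop :=
  ∀ h : ι → ZMod 2, (L.map fun s => h s.1 + h s.2).sum = h a + h b

/-- The segments of the chain are nondegenerate and have endpoints in `A`. -/
def ChainIn (A : Set ι) (L : List (ι × ι)) : Prop := ∀ s ∈ L, s.1 ∈ A ∧ s.2 ∈ A ∧ s.1 ≠ s.2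

theorem list_sum_add {α : Type*} (L : List α) (f g : α → ZMod 2) :
    (L.map fun s => f s + g s).sum = (L.map f).sum + (L.map g).sum := by
  induction L with
  | nil => simp
  | cons a L ih => simp only [List.map_cons, List.sum_cons, ih]; ring

theorem list_sum_comm {α β : Type*} (L : List α) (M : List β) (f : α → β → ZMod 2) :
    (L.map fun s => (M.map fun t => f s t).sum).sum =
      (M.map fun t => (L.map fun s => f s t).sum).sum := by
  induction L with
  | nil => simp
  | cons a L ih => simp only [List.map_cons, List.sum_cons, ih, list_sum_add]

theorem chainCrossing_comm (L M : List (ι × ι)) :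
    chainCrossing q L M = chainCrossing q M L := by
  rw [chainCrossing, list_sum_comm, chainCrossing]
  simp only [crossing_comm]

theorem chainCrossing_append_right (L M N : List (ι × ι)) :
    chainCrossing q L (M ++ N) = chainCrossing q L M + chainCrossing q L N := by
  simp only [chainCrossing, List.map_append, List.sum_append, list_sum_add]

theorem chainCrossing_append_left (L M N : List (ι × ι)) :
    chainCrossing q (L ++ M) N = chainCrossing q L N + chainCrossing q M N := by
  simp only [chainCrossing, List.map_append, List.sum_append]

variable {q}

/-- Two closed chains cross an even number of times. Coning `M` from the extra point `z`, the
crossing of a segment `s` of `L` with a segment `t` of `M` is the crossing of `s` with the triangle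
`z t`, corrected by the two spokes. The spokes cancel because `M` is closed. The triangle terms
become a sum of values of `J` at the ends of `s`, and these cancel because `L` is closed. -/
theorem chainCrossing_closed (hq : GeneralPosition q) {z : ι} {A C : Set ι} (hAC : Disjoint A C)
    (hzA : z ∉ A) (hzC : z ∉ C) {L M : List (ι × ι)} (hL : ChainIn A L) (hM : ChainIn C M)
    (hL' : ∀ h : ι → ZMod 2, (L.map fun s => h s.1 + h s.2).sum = 0)
    (hM' : ∀ h : ι → ZMod 2, (M.map fun s => h s.1 + h s.2).sum = 0) :
    chainCrossing q L M = 0 := by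
  let J : ι → ZMod 2 := fun x => (M.map fun t => inside (q x) (q z) (q t.1) (q t.2)).sum
  rw [← hL' J, chainCrossing]
  congr 1
  refine List.map_congr_left fun s hs => ?_
  obtain ⟨s1, s2, s3⟩ := hL s hs
  rw [← add_zero (List.sum _), ← hM' fun x => crossing (q s.1) (q s.2) (q z) (q x), ← list_sum_add,
    ← list_sum_add]
  congr 1
  refine List.map_congr_left fun t ht => ?_
  obtain ⟨t1, t2, t3⟩ := hM t ht
  have hne : ∀ {x y}, x ∈ A → y ∈ C → x ≠ y := fun hx hy h =>
    Set.disjoint_left.1 hAC hx (h ▸ hy)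
  have hnA : ∀ {x}, x ∈ A → x ≠ z := fun hx h => hzA (h ▸ hx)
  have hnC : ∀ {x}, x ∈ C → z ≠ x := fun hx h => hzC (h ▸ hx)
  rw [← (five_points hq (i := s.1) (j := s.2) (k := z) (l := t.1) (m := t.2) (by
    simp [s3, hnA s1, hnA s2, hne s1 t1, hne s1 t2, hne s2 t1, hne s2 t2, hnC t1, hnC t2, t3])).1]
  ring

end Chain

end Plane

/-! ### From crossing parities to connected sets -/

namespace Plane

open Topology Filter

/-- The points are moved along vectors `(f i, f i ^ 2)` of a parabola. Each orientation becomes a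
polynomial of degree two in the time `t`, whose leading coefficient is a nonzero Vandermonde
product, so it does not vanish for small positive `t`. -/
theorem exists_generalPosition {ι : Type*} [Finite ι] (q : ι → Plane) {ε : ℝ} (hε : 0 < ε) :
    ∃ q' : ι → Plane, GeneralPosition q' ∧ ∀ i, dist (q i) (q' i) < ε := by
  obtain ⟨n, ⟨e⟩⟩ := Finite.exists_equiv_fin ι
  let f : ι → ℝ := fun i => ((e i : ℕ) : ℝ)
  have hf : ∀ i j, i ≠ j → f i ≠ f j := by
    intro i j hij h
    exact hij (e.injective (Fin.ext (Nat.cast_injective h)))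
  let r : ℝ → ι → Plane := fun t i => q i + t • (f i, f i ^ 2)
  have h1 : ∀ i j k, i ≠ j → i ≠ k → j ≠ k →
      ∀ᶠ t in 𝓝[>] (0 : ℝ), orient (r t i) (r t j) (r t k) ≠ 0 := by
    intro i j k hij hik hjk
    have hV : (f j - f i) * (f k - f i) * (f k - f j) ≠ 0 :=
      mul_ne_zero (mul_ne_zero (sub_ne_zero.2 (hf _ _ hij.symm)) (sub_ne_zero.2 (hf _ _ hik.symm)))
        (sub_ne_zero.2 (hf _ _ hjk.symm))
    set V := (f j - f i) * (f k - f i) * (f k - f j) with hVdef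
    obtain ⟨c, hc⟩ : ∃ c, ∀ t, orient (r t i) (r t j) (r t k) =
        orient (q i) (q j) (q k) + t * (c + t * V) := by
      refine ⟨((q j).1 - (q i).1) * (f k ^ 2 - f i ^ 2) + (f j - f i) * ((q k).2 - (q i).2) -
        (((q j).2 - (q i).2) * (f k - f i) + (f j ^ 2 - f i ^ 2) * ((q k).1 - (q i).1)), fun t => ?_⟩
      simp only [r, orient, Plane.det, Prod.fst_sub, Prod.snd_sub, Prod.fst_add, Prod.snd_add,
        Prod.smul_fst, Prod.smul_snd, smul_eq_mul, hVdef]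
      ring
    simp only [hc]
    rcases eq_or_ne (orient (q i) (q j) (q k)) 0 with h0 | h0
    · filter_upwards [IsFaceUnion.eventually_affine_ne c hV, self_mem_nhdsWithin] with t ht ht0
      rw [h0, zero_add]
      exact mul_ne_zero (Set.mem_Ioi.1 ht0).ne' ht
    · have : Tendsto (fun t : ℝ => orient (q i) (q j) (q k) + t * (c + t * V)) (𝓝 0)
          (𝓝 (orient (q i) (q j) (q k) + 0 * (c + 0 * V))) :=
        (by fun_prop : Continuous fun t : ℝ => orient (q i) (q j) (q k) + t * (c + t * V)).tendsto 0
      rw [zero_mul, add_zero] at this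
      exact (this.mono_left nhdsWithin_le_nhds).eventually_ne h0
  have h2 : ∀ i, ∀ᶠ t in 𝓝[>] (0 : ℝ), dist (q i) (r t i) < ε := by
    intro i
    have := (IsFaceUnion.tendsto_add_smul (q i) (f i, f i ^ 2)).eventually
      (Metric.ball_mem_nhds (q i) hε)
    filter_upwards [this] with t ht
    rw [dist_comm]
    exact ht
  have h3 : ∀ᶠ t in 𝓝[>] (0 : ℝ), GeneralPosition (r t) := by
    simp only [GeneralPosition, eventually_all]
    exact h1
  obtain ⟨t, ht, ht'⟩ := (h3.and (eventually_all.2 h2)).exists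
  exact ⟨r t, ht, ht'⟩

/-- A connected set can be walked through in small steps. All large lengths `N` are allowed, so that
finitely many walks can be given a common length. -/
theorem exists_steps {W : Set Plane} (hW : IsPreconnected W) {a b : Plane} (ha : a ∈ W) (hb : b ∈ W)
    {ε : ℝ} (hε : 0 < ε) : ∃ n, ∀ N ≥ n, ∃ x : ℕ → Plane, x 0 = a ∧ x N = b ∧ (∀ t, x t ∈ W) ∧
      ∀ t, dist (x t) (x (t + 1)) < ε := by
  have key : Relation.ReflTransGen (fun x y => y ∈ W ∧ dist x y < ε) a b := by
    refine hW.induction₂' (fun x y => Relation.ReflTransGen (fun x y => y ∈ W ∧ dist x y < ε) x y)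
      ?_ (fun _ _ _ _ _ _ h h' => h.trans h') ha hb
    intro x hx
    filter_upwards [nhdsWithin_le_nhds (Metric.ball_mem_nhds x hε), self_mem_nhdsWithin] with y hy hyW
    exact ⟨.single ⟨hyW, by rw [dist_comm]; exact hy⟩, .single ⟨hx, hy⟩⟩
  induction key with
  | refl => exact ⟨0, fun N _ => ⟨fun _ => a, rfl, rfl, fun _ => ha, fun _ => by simpa using hε⟩⟩
  | @tail c d _ hcd ih =>
    by_cases hc : c ∈ W
    · obtain ⟨n, hn⟩ := ih hc
      refine ⟨n + 1, fun N hN => ?_⟩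
      obtain ⟨x, hx0, hxn, hxW, hxd⟩ := hn n le_rfl
      refine ⟨fun t => if t ≤ n then x t else d, by simp [hx0], if_neg (by omega), ?_, ?_⟩
      · intro t
        dsimp only
        split_ifs
        · exact hxW t
        · exact hcd.1
      · intro t
        dsimp only
        rcases lt_trichotomy t n with h | rfl | h
        · rw [if_pos h.le, if_pos (Nat.succ_le_of_lt h)]; exact hxd t
        · rw [if_pos le_rfl, if_neg (by omega), hxn]; exact hcd.2
        · rw [if_neg (by omega), if_neg (by omega)]; simpa using hε
    · rename_i hr
      refine absurd ?_ hc
      rcases Relation.ReflTransGen.cases_tail hr with rfl | ⟨e, -, he⟩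
      · exact ha
      · exact he.1

theorem sum_castSucc_add_succ (N : ℕ) (h : Fin (N + 1) → ZMod 2) :
    ((List.finRange N).map fun t => h t.castSucc + h t.succ).sum = h 0 + h (Fin.last N) := by
  rw [← Fin.sum_univ_def]
  induction N with
  | zero => simp [CharTwo.add_self_eq_zero]
  | succ N ih =>
    rw [Fin.sum_univ_castSucc]
    have := ih fun t => h t.castSucc
    simp only [Fin.succ_castSucc] at this ⊢
    rw [this]
    simp only [Fin.castSucc_zero, Fin.succ_last]
    have h2 : (2 : ZMod 2) = 0 := rfl
    linear_combination h (Fin.last N).castSucc * h2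

/-- Ten chains that join five points in pairs cannot avoid each other: some two chains without a
common endpoint cross. -/
theorem false_of_chains {ι : Type*} {q : ι → Plane} (hq : GeneralPosition q) (V : Fin 5 → ι)
    (hV : Function.Injective V) (z : ι) (L : Fin 5 → Fin 5 → List (ι × ι))
    (A : Fin 5 → Fin 5 → Set ι) (hVA : ∀ i j, V i ∈ A i j ∧ V j ∈ A i j)
    (hz : ∀ i j, z ∉ A i j) (hL : ∀ i j, i < j → IsChain (V i) (V j) (L i j))
    (hLA : ∀ i j, i < j → ChainIn (A i j) (L i j))
    (hA : ∀ i j k l, i < j → k < l → i ≠ k → i ≠ l → j ≠ k → j ≠ l → Disjoint (A i j) (A k l))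
    (hL0 : ∀ i j k l, i < j → k < l → i ≠ k → i ≠ l → j ≠ k → j ≠ l →
      chainCrossing q (L i j) (L k l) = 0) : False := by
  have h2 : (2 : ZMod 2) = 0 := rfl
  let S : Fin 5 → Fin 5 → List (ι × ι) := fun i j => [(V i, V j)]
  have hSA : ∀ i j, i < j → ChainIn (A i j) (S i j) := by
    intro i j hij s hs
    obtain rfl : s = (V i, V j) := by simpa [S] using hs
    exact ⟨(hVA i j).1, (hVA i j).2, fun h => hij.ne (hV h)⟩
  have happ : ∀ {B : Set ι} {L M : List (ι × ι)}, ChainIn B L → ChainIn B M → ChainIn B (L ++ M) := by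
    intro B L M h h' s hs
    rcases List.mem_append.1 hs with hs | hs
    · exact h s hs
    · exact h' s hs
  have hclosed : ∀ i j, i < j → ∀ h : ι → ZMod 2,
      ((L i j ++ S i j).map fun s => h s.1 + h s.2).sum = 0 := by
    intro i j hij h
    rw [List.map_append, List.sum_append, hL i j hij h]
    simp only [S, List.map_cons, List.map_nil, List.sum_cons, List.sum_nil]
    linear_combination (h (V i) + h (V j)) * h2
  have hcl : ∀ i j, i < j → ChainIn (A i j) (L i j ++ S i j) := fun i j hij =>
    happ (hLA i j hij) (hSA i j hij)
  -- Each chain `L` closed up by its straight edge `S` is a closed chain. Two of these on disjoint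
  -- pairs cross evenly, and their `L`-`L` part vanishes by hypothesis.
  have key1 : ∀ i j k l, i < j → k < l → i ≠ k → i ≠ l → j ≠ k → j ≠ l →
      chainCrossing q (S i j) (S k l) =
        chainCrossing q (L i j) (S k l) + chainCrossing q (L k l) (S i j) := by
    intro i j k l hij hkl ik il jk jl
    have := chainCrossing_closed hq (hA i j k l hij hkl ik il jk jl) (hz i j) (hz k l) (hcl i j hij)
      (hcl k l hkl) (hclosed i j hij) (hclosed k l hkl)
    rw [chainCrossing_append_left, chainCrossing_append_right, chainCrossing_append_right,
      hL0 i j k l hij hkl ik il jk jl, chainCrossing_comm q (S i j) (L k l)] at this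
    linear_combination this - (chainCrossing q (L i j) (S k l) +
      chainCrossing q (L k l) (S i j)) * h2
  -- The same closed chain also crosses the straight triangle on the other three points evenly.
  have key2 : ∀ i j k l m, i < j → k < l → l < m → i ≠ k → i ≠ l → i ≠ m → j ≠ k → j ≠ l → j ≠ m →
      chainCrossing q (L i j) (S k l) + chainCrossing q (L i j) (S k m) +
        chainCrossing q (L i j) (S l m) = chainCrossing q (S i j) (S k l) +
        chainCrossing q (S i j) (S k m) + chainCrossing q (S i j) (S l m) := by
    intro i j k l m hij hkl hlm ik il im jk jl jm
    have hkm := hkl.trans hlm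
    have := chainCrossing_closed hq (z := z) (A := A i j) (C := A k l ∪ A k m ∪ A l m)
      (L := L i j ++ S i j) (M := S k l ++ S k m ++ S l m) ?_ (hz i j) ?_ (hcl i j hij) ?_
      (hclosed i j hij) ?_
    · simp only [chainCrossing_append_left, chainCrossing_append_right] at this
      linear_combination this - (chainCrossing q (S i j) (S k l) +
        chainCrossing q (S i j) (S k m) + chainCrossing q (S i j) (S l m)) * h2
    · exact ((hA i j k l hij hkl ik il jk jl).union_right
        (hA i j k m hij hkm ik im jk jm)).union_right (hA i j l m hij hlm il im jl jm)
    · rintro ((h | h) | h)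
      · exact hz _ _ h
      · exact hz _ _ h
      · exact hz _ _ h
    · refine happ (happ ?_ ?_) ?_
      · exact fun s hs => (hSA k l hkl s hs).imp (fun h => Or.inl (Or.inl h))
          (And.imp (fun h => Or.inl (Or.inl h)) id)
      · exact fun s hs => (hSA k m hkm s hs).imp (fun h => Or.inl (Or.inr h))
          (And.imp (fun h => Or.inl (Or.inr h)) id)
      · exact fun s hs => (hSA l m hlm s hs).imp (fun h => Or.inr h) (And.imp (fun h => Or.inr h) id)
    · intro h
      simp only [S, List.map_append, List.map_cons, List.map_nil, List.sum_append, List.sum_cons,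
        List.sum_nil]
      linear_combination (h (V k) + h (V l) + h (V m)) * h2
  have hfive := (five_points hq (i := V 0) (j := V 1) (k := V 2) (l := V 3) (m := V 4) (by
    simp [hV.eq_iff])).2
  have hS : ∀ i j k l, crossing (q (V i)) (q (V j)) (q (V k)) (q (V l)) =
      chainCrossing q (S i j) (S k l) := by
    intro i j k l; simp [chainCrossing, S]
  simp only [hS] at hfive
  have c := fun i j k l => chainCrossing_comm q (S i j) (S k l)
  have a1 := key1 0 1 2 3 (by decide) (by decide) (by decide) (by decide) (by decide) (by decide)
  have a2 := key1 0 1 2 4 (by decide) (by decide) (by decide) (by decide) (by decide) (by decide)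
  have a3 := key1 0 1 3 4 (by decide) (by decide) (by decide) (by decide) (by decide) (by decide)
  have a4 := key1 0 2 1 3 (by decide) (by decide) (by decide) (by decide) (by decide) (by decide)
  have a5 := key1 0 2 1 4 (by decide) (by decide) (by decide) (by decide) (by decide) (by decide)
  have a6 := key1 0 2 3 4 (by decide) (by decide) (by decide) (by decide) (by decide) (by decide)
  have a7 := key1 0 3 1 2 (by decide) (by decide) (by decide) (by decide) (by decide) (by decide)
  have a8 := key1 0 3 1 4 (by decide) (by decide) (by decide) (by decide) (by decide) (by decide)
  have a9 := key1 0 3 2 4 (by decide) (by decide) (by decide) (by decide) (by decide) (by decide)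
  have a10 := key1 0 4 1 2 (by decide) (by decide) (by decide) (by decide) (by decide) (by decide)
  have a11 := key1 0 4 1 3 (by decide) (by decide) (by decide) (by decide) (by decide) (by decide)
  have a12 := key1 0 4 2 3 (by decide) (by decide) (by decide) (by decide) (by decide) (by decide)
  have a13 := key1 1 2 3 4 (by decide) (by decide) (by decide) (by decide) (by decide) (by decide)
  have a14 := key1 1 3 2 4 (by decide) (by decide) (by decide) (by decide) (by decide) (by decide)
  have a15 := key1 1 4 2 3 (by decide) (by decide) (by decide) (by decide) (by decide) (by decide)
  have b1 := key2 0 1 2 3 4 (by decide) (by decide) (by decide) (by decide) (by decide) (by decide)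
    (by decide) (by decide) (by decide)
  have b2 := key2 0 2 1 3 4 (by decide) (by decide) (by decide) (by decide) (by decide) (by decide)
    (by decide) (by decide) (by decide)
  have b3 := key2 0 3 1 2 4 (by decide) (by decide) (by decide) (by decide) (by decide) (by decide)
    (by decide) (by decide) (by decide)
  have b4 := key2 0 4 1 2 3 (by decide) (by decide) (by decide) (by decide) (by decide) (by decide)
    (by decide) (by decide) (by decide)
  have b5 := key2 1 2 0 3 4 (by decide) (by decide) (by decide) (by decide) (by decide) (by decide)
    (by decide) (by decide) (by decide)
  have b6 := key2 1 3 0 2 4 (by decide) (by decide) (by decide) (by decide) (by decide) (by decide)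
    (by decide) (by decide) (by decide)
  have b7 := key2 1 4 0 2 3 (by decide) (by decide) (by decide) (by decide) (by decide) (by decide)
    (by decide) (by decide) (by decide)
  have b8 := key2 2 3 0 1 4 (by decide) (by decide) (by decide) (by decide) (by decide) (by decide)
    (by decide) (by decide) (by decide)
  have b9 := key2 2 4 0 1 3 (by decide) (by decide) (by decide) (by decide) (by decide) (by decide)
    (by decide) (by decide) (by decide)
  have b10 := key2 3 4 0 1 2 (by decide) (by decide) (by decide) (by decide) (by decide) (by decide)
    (by decide) (by decide) (by decide)
  rw [c 1 2 0 3, c 1 2 0 4] at b5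
  rw [c 1 3 0 2, c 1 3 0 4] at b6
  rw [c 1 4 0 2, c 1 4 0 3] at b7
  rw [c 2 3 0 1, c 2 3 0 4, c 2 3 1 4] at b8
  rw [c 2 4 0 1, c 2 4 0 3, c 2 4 1 3] at b9
  rw [c 3 4 0 1, c 3 4 0 2, c 3 4 1 2] at b10
  have h01 : (0 : ZMod 2) ≠ 1 := by decide
  apply h01
  -- The 15 relations `key1` add up to: the number of crossings of straight edges equals the number
  -- of mixed crossings, over all 30 ordered pairs. The ten relations `key2` turn the mixed
  -- crossings into straight ones, in which every unordered pair occurs twice. So the straight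
  -- crossings are even, against `five_points`.
  linear_combination hfive + (a1 + a2 + a3 + a4 + a5 + a6 + a7 + a8 + a9 + a10 + a11 + a12 + a13 + a14 + a15) +
    (b1 + b2 + b3 + b4 + b5 + b6 + b7 + b8 + b9 + b10)

/-- If ten connected sets join five points in pairs, then two sets without a common endpoint meet. -/
theorem false_of_connected_sets (v : Fin 5 → Plane) (W : Fin 5 → Fin 5 → Set Plane)
    (hW : ∀ i j, i < j → IsCompact (W i j) ∧ IsPreconnected (W i j) ∧ v i ∈ W i j ∧ v j ∈ W i j)
    (hdisj : ∀ i j k l, i < j → k < l → i ≠ k → i ≠ l → j ≠ k → j ≠ l →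
      Disjoint (W i j) (W k l)) : False := by
  -- Disjoint compact sets have disjoint thickenings. Half of `δ` is spent on the step length of the
  -- walks and half on moving the points to general position, so the resulting segments stay in the
  -- thickenings.
  obtain ⟨δ, hδ0, hδ⟩ : ∃ δ : ℝ, 0 < δ ∧ ∀ i j k l, i < j → k < l → i ≠ k → i ≠ l → j ≠ k → j ≠ l →
      Disjoint (Metric.thickening δ (W i j)) (Metric.thickening δ (W k l)) := by
    have h1 : ∀ᶠ δ : ℝ in 𝓝[>] 0, ∀ i j k l, i < j → k < l → i ≠ k → i ≠ l → j ≠ k → j ≠ l →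
        Disjoint (Metric.thickening δ (W i j)) (Metric.thickening δ (W k l)) := by
      simp only [eventually_all]
      intro i j k l hij hkl ik il jk jl
      obtain ⟨d, hd, hd'⟩ := (hdisj i j k l hij hkl ik il jk jl).exists_thickenings (hW i j hij).1
        (hW k l hkl).1.isClosed
      filter_upwards [Ioo_mem_nhdsGT hd] with e he
      exact hd'.mono (Metric.thickening_mono he.2.le _) (Metric.thickening_mono he.2.le _)
    have h2 : ∀ᶠ δ : ℝ in 𝓝[>] 0, 0 < δ := self_mem_nhdsWithin
    exact (h2.and h1).exists
  have hε : 0 < δ / 2 := by linarith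
  have hsteps : ∀ i j, ∃ n, i < j → ∀ N ≥ n, ∃ x : ℕ → Plane, x 0 = v i ∧ x N = v j ∧
      (∀ t, x t ∈ W i j) ∧ ∀ t, dist (x t) (x (t + 1)) < δ / 2 := by
    intro i j
    by_cases hij : i < j
    · obtain ⟨-, h2, h3, h4⟩ := hW i j hij
      obtain ⟨n, hn⟩ := exists_steps h2 h3 h4 hε
      exact ⟨n, fun _ => hn⟩
    · exact ⟨0, fun h => absurd h hij⟩
  choose n hn using hsteps
  obtain ⟨N, hN⟩ : ∃ N, ∀ i j, n i j ≤ N := by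
    refine ⟨∑ i, ∑ j, n i j, fun i j => ?_⟩
    exact (Finset.single_le_sum (f := fun j => n i j) (fun _ _ => Nat.zero_le _)
      (Finset.mem_univ j)).trans (Finset.single_le_sum (f := fun i => ∑ j, n i j)
      (fun _ _ => Nat.zero_le _) (Finset.mem_univ i))
  have hx : ∀ i j, ∃ x : ℕ → Plane, i < j → x 0 = v i ∧ x N = v j ∧
      (∀ t, x t ∈ W i j) ∧ ∀ t, dist (x t) (x (t + 1)) < δ / 2 := by
    intro i j
    by_cases hij : i < j
    · obtain ⟨x, hx⟩ := hn i j hij N (hN i j)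
      exact ⟨x, fun _ => hx⟩
    · exact ⟨fun _ => 0, fun h => absurd h hij⟩
  choose x hx using hx
  -- Every vertex and every point of every walk gets its own label, even when positions coincide, so
  -- that the perturbation separates them. The label `none` is the cone point required by the parity
  -- argument.
  let V : Fin 5 → Option (Fin 5 ⊕ (Fin 5 × Fin 5 × Fin (N + 1))) := fun i => some (Sum.inl i)
  let P : Fin 5 → Fin 5 → Fin (N + 1) → Option (Fin 5 ⊕ (Fin 5 × Fin 5 × Fin (N + 1))) :=
    fun i j t => some (Sum.inr (i, j, t))
  let q : Option (Fin 5 ⊕ (Fin 5 × Fin 5 × Fin (N + 1))) → Plane := fun o =>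
    match o with
    | none => 0
    | some (Sum.inl i) => v i
    | some (Sum.inr (i, j, t)) => x i j t
  obtain ⟨q', hq', hqd⟩ := exists_generalPosition q hε
  let L : Fin 5 → Fin 5 → List (_ × _) := fun i j => (V i, P i j 0) :: (P i j (Fin.last N), V j) ::
    (List.finRange N).map fun t => (P i j t.castSucc, P i j t.succ)
  let A : Fin 5 → Fin 5 → Set (Option (Fin 5 ⊕ (Fin 5 × Fin 5 × Fin (N + 1)))) := fun i j =>
    {V i, V j} ∪ Set.range (P i j)
  have hLmem : ∀ i j, ∀ s ∈ L i j, s = (V i, P i j 0) ∨ s = (P i j (Fin.last N), V j) ∨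
      ∃ t : Fin N, s = (P i j t.castSucc, P i j t.succ) := by
    intro i j s hs
    rcases List.mem_cons.1 hs with rfl | hs
    · exact Or.inl rfl
    rcases List.mem_cons.1 hs with rfl | hs
    · exact Or.inr (Or.inl rfl)
    obtain ⟨t, -, rfl⟩ := List.mem_map.1 hs
    exact Or.inr (Or.inr ⟨t, rfl⟩)
  have hLA : ∀ i j, i < j → ChainIn (A i j) (L i j) := by
    intro i j _ s hs
    rcases hLmem i j s hs with rfl | rfl | ⟨t, rfl⟩
    · exact ⟨Or.inl (by simp), Or.inr ⟨_, rfl⟩, by simp [V, P]⟩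
    · exact ⟨Or.inr ⟨_, rfl⟩, Or.inl (by simp), by simp [V, P]⟩
    · refine ⟨Or.inr ⟨_, rfl⟩, Or.inr ⟨_, rfl⟩, ?_⟩
      simp [P, Fin.ext_iff]
  have hA : ∀ i j k l, i < j → k < l → i ≠ k → i ≠ l → j ≠ k → j ≠ l →
      Disjoint (A i j) (A k l) := by
    intro i j k l _ _ ik il jk jl
    rw [Set.disjoint_left]
    rintro s ((rfl | rfl) | ⟨t, rfl⟩) ((h | h) | ⟨t', h⟩) <;> simp_all [V, P]
  have hseg : ∀ i j, i < j → ∀ s ∈ L i j,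
      segment ℝ (q' s.1) (q' s.2) ⊆ Metric.thickening δ (W i j) := by
    intro i j hij s hs
    obtain ⟨hx0, hxN, hxW, hxd⟩ := hx i j hij
    have h1 : q s.1 ∈ W i j ∧ dist (q s.2) (q s.1) < δ / 2 := by
      rcases hLmem i j s hs with rfl | rfl | ⟨t, rfl⟩
      · exact ⟨(hW i j hij).2.2.1, by simp [q, V, P, hx0, hδ0]⟩
      · exact ⟨by simpa [q, P] using hxW N, by simp [q, V, P, hxN, hδ0]⟩
      · refine ⟨by simpa [q, P] using hxW t, ?_⟩
        rw [dist_comm]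
        simpa [q, P] using hxd t
    have h2 : segment ℝ (q' s.1) (q' s.2) ⊆ Metric.ball (q s.1) δ := by
      refine (convex_ball _ _).segment_subset ?_ ?_
      · have := hqd s.1
        rw [dist_comm] at this
        exact lt_trans this (by linarith)
      · have := hqd s.2
        rw [dist_comm] at this
        have := dist_triangle (q' s.2) (q s.2) (q s.1)
        rw [Metric.mem_ball]
        linarith [h1.2]
    exact h2.trans (Metric.ball_subset_thickening h1.1 δ)
  refine false_of_chains hq' V (fun i j h => by simpa [V] using h) none L A ?_ ?_ ?_ hLA hA ?_
  · exact fun i j => ⟨Or.inl (by simp), Or.inl (by simp)⟩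
  · rintro i j ((h | h) | ⟨t, h⟩) <;> simp [V, P] at h
  · intro i j _ h
    have := sum_castSucc_add_succ N fun t => h (P i j t)
    simp only [L, List.map_cons, List.map_map, List.sum_cons]
    have e : ((fun s : _ × _ => h s.1 + h s.2) ∘ fun t : Fin N => (P i j t.castSucc, P i j t.succ)) =
        fun t => h (P i j t.castSucc) + h (P i j t.succ) := rfl
    rw [e, this]
    have h2 : (2 : ZMod 2) = 0 := rfl
    linear_combination (h (P i j 0) + h (P i j (Fin.last N))) * h2
  · intro i j k l hij hkl ik il jk jl
    have hz : ∀ s ∈ L i j, ((L k l).map fun t =>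
        crossing (q' s.1) (q' s.2) (q' t.1) (q' t.2)).sum = 0 := by
      intro s hs
      refine List.sum_eq_zero ?_
      intro c hc
      obtain ⟨t, ht, rfl⟩ := List.mem_map.1 hc
      obtain ⟨s1, s2, s3⟩ := hLA i j hij s hs
      obtain ⟨t1, t2, t3⟩ := hLA k l hkl t ht
      have hne : ∀ {a b}, a ∈ A i j → b ∈ A k l → a ≠ b := fun ha hb h =>
        Set.disjoint_left.1 (hA i j k l hij hkl ik il jk jl) ha (h ▸ hb)
      exact crossing_eq_zero_of_disjoint (hq' _ _ _ s3 (hne s1 t1) (hne s2 t1))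
        (hq' _ _ _ s3 (hne s1 t2) (hne s2 t2)) (hq' _ _ _ t3 (hne s1 t1).symm (hne s1 t2).symm)
        (hq' _ _ _ t3 (hne s2 t1).symm (hne s2 t2).symm)
        ((hδ i j k l hij hkl ik il jk jl).mono (hseg i j hij s hs) (hseg k l hkl t ht))
    refine List.sum_eq_zero ?_
    intro c hc
    obtain ⟨s, hs, rfl⟩ := List.mem_map.1 hc
    exact hz s hs

end Plane

/-! ### Separation by a triangle -/

namespace PlaneEmbedding

variable {V : Type*} {G : SimpleGraph V}

variable [Finite V] (E : PlaneEmbedding G)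

/-- Two vertices on the closure of the outer face are joined by a compact connected set that avoids
the drawing of any vertices of `S` different from them. -/
theorem exists_connecting_set {S T : Set V} (hTS : T ⊆ S) {a c : V} (ha : a ∉ T) (hc : c ∉ T)
    (haF : E.pt a ∈ closure (E.outerFace S)) (hcF : E.pt c ∈ closure (E.outerFace S)) :
    ∃ K : Set Plane, IsCompact K ∧ IsPreconnected K ∧ E.pt a ∈ K ∧ E.pt c ∈ K ∧
      Disjoint K (E.carrier T) := by
  have hF := E.outerFace_isFaceUnion S
  have hconn : IsPathConnected (E.outerFace S) :=
    hF.isOpen.isConnected_iff_isPathConnected.1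
      ⟨E.outerFace_nonempty S, E.outerFace_isPreconnected S⟩
  have hnear : ∀ a, a ∉ T → E.pt a ∈ closure (E.outerFace S) →
      ∃ f ∈ E.outerFace S, Disjoint (segment ℝ (E.pt a) f) (E.carrier T) := by
    intro a ha haF
    have h1 : E.pt a ∈ (E.carrier T)ᶜ := fun h => ha (E.mem_of_pt_mem_carrier h)
    obtain ⟨r, hr, hr'⟩ := Metric.isOpen_iff.1 (E.carrier_isClosed T).isOpen_compl _ h1
    obtain ⟨f, hf, hfF⟩ := mem_closure_iff.1 haF _ Metric.isOpen_ball (Metric.mem_ball_self hr)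
    refine ⟨f, hfF, Set.disjoint_left.2 fun x hx => hr' ?_⟩
    exact (convex_ball _ _).segment_subset (Metric.mem_ball_self hr) hf hx
  obtain ⟨f, hfF, hf⟩ := hnear a ha haF
  obtain ⟨g, hgF, hg⟩ := hnear c hc hcF
  obtain ⟨γ, hγ⟩ := hconn.joinedIn f hfF g hgF
  have hcomp : ∀ x y : Plane, IsCompact (segment ℝ x y) := fun x y => by
    rw [segment_eq_image]; exact isCompact_Icc.image (by fun_prop)
  have hpre : ∀ x y : Plane, IsPreconnected (segment ℝ x y) := fun x y =>
    (convex_segment x y).isPreconnected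
  refine ⟨segment ℝ (E.pt a) f ∪ Set.range γ ∪ segment ℝ (E.pt c) g,
    ((hcomp _ _).union (isCompact_range γ.continuous)).union (hcomp _ _), ?_,
    Or.inl (Or.inl (left_mem_segment ℝ _ _)), Or.inr (left_mem_segment ℝ _ _), ?_⟩
  · exact ((hpre _ _).union f (right_mem_segment ℝ _ _) (⟨0, by simp⟩ : f ∈ Set.range γ)
      (isPreconnected_range γ.continuous)).union g (Or.inr (⟨1, by simp⟩ : g ∈ Set.range γ)) (right_mem_segment ℝ _ _)
      (hpre _ _)
  · refine (hf.union_left ?_).union_left hg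
    rw [Set.disjoint_left]
    rintro _ ⟨t, rfl⟩ h
    exact Set.disjoint_left.1 hF.disjoint (hγ t) (E.carrier_mono hTS h)

/-- A triangle separates two disjoint connected parts of the graph that are both adjacent to all
its vertices: they cannot both reach the outer face. -/
theorem false_of_triangle_between {S A C : Set V} {t : Fin 3 → V} (htS : ∀ i, t i ∈ S)
    (ht : ∀ i j, i ≠ j → G.Adj (t i) (t j)) (hA : (G.induce A).Preconnected)
    (hC : (G.induce C).Preconnected) (hAC : Disjoint A C) (htA : ∀ i, t i ∉ A)
    (htC : ∀ i, t i ∉ C) (hadjA : ∀ i, ∃ a ∈ A, G.Adj (t i) a)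
    (hadjC : ∀ i, ∃ c ∈ C, G.Adj (t i) c) {a c : V} (ha : a ∈ A) (hc : c ∈ C)
    (haF : E.pt a ∈ closure (E.outerFace S)) (hcF : E.pt c ∈ closure (E.outerFace S)) : False := by
  obtain ⟨K, hKc, hKp, haK, hcK, hKT⟩ := E.exists_connecting_set (T := Set.range t)
    (Set.range_subset_iff.2 htS) (a := a) (c := c) (by rintro ⟨i, rfl⟩; exact htA i ha)
    (by rintro ⟨i, rfl⟩; exact htC i hc) haF hcF
  -- The branch sets of a `K₅` minor in which only the connection between `A` and `C` is missing.
  let B : Fin 5 → Set V := ![{t 0}, {t 1}, {t 2}, A, C]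
  let v : Fin 5 → V := ![t 0, t 1, t 2, a, c]
  have hvB : ∀ i, v i ∈ B i := by
    intro i; fin_cases i <;> simp [v, B, ha, hc]
  have hBp : ∀ i, (G.induce (B i)).Preconnected := by
    have h1 : ∀ x : V, (G.induce ({x} : Set V)).Preconnected := fun x y z => by
      rw [Subsingleton.elim y z]
    intro i; fin_cases i <;> simp [B, hA, hC]
  have hBd : ∀ i j, i ≠ j → Disjoint (B i) (B j) := by
    have h1 : ∀ i j, i < j → Disjoint (B i) (B j) := by
      intro i j hij
      fin_cases i <;> fin_cases j <;> simp at hij <;>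
        simp [B, htA, htC, hAC, (ht _ _ _).ne]
    intro i j hij
    rcases hij.lt_or_gt with h | h
    · exact h1 i j h
    · exact (h1 j i h).symm
  have hadj : ∀ i j, i < j → ¬ (i = 3 ∧ j = 4) → ∃ x ∈ B i, ∃ y ∈ B j, G.Adj x y := by
    intro i j hij h
    fin_cases i <;> fin_cases j <;> simp at hij h <;> simp [B, ht, hadjA, hadjC]
  -- The missing connection runs through the outer face along `K`. It only has to avoid the edges of
  -- the triangle, because these are the pairs disjoint from `{3, 4}`.
  let W : Fin 5 → Fin 5 → Set Plane := fun i j =>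
    if i = 3 ∧ j = 4 then E.carrier A ∪ K ∪ E.carrier C else E.carrier (B i ∪ B j)
  have hsmall : ∀ k l : Fin 5, k < l → k ≠ 3 → k ≠ 4 → l ≠ 3 → l ≠ 4 → B k ∪ B l ⊆ Set.range t := by
    have h1 : ∀ k : Fin 5, k ≠ 3 → k ≠ 4 → B k ⊆ Set.range t := by
      intro k h3 h4
      fin_cases k <;> simp at h3 h4 <;> simp [B]
    intro k l _ k3 k4 l3 l4
    exact Set.union_subset (h1 k k3 k4) (h1 l l3 l4)
  have hbig : ∀ k l : Fin 5, k < l → k ≠ 3 → k ≠ 4 → l ≠ 3 → l ≠ 4 → Disjoint (W 3 4) (W k l) := by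
    intro k l hkl k3 k4 l3 l4
    have hsub := hsmall k l hkl k3 k4 l3 l4
    have e1 : W 3 4 = E.carrier A ∪ K ∪ E.carrier C := rfl
    have e2 : W k l = E.carrier (B k ∪ B l) := if_neg fun h => k3 h.1
    rw [e1, e2]
    refine ((E.carrier_disjoint ?_).union_left (hKT.mono_right (E.carrier_mono hsub))).union_left
      (E.carrier_disjoint ?_)
    · refine Disjoint.mono_right hsub (Set.disjoint_right.2 ?_)
      rintro _ ⟨i, rfl⟩; exact htA i
    · refine Disjoint.mono_right hsub (Set.disjoint_right.2 ?_)
      rintro _ ⟨i, rfl⟩; exact htC i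
  refine Plane.false_of_connected_sets (fun i => E.pt (v i)) W ?_ ?_
  · intro i j hij
    by_cases h : i = 3 ∧ j = 4
    · obtain ⟨rfl, rfl⟩ := h
      have e1 : W 3 4 = E.carrier A ∪ K ∪ E.carrier C := rfl
      rw [e1]
      refine ⟨((E.carrier_isCompact A).union hKc).union (E.carrier_isCompact C), ?_,
        Or.inl (Or.inr haK), Or.inl (Or.inr hcK)⟩
      exact ((E.carrier_isPreconnected hA).union _ (E.pt_mem_carrier ha) haK hKp).union _
        (Or.inr hcK) (E.pt_mem_carrier hc) (E.carrier_isPreconnected hC)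
    · have e2 : W i j = E.carrier (B i ∪ B j) := if_neg h
      rw [e2]
      obtain ⟨x, hx, y, hy, hxy⟩ := hadj i j hij h
      exact ⟨E.carrier_isCompact _, E.carrier_isPreconnected
        (SimpleGraph.connected_induce_union (hBp i) (hBp j) hx hy hxy).preconnected,
        E.pt_mem_carrier (Or.inl (hvB i)), E.pt_mem_carrier (Or.inr (hvB j))⟩
  · intro i j k l hij hkl ik il jk jl
    by_cases h : i = 3 ∧ j = 4
    · obtain ⟨rfl, rfl⟩ := h
      exact hbig k l hkl ik.symm jk.symm il.symm jl.symm
    · by_cases h' : k = 3 ∧ l = 4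
      · obtain ⟨rfl, rfl⟩ := h'
        exact (hbig i j hij ik il jk jl).symm
      · have e2 : W i j = E.carrier (B i ∪ B j) := if_neg h
        have e3 : W k l = E.carrier (B k ∪ B l) := if_neg h'
        rw [e2, e3]
        exact E.carrier_disjoint (((hBd i k ik).union_right (hBd i l il)).union_left
          ((hBd j k jk).union_right (hBd j l jl)))

end PlaneEmbedding

/-! ### Nested triangles need many rounds -/

namespace nestedTriangles

variable {m : ℕ}

theorem adj_same {i : Fin m} {a b : Fin 3} (h : a ≠ b) : (nestedTriangles m).Adj (i, a) (i, b) :=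
  Or.inl ⟨rfl, h⟩

theorem induce_preconnected {I : Set (Fin m)} (hI : I.OrdConnected) :
    ((nestedTriangles m).induce (Prod.fst ⁻¹' I)).Preconnected := by
  have hlevel : ∀ (i : Fin m) (hi : i ∈ I) (a b : Fin 3),
      ((nestedTriangles m).induce (Prod.fst ⁻¹' I)).Reachable ⟨(i, a), hi⟩ ⟨(i, b), hi⟩ := by
    intro i hi a b
    rcases eq_or_ne a b with rfl | hab
    · exact .refl _
    · exact SimpleGraph.Adj.reachable (adj_same (m := m) hab)
  have hup : ∀ (d : ℕ) (i j : Fin m) (hi : i ∈ I) (hj : j ∈ I), i.val + d = j.val →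
      ((nestedTriangles m).induce (Prod.fst ⁻¹' I)).Reachable ⟨(i, 0), hi⟩ ⟨(j, 0), hj⟩ := by
    intro d
    induction d with
    | zero =>
      intro i j hi hj h
      obtain rfl : i = j := Fin.ext h
      exact .refl _
    | succ d ih =>
      intro i j hi hj h
      let i' : Fin m := ⟨i.val + 1, by omega⟩
      have hi' : i' ∈ I := hI.out hi hj ⟨by simp [i', Fin.le_def], by simp [i', Fin.le_def]; omega⟩
      refine SimpleGraph.Reachable.trans ?_ (ih i' j hi' hj (by simp [i']; omega))
      refine SimpleGraph.Adj.reachable ?_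
      exact Or.inr ⟨rfl, Or.inl rfl⟩
  rintro ⟨⟨i, a⟩, hi⟩ ⟨⟨j, b⟩, hj⟩
  refine (hlevel i hi a 0).trans (SimpleGraph.Reachable.trans ?_ (hlevel j hj 0 b))
  rcases le_total i j with h | h
  · exact hup (j.val - i.val) i j hi hj (by rw [Fin.le_def] at h; omega)
  · exact (hup (i.val - j.val) j i hj hi (by rw [Fin.le_def] at h; omega)).symm

/-- A triangle that is still present separates the triangles before it from those after it. -/
theorem false_of_outer (E : PlaneEmbedding (nestedTriangles m)) {S : Set (Fin m × Fin 3)} {j : Fin m}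
    (hj : ∀ a, (j, a) ∈ S) {x y : Fin m × Fin 3} (hx : x.1 < j) (hy : j < y.1)
    (hxF : E.pt x ∈ closure (E.outerFace S)) (hyF : E.pt y ∈ closure (E.outerFace S)) : False := by
  have hj0 : 0 < j.val := by have := Fin.lt_def.1 hx; omega
  have hj1 : j.val + 1 < m := by have := Fin.lt_def.1 hy; omega
  refine E.false_of_triangle_between (S := S) (A := Prod.fst ⁻¹' Set.Iio j) (C := Prod.fst ⁻¹' Set.Ioi j)
    (t := fun a => (j, a)) hj (fun a b hab => adj_same hab) (induce_preconnected Set.ordConnected_Iio)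
    (induce_preconnected Set.ordConnected_Ioi) ?_ ?_ ?_ ?_ ?_ hx hy hxF hyF
  · rw [Set.disjoint_left]
    exact fun x hx hx' => lt_asymm (show x.1 < j from hx) hx'
  · simp
  · simp
  · intro a
    refine ⟨(⟨j.val - 1, by omega⟩, a), Fin.lt_def.2 (by simp; omega), Or.inr ⟨rfl, Or.inr ?_⟩⟩
    simp; omega
  · intro a
    exact ⟨(⟨j.val + 1, hj1⟩, a), Fin.lt_def.2 (by simp), Or.inr ⟨rfl, Or.inl rfl⟩⟩

/-- While the first `p` triangles are intact, the last of them separates the earlier ones from `y`,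
so one round can damage only that one. The vertex `y` itself may have been removed: its point stays
in the closure of the outer face, because this face only grows. -/
theorem le_of_peelsIn_of_lt (E : PlaneEmbedding (nestedTriangles m)) {y : Fin m × Fin 3}
    (hy : y ∈ E.outerVertices Set.univ) {k : ℕ} {S : Set (Fin m × Fin 3)} (hS : E.PeelsIn k S)
    {p : ℕ} (hp : p ≤ y.1.val) (hpS : ∀ x : Fin m × Fin 3, x.1.val < p → x ∈ S) : p ≤ k := by
  induction k generalizing S p with
  | zero =>
    by_contra! hp0
    have := hpS (⟨0, by omega⟩, 0) hp0
    rw [show S = ∅ from hS] at this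
    exact this
  | succ k ih =>
    rcases p with _ | p
    · omega
    have := ih hS.2 (p := p) (by omega) fun x hx => ⟨hpS x (by omega), fun hxS => ?_⟩
    · omega
    · exact false_of_outer E (S := S) (j := ⟨p, by omega⟩) (fun a => hpS _ (by simp)) (x := x) (y := y)
        (Fin.lt_def.2 hx) (Fin.lt_def.2 (by simp; omega)) hxS.2
        (closure_mono (E.outerFace_anti (Set.subset_univ S)) hy.2)

/-- The mirror image of `le_of_peelsIn_of_lt`, for the last `p` triangles. -/
theorem le_of_peelsIn_of_gt (E : PlaneEmbedding (nestedTriangles m)) {y : Fin m × Fin 3}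
    (hy : y ∈ E.outerVertices Set.univ) {k : ℕ} {S : Set (Fin m × Fin 3)} (hS : E.PeelsIn k S)
    {p : ℕ} (hp : y.1.val + p < m) (hpS : ∀ x : Fin m × Fin 3, m ≤ x.1.val + p → x ∈ S) : p ≤ k := by
  induction k generalizing S p with
  | zero =>
    by_contra! hp0
    have := hpS (⟨m - 1, by omega⟩, 0) (by simp; omega)
    rw [show S = ∅ from hS] at this
    exact this
  | succ k ih =>
    rcases p with _ | p
    · omega
    have := ih hS.2 (p := p) (by omega) fun x hx => ⟨hpS x (by omega), fun hxS => ?_⟩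
    · omega
    · exact false_of_outer E (S := S) (j := ⟨m - (p + 1), by omega⟩) (fun a => hpS _ (by simp; omega))
        (x := y) (y := x) (Fin.lt_def.2 (by simp; omega)) (Fin.lt_def.2 (by simp; omega))
        (closure_mono (E.outerFace_anti (Set.subset_univ S)) hy.2) hxS.2

/-- A vertex on the first outer face has some number of triangles before it and the rest after it.
Each of these two numbers is at most `k`, and together they are `m - 1`. -/
theorem le_of_isOuterplane (hm : 0 < m) (E : PlaneEmbedding (nestedTriangles m)) {k : ℕ}
    (h : E.IsOuterplane k) : m ≤ 2 * k + 1 := by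
  have hne : (Set.univ : Set (Fin m × Fin 3)).Nonempty := ⟨(⟨0, hm⟩, 0), trivial⟩
  obtain ⟨y, hy⟩ := E.outerVertices_nonempty hne
  have h1 := le_of_peelsIn_of_lt E hy h le_rfl fun _ _ => Set.mem_univ _
  have h2 := le_of_peelsIn_of_gt E hy h (p := m - 1 - y.1.val) (by omega) fun _ _ => Set.mem_univ _
  omega

end nestedTriangles

/-! ### A pixel representation of the nested triangle graph -/

namespace nestedTriangles

/-- The pixels `(x, y)` of the `a`-th vertex of the `r`-th of `k` nested triangles. -/
def Tower (k r : ℤ) (a : Fin 3) (x y : ℤ) : Prop :=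
  match a with
  | 0 => (y = 2 * r + 1 ∧ -(2 * r) ≤ x ∧ x ≤ 2 * r + 1) ∨ (r + 1 < k ∧ x = 0 ∧ y = 2 * r + 2) ∨
      (r + 1 = k ∧ x = 2 * r + 2 ∧ y = 2 * r + 1)
  | 1 => (y = -(2 * r + 1) ∧ -(2 * r + 1) ≤ x ∧ x ≤ 2 * r + 1) ∨
      (x = -(2 * r + 1) ∧ -(2 * r + 1) ≤ y ∧ y ≤ 2 * r + 1) ∨
      (r + 1 < k ∧ x = 0 ∧ y = -(2 * r + 2)) ∨ (r + 1 = k ∧ x = 2 * r + 2 ∧ y = -(2 * r + 1))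
  | 2 => (x = 2 * r + 1 ∧ -(2 * r) ≤ y ∧ y ≤ 2 * r) ∨ (x = 2 * r + 2 ∧ y = 0)

/-- The pixels `(x, y)` of the vertex `(i, a)` in a representation of `2k` nested triangles that
consists of two towers side by side. -/
def InBlob (k i : ℤ) (a : Fin 3) (x y : ℤ) : Prop :=
  (i < k ∧ Tower k i a x y) ∨ (k ≤ i ∧ Tower k (2 * k - 1 - i) a (4 * k + 1 - x) y)

theorem tower_bounds {k r x y : ℤ} {a : Fin 3} (hr : 0 ≤ r) (hk : r < k) (h : Tower k r a x y) :
    -(2 * k - 1) ≤ x ∧ x ≤ 2 * k ∧ -(2 * k - 1) ≤ y ∧ y ≤ 2 * k - 1 := by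
  fin_cases a <;> simp only [Tower] at h <;> omega

theorem tower_unique {k r s x y : ℤ} {a b : Fin 3} (hr : 0 ≤ r) (hs : 0 ≤ s)
    (h : Tower k r a x y) (h' : Tower k s b x y) : r = s ∧ a = b := by
  fin_cases a <;> fin_cases b <;> simp [Tower] at h h' ⊢ <;> omega

/-- The last column of a tower contains exactly one connecting pixel for each vertex of the
outermost ring. The mirrored tower has the same pixels opposite, so the two towers touch in three
matching pairs. -/
theorem tower_right {k r x y : ℤ} {a : Fin 3} (hr : 0 ≤ r) (hk : r < k) (h : Tower k r a x y)
    (hx : x = 2 * k) : r = k - 1 ∧ (a = 0 ∧ y = 2 * k - 1 ∨ a = 1 ∧ y = -(2 * k - 1) ∨ a = 2 ∧ y = 0) := by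
  fin_cases a <;> simp [Tower] at h ⊢ <;> omega

theorem tower_adj {k r s x y x' y' : ℤ} {a b : Fin 3} (hr : 0 ≤ r) (hs : 0 ≤ s) (hk : 2 ≤ k)
    (hrk : r < k) (hsk : s < k)
    (h : Tower k r a x y) (h' : Tower k s b x' y')
    (hadj : (x' = x + 1 ∧ y' = y) ∨ (x' = x ∧ y' = y + 1)) (hne : ¬ (r = s ∧ a = b)) :
    (r = s ∧ a ≠ b) ∨ (a = b ∧ (r + 1 = s ∨ s + 1 = r)) := by
  fin_cases a <;> fin_cases b <;> simp [Tower] at h h' hne ⊢ <;> omega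

theorem adj_right (x y : ℤ) : pixelGraph.Adj (x, y) (x + 1, y) := by simp [pixelGraph]

theorem adj_up (x y : ℤ) : pixelGraph.Adj (x, y) (x, y + 1) := by simp [pixelGraph]

theorem pixelGraph_adj_iff {x y x' y' : ℤ} : pixelGraph.Adj (x, y) (x', y') ↔
    (x' = x + 1 ∧ y' = y) ∨ (x = x' + 1 ∧ y' = y) ∨ (y' = y + 1 ∧ x' = x) ∨
      (y = y' + 1 ∧ x' = x) := by
  refine ⟨fun h => Pixel.cases_of_adj h, ?_⟩
  rintro (⟨rfl, rfl⟩ | ⟨rfl, rfl⟩ | ⟨rfl, rfl⟩ | ⟨rfl, rfl⟩)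
  · exact adj_right _ _
  · exact (adj_right _ _).symm
  · exact adj_up _ _
  · exact (adj_up _ _).symm

theorem exists_tower_adj_same {k r : ℤ} (hr : 0 ≤ r) {a b : Fin 3} (hab : a ≠ b) :
    ∃ x y x' y', Tower k r a x y ∧ Tower k r b x' y' ∧ pixelGraph.Adj (x, y) (x', y') := by
  have key : ∀ a b : Fin 3, a < b →
      ∃ x y x' y', Tower k r a x y ∧ Tower k r b x' y' ∧ pixelGraph.Adj (x, y) (x', y') := by
    intro a b hab
    fin_cases a <;> fin_cases b <;> simp at hab
    · refine ⟨-(2 * r), 2 * r + 1, -(2 * r + 1), 2 * r + 1, ?_, ?_, pixelGraph_adj_iff.2 ?_⟩ <;>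
        simp [Tower] <;> omega
    · refine ⟨2 * r + 1, 2 * r + 1, 2 * r + 1, 2 * r, ?_, ?_, pixelGraph_adj_iff.2 ?_⟩ <;>
        simp [Tower] <;> omega
    · refine ⟨2 * r + 1, -(2 * r + 1), 2 * r + 1, -(2 * r), ?_, ?_, pixelGraph_adj_iff.2 ?_⟩ <;>
        simp [Tower] <;> omega
  rcases hab.lt_or_gt with h | h
  · exact key a b h
  · obtain ⟨x, y, x', y', h1, h2, h3⟩ := key b a h
    exact ⟨x', y', x, y, h2, h1, h3.symm⟩

theorem exists_tower_adj_succ {k r : ℤ} (hr : 0 ≤ r) (hk : r + 1 < k) (a : Fin 3) :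
    ∃ x y x' y', Tower k r a x y ∧ Tower k (r + 1) a x' y' ∧ pixelGraph.Adj (x, y) (x', y') := by
  fin_cases a
  · refine ⟨0, 2 * r + 2, 0, 2 * r + 3, ?_, ?_, pixelGraph_adj_iff.2 ?_⟩ <;> simp [Tower] <;> omega
  · refine ⟨0, -(2 * r + 2), 0, -(2 * r + 3), ?_, ?_, pixelGraph_adj_iff.2 ?_⟩ <;>
      simp [Tower] <;> omega
  · refine ⟨2 * r + 2, 0, 2 * r + 3, 0, ?_, ?_, pixelGraph_adj_iff.2 ?_⟩ <;> simp [Tower] <;> omega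

theorem exists_tower_right {k : ℤ} (a : Fin 3) : ∃ y, Tower k (k - 1) a (2 * k) y := by
  fin_cases a
  · exact ⟨2 * k - 1, by simp [Tower]; omega⟩
  · exact ⟨-(2 * k - 1), by simp [Tower]; omega⟩
  · exact ⟨0, by simp [Tower]; omega⟩

/-- Certifies that a blob is connected: every pixel has a neighbour in the blob that is closer, in
the taxicab distance, to a base pixel. For the L-shaped blob the base pixel is the corner of the L.
-/
theorem tower_descent {k r : ℤ} (hr : 0 ≤ r) (a : Fin 3) : ∃ (x₀ y₀ : ℤ) (μ : ℤ → ℤ → ℕ),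
    Tower k r a x₀ y₀ ∧ ∀ x y, Tower k r a x y → (x = x₀ ∧ y = y₀) ∨
      ∃ x' y', Tower k r a x' y' ∧ pixelGraph.Adj (x, y) (x', y') ∧ μ x' y' < μ x y := by
  simp only [pixelGraph_adj_iff]
  fin_cases a
  · refine ⟨0, 2 * r + 1, fun x y => x.natAbs + (y - (2 * r + 1)).natAbs, by simp [Tower]; omega, ?_⟩
    intro x y h
    simp only [Tower] at h ⊢
    by_cases h1 : y = 2 * r + 1
    · rcases lt_trichotomy x 0 with h2 | h2 | h2
      · exact Or.inr ⟨x + 1, y, by omega⟩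
      · exact Or.inl ⟨h2, h1⟩
      · exact Or.inr ⟨x - 1, y, by omega⟩
    · exact Or.inr ⟨x, y - 1, by omega⟩
  · refine ⟨-(2 * r + 1), -(2 * r + 1),
      fun x y => (x + (2 * r + 1)).natAbs + (y + (2 * r + 1)).natAbs, by simp [Tower]; omega, ?_⟩
    intro x y h
    simp only [Tower] at h ⊢
    by_cases h1 : x = -(2 * r + 1)
    · by_cases h2 : y = -(2 * r + 1)
      · exact Or.inl ⟨h1, h2⟩
      · exact Or.inr ⟨x, y - 1, by omega⟩
    · by_cases h2 : y = -(2 * r + 1)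
      · exact Or.inr ⟨x - 1, y, by omega⟩
      · exact Or.inr ⟨x, y + 1, by omega⟩
  · refine ⟨2 * r + 1, 0, fun x y => (x - (2 * r + 1)).natAbs + y.natAbs, by simp [Tower]; omega, ?_⟩
    intro x y h
    simp only [Tower] at h ⊢
    by_cases h1 : x = 2 * r + 1
    · rcases lt_trichotomy y 0 with h2 | h2 | h2
      · exact Or.inr ⟨x, y + 1, by omega⟩
      · exact Or.inl ⟨h1, h2⟩
      · exact Or.inr ⟨x, y - 1, by omega⟩
    · exact Or.inr ⟨x - 1, y, by omega⟩

theorem connected_of_descent {B : Set Pixel} {p₀ : Pixel} (hp₀ : p₀ ∈ B) (μ : Pixel → ℕ)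
    (h : ∀ p ∈ B, p = p₀ ∨ ∃ q ∈ B, pixelGraph.Adj p q ∧ μ q < μ p) :
    (pixelGraph.induce B).Connected := by
  have key : ∀ n, ∀ p (hp : p ∈ B), μ p = n →
      (pixelGraph.induce B).Reachable ⟨p, hp⟩ ⟨p₀, hp₀⟩ := by
    intro n
    induction n using Nat.strong_induction_on with
    | _ n ih =>
      intro p hp hn
      rcases h p hp with rfl | ⟨q, hq, hpq, hlt⟩
      · exact .refl _
      · have hadj : (pixelGraph.induce B).Adj ⟨p, hp⟩ ⟨q, hq⟩ := hpq
        exact hadj.reachable.trans (ih _ (hn ▸ hlt) q hq rfl)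
  have : Nonempty B := ⟨⟨p₀, hp₀⟩⟩
  exact ⟨fun x y => (key _ x.1 x.2 rfl).trans (key _ y.1 y.2 rfl).symm⟩

theorem inBlob_connected {k i : ℤ} (hi : 0 ≤ i) (hik : i < 2 * k) (a : Fin 3) :
    (pixelGraph.induce {p : Pixel | InBlob k i a p.1 p.2}).Connected := by
  rcases lt_or_ge i k with h | h
  · obtain ⟨x₀, y₀, μ, h0, hd⟩ := tower_descent (k := k) hi a
    refine connected_of_descent (p₀ := (x₀, y₀)) (Or.inl ⟨h, h0⟩) (fun p => μ p.1 p.2) ?_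
    rintro ⟨x, y⟩ (⟨-, hp⟩ | ⟨h', -⟩)
    · rcases hd x y hp with ⟨rfl, rfl⟩ | ⟨x', y', h1, h2, h3⟩
      · exact Or.inl rfl
      · exact Or.inr ⟨(x', y'), Or.inl ⟨h, h1⟩, h2, h3⟩
    · omega
  · obtain ⟨x₀, y₀, μ, h0, hd⟩ := tower_descent (k := k) (r := 2 * k - 1 - i) (by omega) a
    refine connected_of_descent (p₀ := (4 * k + 1 - x₀, y₀)) (Or.inr ⟨h, by simpa using h0⟩)
      (fun p => μ (4 * k + 1 - p.1) p.2) ?_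
    rintro ⟨x, y⟩ (⟨h', -⟩ | ⟨-, hp⟩)
    · omega
    · rcases hd _ _ hp with ⟨h1, rfl⟩ | ⟨x', y', h1, h2, h3⟩
      · left
        simp only at h1
        rw [← h1, sub_sub_cancel]
      · refine Or.inr ⟨(4 * k + 1 - x', y'), Or.inr ⟨h, by simpa using h1⟩, ?_, by simpa using h3⟩
        rw [pixelGraph_adj_iff] at h2 ⊢
        simp only at h2
        omega

theorem inBlob_bounds {k i x y : ℤ} {a : Fin 3} (hi : 0 ≤ i) (hik : i < 2 * k)
    (h : InBlob k i a x y) :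
    -(2 * k - 1) ≤ x ∧ x ≤ 6 * k ∧ -(2 * k - 1) ≤ y ∧ y ≤ 2 * k - 1 := by
  rcases h with ⟨h1, h⟩ | ⟨h1, h⟩
  · have := tower_bounds hi h1 h
    omega
  · have := tower_bounds (by omega) (by omega) h
    omega

theorem inBlob_unique {k i j x y : ℤ} {a b : Fin 3} (hi : 0 ≤ i) (hik : i < 2 * k) (hj : 0 ≤ j)
    (hjk : j < 2 * k) (h : InBlob k i a x y) (h' : InBlob k j b x y) : i = j ∧ a = b := by
  rcases h with ⟨h1, h⟩ | ⟨h1, h⟩ <;> rcases h' with ⟨h2, h'⟩ | ⟨h2, h'⟩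
  · exact tower_unique hi hj h h'
  · have := tower_bounds hi h1 h
    have := tower_bounds (by omega) (by omega) h'
    omega
  · have := tower_bounds (by omega) (by omega) h
    have := tower_bounds hj h2 h'
    omega
  · obtain ⟨h3, h4⟩ := tower_unique (by omega) (by omega) h h'
    exact ⟨by omega, h4⟩

theorem inBlob_adj {k i j x y x' y' : ℤ} {a b : Fin 3} (hk : 2 ≤ k) (hi : 0 ≤ i) (hik : i < 2 * k)
    (hj : 0 ≤ j) (hjk : j < 2 * k) (h : InBlob k i a x y) (h' : InBlob k j b x' y')
    (hadj : pixelGraph.Adj (x, y) (x', y')) (hne : ¬ (i = j ∧ a = b)) :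
    (i = j ∧ a ≠ b) ∨ (a = b ∧ (i + 1 = j ∨ j + 1 = i)) := by
  have hadj' : ∀ {r s x y x' y' : ℤ} {a b : Fin 3}, 0 ≤ r → 0 ≤ s → r < k → s < k →
      Tower k r a x y → Tower k s b x' y' → pixelGraph.Adj (x, y) (x', y') → ¬ (r = s ∧ a = b) →
      (r = s ∧ a ≠ b) ∨ (a = b ∧ (r + 1 = s ∨ s + 1 = r)) := by
    intro r s x y x' y' a b hr hs hrk hsk h h' hadj hne
    rcases pixelGraph_adj_iff.1 hadj with hc | hc | hc | hc
    · exact tower_adj hr hs hk hrk hsk h h' (Or.inl hc) hne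
    · have := tower_adj hs hr hk hsk hrk h' h (Or.inl ⟨hc.1, hc.2.symm⟩) (by tauto)
      rcases this with ⟨h1, h2⟩ | ⟨h1, h2⟩
      · exact Or.inl ⟨h1.symm, h2.symm⟩
      · exact Or.inr ⟨h1.symm, h2.symm⟩
    · exact tower_adj hr hs hk hrk hsk h h' (Or.inr ⟨hc.2, hc.1⟩) hne
    · have := tower_adj hs hr hk hsk hrk h' h (Or.inr ⟨hc.2.symm, hc.1⟩) (by tauto)
      rcases this with ⟨h1, h2⟩ | ⟨h1, h2⟩
      · exact Or.inl ⟨h1.symm, h2.symm⟩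
      · exact Or.inr ⟨h1.symm, h2.symm⟩
  have hmix : ∀ {i j x y x' y' : ℤ} {a b : Fin 3}, 0 ≤ i → i < k → k ≤ j → j < 2 * k →
      Tower k i a x y → Tower k (2 * k - 1 - j) b (4 * k + 1 - x') y' →
      pixelGraph.Adj (x, y) (x', y') → a = b ∧ i + 1 = j := by
    intro i j x y x' y' a b hi hik hj hjk h h' hadj
    have b1 := tower_bounds hi hik h
    have b2 := tower_bounds (by omega) (by omega) h'
    have hc := pixelGraph_adj_iff.1 hadj
    obtain ⟨h1, h2⟩ := tower_right hi hik h (by omega)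
    obtain ⟨h3, h4⟩ := tower_right (by omega) (by omega) h' (by omega)
    refine ⟨?_, by omega⟩
    rcases h2 with h2 | h2 | h2 <;> rcases h4 with h4 | h4 | h4 <;> omega
  rcases h with ⟨h1, h⟩ | ⟨h1, h⟩ <;> rcases h' with ⟨h2, h'⟩ | ⟨h2, h'⟩
  · exact hadj' hi hj h1 h2 h h' hadj hne
  · obtain ⟨h3, h4⟩ := hmix hi h1 h2 hjk h h' hadj
    exact Or.inr ⟨h3, Or.inl h4⟩
  · obtain ⟨h3, h4⟩ := hmix hj h2 h1 hik h' h hadj.symm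
    exact Or.inr ⟨h3.symm, Or.inr h4⟩
  · have hc := pixelGraph_adj_iff.1 hadj
    have := hadj' (by omega) (by omega) (by omega) (by omega) h h'
      (pixelGraph_adj_iff.2 (by omega)) (fun h => hne ⟨by omega, h.2⟩)
    rcases this with ⟨h3, h4⟩ | ⟨h3, h4⟩
    · exact Or.inl ⟨by omega, h4⟩
    · exact Or.inr ⟨h3, by omega⟩

theorem exists_inBlob_adj_same {k i : ℤ} (hi : 0 ≤ i) (hik : i < 2 * k) {a b : Fin 3} (hab : a ≠ b) :
    ∃ x y x' y', InBlob k i a x y ∧ InBlob k i b x' y' ∧ pixelGraph.Adj (x, y) (x', y') := by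
  rcases lt_or_ge i k with h | h
  · obtain ⟨x, y, x', y', h1, h2, h3⟩ := exists_tower_adj_same (k := k) hi hab
    exact ⟨x, y, x', y', Or.inl ⟨h, h1⟩, Or.inl ⟨h, h2⟩, h3⟩
  · obtain ⟨x, y, x', y', h1, h2, h3⟩ := exists_tower_adj_same (k := k) (r := 2 * k - 1 - i)
      (by omega) hab
    refine ⟨4 * k + 1 - x, y, 4 * k + 1 - x', y', Or.inr ⟨h, by simpa using h1⟩,
      Or.inr ⟨h, by simpa using h2⟩, ?_⟩
    rw [pixelGraph_adj_iff] at h3 ⊢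
    omega

theorem exists_inBlob_adj_succ {k i : ℤ} (hi : 0 ≤ i) (hik : i + 1 < 2 * k) (a : Fin 3) :
    ∃ x y x' y', InBlob k i a x y ∧ InBlob k (i + 1) a x' y' ∧ pixelGraph.Adj (x, y) (x', y') := by
  rcases lt_trichotomy (i + 1) k with h | h | h
  · obtain ⟨x, y, x', y', h1, h2, h3⟩ := exists_tower_adj_succ (k := k) hi h a
    exact ⟨x, y, x', y', Or.inl ⟨by omega, h1⟩, Or.inl ⟨h, h2⟩, h3⟩
  · obtain ⟨y, hy⟩ := exists_tower_right (k := k) a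
    refine ⟨2 * k, y, 2 * k + 1, y, Or.inl ⟨by omega, ?_⟩, Or.inr ⟨by omega, ?_⟩, adj_right _ _⟩
    · rw [show i = k - 1 by omega]; exact hy
    · rw [show 2 * k - 1 - (i + 1) = k - 1 by omega, show 4 * k + 1 - (2 * k + 1) = 2 * k by omega]
      exact hy
  · obtain ⟨x, y, x', y', h1, h2, h3⟩ := exists_tower_adj_succ (k := k) (r := 2 * k - 1 - (i + 1))
      (by omega) (by omega) a
    rw [show 2 * k - 1 - (i + 1) + 1 = 2 * k - 1 - i by omega] at h2
    refine ⟨4 * k + 1 - x', y', 4 * k + 1 - x, y, Or.inr ⟨by omega, by simpa using h2⟩,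
      Or.inr ⟨by omega, by simpa using h1⟩, ?_⟩
    rw [pixelGraph_adj_iff] at h3 ⊢
    omega

open Classical in
/-- The blob of a vertex of the nested triangle graph. -/
noncomputable def blob (k : ℕ) (v : Fin (2 * k) × Fin 3) : Finset Pixel :=
  (Finset.Icc (-(2 * k - 1) : ℤ) (6 * k) ×ˢ Finset.Icc (-(2 * k - 1) : ℤ) (2 * k - 1)).filter
    fun p => InBlob k v.1.val v.2 p.1 p.2

theorem mem_blob {k : ℕ} {v : Fin (2 * k) × Fin 3} {p : Pixel} :
    p ∈ blob k v ↔ InBlob k v.1.val v.2 p.1 p.2 := by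
  classical
  unfold blob
  rw [Finset.mem_filter, and_iff_right_iff_imp]
  intro h
  have := inBlob_bounds (by omega) (by omega) h
  simp only [Finset.mem_product, Finset.mem_Icc]
  omega

/-- Two towers of nested rings of blobs, side by side. -/
noncomputable def pixelRepresentation (k : ℕ) (hk : 2 ≤ k) :
    PixelRepresentation (nestedTriangles (2 * k)) where
  blob := blob k
  blob_disjoint u v huv := by
    rw [Finset.disjoint_left]
    intro p hp hp'
    obtain ⟨h1, h2⟩ := inBlob_unique (by omega) (by omega) (by omega) (by omega) (mem_blob.1 hp)
      (mem_blob.1 hp')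
    exact huv (Prod.ext (Fin.ext (by exact_mod_cast h1)) h2)
  blob_connected v := by
    have : (blob k v : Set Pixel) = {p : Pixel | InBlob k v.1.val v.2 p.1 p.2} := by
      ext p; exact mem_blob
    rw [this]
    exact inBlob_connected (by omega) (by omega) _
  adj_iff u v huv := by
    obtain ⟨⟨i, hi⟩, a⟩ := u
    obtain ⟨⟨j, hj⟩, b⟩ := v
    constructor
    · rintro (⟨h1, h2⟩ | ⟨h1, h2⟩)
      · simp only [Fin.mk.injEq] at h1 h2
        subst h1
        obtain ⟨x, y, x', y', h3, h4, h5⟩ := exists_inBlob_adj_same (k := k) (i := i) (by omega)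
          (by omega) h2
        exact ⟨(x, y), mem_blob.2 h3, (x', y'), mem_blob.2 h4, h5⟩
      · simp only at h1 h2
        subst h1
        rcases h2 with rfl | rfl
        · obtain ⟨x, y, x', y', h3, h4, h5⟩ := exists_inBlob_adj_succ (k := k) (i := i) (by omega)
            (by omega) a
          exact ⟨(x, y), mem_blob.2 h3, (x', y'), mem_blob.2 (by push_cast; exact h4), h5⟩
        · obtain ⟨x, y, x', y', h3, h4, h5⟩ := exists_inBlob_adj_succ (k := k) (i := j) (by omega)
            (by omega) a
          exact ⟨(x', y'), mem_blob.2 (by push_cast; exact h4), (x, y), mem_blob.2 h3, h5.symm⟩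
    · rintro ⟨⟨x, y⟩, hp, ⟨x', y'⟩, hq, hpq⟩
      have := inBlob_adj (by omega) (by omega) (by omega) (by omega) (by omega) (mem_blob.1 hp)
        (mem_blob.1 hq) hpq (fun h => huv (Prod.ext (Fin.ext (by exact_mod_cast h.1)) h.2))
      rcases this with ⟨h1, h2⟩ | ⟨h1, h2⟩
      · exact Or.inl ⟨Fin.ext (by exact_mod_cast h1), h2⟩
      · exact Or.inr ⟨h1, by simp only at h2 ⊢; omega⟩

end nestedTriangles

/-! ### The two towers peel in at most `k` rounds -/

/-- A vertex of `S` that owns a pixel with no pixel of `S` straight above it is on the outer face. -/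
theorem PixelRepresentation.Induces.mem_outerVertices_of_above {V : Type*} [Finite V]
    {G : SimpleGraph V} {Γ : PixelRepresentation G} {E : PlaneEmbedding G} (hE : Γ.Induces E)
    {S : Set V} {v : V} (hv : v ∈ S) {x y : ℤ} (hp : (x, y) ∈ Γ.blob v)
    (h : ∀ w ∈ S, ∀ y' > y, (x, y') ∉ Γ.blob w) : v ∈ E.outerVertices S := by
  refine hE.mem_outerVertices hv hp ⟨((x : ℝ), (y : ℝ) + 1), ?_, ?_⟩
  · simp [Pixel.square]
  -- The upward ray from the upper left corner runs through squares of pixels that belong to no blob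
  -- of `S`; the pixel at height `y + 1 + t` is found by rounding down.
  · refine E.mem_outerFace_of_ray (d := ((0, 1) : Plane)) (by simp) fun t ht hmem => ?_
    have hdis := hE.carrier_disjoint_square (S := S) (p := (x, ⌊(y : ℝ) + 1 + t⌋)) fun w hw =>
      h w hw _ (by
        have : y + 1 ≤ ⌊(y : ℝ) + 1 + t⌋ := Int.le_floor.2 (by push_cast; linarith)
        omega)
    refine Set.disjoint_left.1 hdis ?_ hmem
    have h1 := Int.floor_le ((y : ℝ) + 1 + t)
    have h2 := Int.lt_floor_add_one ((y : ℝ) + 1 + t)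
    simp only [Pixel.square, Set.mem_prod, Set.mem_Icc, Prod.fst_add, Prod.snd_add, Prod.smul_fst,
      Prod.smul_snd, smul_eq_mul]
    refine ⟨⟨?_, ?_⟩, ?_, ?_⟩ <;> linarith

namespace nestedTriangles

/-- The vertices of the `ρ`-th of `k` nested triangles that are left after `r` rounds of peeling. -/
def Layer (k r ρ : ℤ) (a : Fin 3) : Prop :=
  r = 0 ∨ ρ + r + 1 ≤ k ∨ (r = 1 ∧ a = 2)

/-- The witnesses are the ends of the top side, owned by the vertices 0 and 1, and for vertex 2 the
connecting pixel to the right of its side. The right sides of the two outermost rings face each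
other and are shielded from above by the joined connectors, so they are guaranteed to go only in the
second round. This is the exception `r = 1`, `a = 2` in `Layer`; the right side of the next ring
goes in the second round as well, so no round is lost. -/
theorem exists_tower_escape {k r ρ : ℤ} {a : Fin 3} (hr : 0 ≤ r) (hρ : 0 ≤ ρ) (hρk : ρ < k)
    (ha : ¬ Layer k (r + 1) ρ a) (ha' : Layer k r ρ a) :
    ∃ x y, Tower k ρ a x y ∧ ∀ σ b y', 0 ≤ σ → σ < k → Layer k r σ b → y < y' →
      ¬ Tower k σ b x y' := by
  fin_cases a
  · refine ⟨2 * ρ + 1, 2 * ρ + 1, by simp [Tower]; omega, ?_⟩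
    intro σ b y' h1 h2 h3 h4 h5
    fin_cases b <;> simp [Tower, Layer] at h3 h5 ha ha' <;> omega
  · refine ⟨-(2 * ρ + 1), 2 * ρ + 1, by simp [Tower]; omega, ?_⟩
    intro σ b y' h1 h2 h3 h4 h5
    fin_cases b <;> simp [Tower, Layer] at h3 h5 ha ha' <;> omega
  · refine ⟨2 * ρ + 2, 0, by simp [Tower], ?_⟩
    intro σ b y' h1 h2 h3 h4 h5
    fin_cases b <;> simp [Tower, Layer] at h3 h5 ha ha' <;> omega

/-- The position of the `i`-th of `2k` triangles in its tower. -/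
def rank (k i : ℤ) : ℤ := if i < k then i else 2 * k - 1 - i

theorem exists_escape {k r i : ℤ} {a : Fin 3} (hr : 0 ≤ r) (hi : 0 ≤ i) (hik : i < 2 * k)
    (ha : ¬ Layer k (r + 1) (rank k i) a) (ha' : Layer k r (rank k i) a) :
    ∃ x y, InBlob k i a x y ∧ ∀ j b y', 0 ≤ j → j < 2 * k → Layer k r (rank k j) b → y < y' →
      ¬ InBlob k j b x y' := by
  unfold rank at ha ha'
  rcases lt_or_ge i k with h | h
  · rw [if_pos h] at ha ha'
    obtain ⟨x, y, h1, h2⟩ := exists_tower_escape hr hi h ha ha'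
    refine ⟨x, y, Or.inl ⟨h, h1⟩, ?_⟩
    rintro j b y' h3 h4 h5 h6 (⟨h7, h8⟩ | ⟨h7, h8⟩)
    · rw [rank, if_pos h7] at h5
      exact h2 j b y' h3 h7 h5 h6 h8
    · have := tower_bounds hi h h1
      have := tower_bounds (by omega) (by omega) h8
      omega
  · rw [if_neg (by omega)] at ha ha'
    obtain ⟨x, y, h1, h2⟩ := exists_tower_escape hr (by omega) (by omega) ha ha'
    refine ⟨4 * k + 1 - x, y, Or.inr ⟨h, by simpa using h1⟩, ?_⟩
    rintro j b y' h3 h4 h5 h6 (⟨h7, h8⟩ | ⟨h7, h8⟩)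
    · have := tower_bounds (by omega) (by omega) h1
      have := tower_bounds h3 h7 h8
      omega
    · rw [rank, if_neg (by omega)] at h5
      exact h2 _ b y' (by omega) (by omega) h5 h6 (by simpa using h8)

/-- Every vertex that leaves the bound `Layer` in this round has a pixel visible from above and so
is peeled. The bound is empty after `k` rounds; here `k ≥ 2` matters, because its exceptional
vertices survive at `r = 1`. -/
theorem add_le_of_peelsIn {k : ℕ} {hk : 2 ≤ k} {E : PlaneEmbedding (nestedTriangles (2 * k))}
    (hE : (pixelRepresentation k hk).Induces E) {j : ℕ} :
    ∀ {r : ℕ} {S : Set (Fin (2 * k) × Fin 3)}, r ≤ k → (∀ v ∈ S, Layer k r (rank k v.1.val) v.2) →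
      E.PeelsIn j S → j + r ≤ k := by
  induction j with
  | zero => intro r S hr _ _; omega
  | succ j ih =>
    rintro r S hr hS ⟨⟨v, hv⟩, hpeel⟩
    have hrk : r ≠ k := by
      rintro rfl
      have h := hS v hv
      have := v.1.isLt
      simp only [Layer, rank] at h
      split_ifs at h <;> omega
    have := ih (r := r + 1) (by omega) (fun w hw => ?_) hpeel
    · omega
    · by_contra hcon
      push_cast at hcon
      refine hw.2 ?_
      obtain ⟨x, y, h1, h2⟩ := exists_escape (by omega) (by omega) (by omega) hcon (hS w hw.1)
      exact hE.mem_outerVertices_of_above hw.1 (mem_blob.2 h1) fun u hu y' hy' h =>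
        h2 _ _ _ (by omega) (by omega) (hS u hu) hy' (mem_blob.1 h)

/-- The embedding is not written down: whichever one the towers induce peels in at most `k` rounds,
and no embedding peels in fewer. -/
theorem isOuterplanar {k : ℕ} (hk : 2 ≤ k) : IsOuterplanar (nestedTriangles (2 * k)) k := by
  have hlow : ∀ (E : PlaneEmbedding (nestedTriangles (2 * k))) j, E.IsOuterplane j → k ≤ j := by
    intro E j h
    have := le_of_isOuterplane (by omega) E h
    omega
  refine ⟨?_, fun k' hk' ⟨E, hE⟩ => by have := hlow E k' hE; omega⟩
  obtain ⟨E, hE⟩ := (pixelRepresentation k hk).exists_induces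
  obtain ⟨j, -, hj⟩ := E.exists_peelsIn Set.univ
  have h1 := hlow E j hj
  have h2 := add_le_of_peelsIn hE (r := 0) (by omega) (fun v _ => Or.inl rfl) hj
  obtain rfl : j = k := by omega
  exact ⟨E, hj⟩

end nestedTriangles

/-! ### Embeddings of induced subgraphs -/

namespace PlaneEmbedding

variable {V W : Type*} {G : SimpleGraph V} {H : SimpleGraph W}

/-- The plane embedding of an induced subgraph that is obtained by restriction. -/
def comap (E : PlaneEmbedding G) (φ : H ↪g G) : PlaneEmbedding H where
  pt v := E.pt (φ v)
  arc e := E.arc (e.map φ)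
  pt_injective := E.pt_injective.comp φ.injective
  arc_isPolygonalArc u v h := E.arc_isPolygonalArc (φ u) (φ v) (φ.map_adj_iff.2 h)
  mem_of_pt_mem_arc e he w hw := by
    obtain ⟨w', hw', h⟩ := Sym2.mem_map.1
      (E.mem_of_pt_mem_arc (e.map φ) (φ.toHom.map_mem_edgeSet he) (φ w) hw)
    exact φ.injective h ▸ hw'
  arc_inter_arc e he f hf hef x hx hx' := by
    obtain ⟨w, hw, hw', rfl⟩ := E.arc_inter_arc (e.map φ) (φ.toHom.map_mem_edgeSet he) (f.map φ)
      (φ.toHom.map_mem_edgeSet hf) (fun h => hef (Sym2.map.injective φ.injective h)) x hx hx'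
    obtain ⟨a, ha, rfl⟩ := Sym2.mem_map.1 hw
    obtain ⟨b, hb, h⟩ := Sym2.mem_map.1 hw'
    exact ⟨a, ha, φ.injective h ▸ hb, rfl⟩

variable (E : PlaneEmbedding G) (φ : H ↪g G)

theorem carrier_comap (S : Set W) : (E.comap φ).carrier S = E.carrier (φ '' S) := by
  ext x
  constructor
  · rintro (⟨v, hv, rfl⟩ | ⟨e, he, hS, hx⟩)
    · exact E.pt_mem_carrier (Set.mem_image_of_mem φ hv)
    · refine Or.inr ⟨e.map φ, φ.toHom.map_mem_edgeSet he, fun v hv => ?_, hx⟩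
      obtain ⟨w, hw, rfl⟩ := Sym2.mem_map.1 hv
      exact Set.mem_image_of_mem φ (hS w hw)
  · rintro (⟨v, ⟨w, hw, rfl⟩, rfl⟩ | ⟨e, he, hS, hx⟩)
    · exact (E.comap φ).pt_mem_carrier hw
    · induction e with
      | h u v =>
        obtain ⟨a, ha, rfl⟩ := hS u (Sym2.mem_mk_left _ _)
        obtain ⟨b, hb, rfl⟩ := hS v (Sym2.mem_mk_right _ _)
        exact (E.comap φ).arc_subset_carrier (φ.map_adj_iff.1 he) ha hb hx

theorem image_outerVertices_comap (S : Set W) :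
    φ '' (E.comap φ).outerVertices S = E.outerVertices (φ '' S) := by
  have hface : (E.comap φ).outerFace S = E.outerFace (φ '' S) := by
    unfold outerFace
    rw [carrier_comap]
  ext v
  constructor
  · rintro ⟨w, ⟨hw, hwc⟩, rfl⟩
    exact ⟨Set.mem_image_of_mem φ hw, hface ▸ hwc⟩
  · rintro ⟨⟨w, hw, rfl⟩, hwc⟩
    exact ⟨w, ⟨hw, hface ▸ hwc⟩, rfl⟩

theorem peelsIn_comap {k : ℕ} {S : Set W} : (E.comap φ).PeelsIn k S ↔ E.PeelsIn k (φ '' S) := by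
  induction k generalizing S with
  | zero => exact Set.image_eq_empty.symm
  | succ k ih =>
    unfold PeelsIn
    rw [ih, Set.image_nonempty, Set.image_sdiff φ.injective, image_outerVertices_comap]

theorem IsOuterplane.exists_le_comap [Finite V] {E : PlaneEmbedding G} {k : ℕ}
    (h : E.IsOuterplane k) (φ : H ↪g G) : ∃ j ≤ k, (E.comap φ).IsOuterplane j := by
  obtain ⟨j, hj, h⟩ := PeelsIn.exists_le E h (Set.subset_univ (φ '' Set.univ))
  exact ⟨j, hj, (E.peelsIn_comap φ).2 h⟩

end PlaneEmbedding

theorem IsOuterplanar.of_iso {V W : Type*} [Finite V] [Finite W] {G : SimpleGraph V}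
    {H : SimpleGraph W} {k : ℕ} (h : IsOuterplanar G k) (e : H ≃g G) : IsOuterplanar H k := by
  have hlow : ∀ (E : PlaneEmbedding H) (j : ℕ), E.IsOuterplane j → k ≤ j := by
    intro E j hj
    obtain ⟨i, hi, h'⟩ := hj.exists_le_comap e.symm.toEmbedding
    by_contra hlt
    exact h.2 i (by omega) ⟨_, h'⟩
  obtain ⟨E, hE⟩ := h.1
  obtain ⟨j, hj, h'⟩ := hE.exists_le_comap e.toEmbedding
  obtain rfl : j = k := le_antisymm hj (hlow _ _ h')
  exact ⟨⟨_, h'⟩, fun k' hk' ⟨E', hE'⟩ => (hlow E' k' hE').not_gt hk'⟩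

/-! ### Lower bounds for all representations, summed over components -/

namespace PixelRepresentation

variable {V W : Type*} {G : SimpleGraph V} {H : SimpleGraph W}

/-- The pixel representation of an induced subgraph that is obtained by restriction. -/
def comap (Γ : PixelRepresentation G) (φ : H ↪g G) : PixelRepresentation H where
  blob v := Γ.blob (φ v)
  blob_disjoint _ _ huv := Γ.blob_disjoint _ _ (φ.injective.ne huv)
  blob_connected _ := Γ.blob_connected _
  adj_iff _ _ huv := φ.map_adj_iff.symm.trans (Γ.adj_iff _ _ (φ.injective.ne huv))

theorem blob_nonempty (Γ : PixelRepresentation G) (v : V) : (Γ.blob v).Nonempty := by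
  obtain ⟨p, hp⟩ := (Γ.blob_connected v).nonempty
  exact ⟨p, hp⟩

theorem card_le_size [Fintype V] (Γ : PixelRepresentation G) : Fintype.card V ≤ Γ.size := by
  rw [Fintype.card_eq_sum_ones]
  exact Finset.sum_le_sum fun v _ => (Γ.blob_nonempty v).card_pos

/-- The induced embedding may need more than `k` rounds, which only helps, since the bound increases
with the number of rounds. -/
theorem le_size_of_isOuterplanar [Fintype V] {k : ℕ} (hG : IsOuterplanar G k)
    (Γ : PixelRepresentation G) : 4 * k ^ 2 - 4 * k ≤ Γ.size := by
  obtain ⟨E, hE⟩ := Γ.exists_induces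
  obtain ⟨j, -, hj⟩ := E.exists_peelsIn Set.univ
  have hkj : k ≤ j := not_lt.1 fun h => hG.2 j h ⟨E, hj⟩
  refine le_trans ?_ (IsOuterplane.le_size ⟨E, hE, hj⟩)
  obtain ⟨i, rfl⟩ := Nat.exists_eq_add_of_le hkj
  -- In the factored form, monotonicity is visible despite the truncated subtraction.
  have : 4 * (k + i) ^ 2 - 4 * (k + i) = 4 * ((k + i) * (k + i - 1)) := by
    rw [Nat.mul_sub_one, Nat.mul_sub]; ring_nf
  rw [this]
  have : 4 * k ^ 2 - 4 * k = 4 * (k * (k - 1)) := by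
    rw [Nat.mul_sub_one, Nat.mul_sub]; ring_nf
  rw [this]
  gcongr

theorem sum_size_comap [Fintype V] (Γ : PixelRepresentation G) [Fintype G.ConnectedComponent]
    [∀ C : G.ConnectedComponent, Fintype C.supp] :
    ∑ C : G.ConnectedComponent, (Γ.comap (SimpleGraph.Embedding.induce C.supp)).size = Γ.size := by
  classical
  unfold size
  rw [← Finset.sum_fiberwise _ (fun v => G.connectedComponentMk v)]
  refine Finset.sum_congr rfl fun C _ => ?_
  rw [Finset.sum_subtype (p := fun v => v ∈ C.supp) _ (by simp)]
  rfl

theorem mul_card_le_size [Fintype V] {k : ℕ}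
    (hG : ∀ C : G.ConnectedComponent, IsOuterplanar (G.induce C.supp) k)
    (Γ : PixelRepresentation G) :
    (4 * k ^ 2 - 4 * k) * Nat.card G.ConnectedComponent ≤ Γ.size := by
  classical
  have := Fintype.ofFinite G.ConnectedComponent
  rw [← Γ.sum_size_comap, Nat.card_eq_fintype_card, mul_comm, ← smul_eq_mul, ← Finset.card_univ]
  exact Finset.card_nsmul_le_sum _ _ _ fun C _ => le_size_of_isOuterplanar (hG C) _

end PixelRepresentation

/-! ### Drawing the connected components side by side -/

theorem IsPolygonalArc.translate {a b : Plane} {A : Set Plane} (h : IsPolygonalArc a b A)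
    (t : Plane) : IsPolygonalArc (t + a) (t + b) ((t + ·) '' A) := by
  obtain ⟨n, p, hn, rfl, rfl, rfl, h2, h3⟩ := h
  refine ⟨n, fun i => t + p i, hn, rfl, rfl, ?_, fun i hi h => h2 i hi (add_left_cancel h), ?_⟩
  · ext x
    constructor
    · rintro ⟨y, ⟨i, hi, hy⟩, rfl⟩
      exact ⟨i, hi, (mem_segment_translate ℝ t).2 hy⟩
    · rintro ⟨i, hi, hx⟩
      rw [← add_sub_cancel t x, mem_segment_translate] at hx
      exact ⟨x - t, ⟨i, hi, hx⟩, add_sub_cancel _ _⟩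
  · intro i j hij hj x hx hx'
    rw [← add_sub_cancel t x, mem_segment_translate] at hx hx'
    obtain ⟨h4, h5⟩ := h3 i j hij hj _ hx hx'
    exact ⟨h4, sub_eq_iff_eq_add'.1 h5⟩

namespace PlaneEmbedding

variable {V W : Type*} {G : SimpleGraph V} {H : SimpleGraph W}

theorem arc_subset_carrier_of_mem (E : PlaneEmbedding G) {S : Set V} {e : Sym2 V}
    (he : e ∈ G.edgeSet) (hS : ∀ v ∈ e, v ∈ S) : E.arc e ⊆ E.carrier S :=
  fun _ hx => Or.inr ⟨e, he, hS, hx⟩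

/-- If the part of a drawing in a vertical strip is a translate of a drawing, then the outer face
of the latter is contained in the outer face of the former. -/
theorem add_mem_outerFace_of_strip [Finite V] [Finite W] {E : PlaneEmbedding G}
    {E' : PlaneEmbedding H} {S : Set V} {S' : Set W} {t : Plane} {M : ℝ}
    (hM : ∀ x ∈ E'.carrier S', |x.1| < M)
    (h : ∀ x : Plane, |x.1| ≤ M → t + x ∈ E.carrier S → x ∈ E'.carrier S') {x : Plane}
    (hx : x ∈ E'.outerFace S') (hxM : |x.1| ≤ M) : t + x ∈ E.outerFace S := by
  have hM0 : 0 ≤ M := (abs_nonneg _).trans hxM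
  obtain ⟨N, hN0, hN⟩ := E'.exists_carrier_bound S'
  -- Pushing the outer face of the small drawing horizontally into the closed strip keeps it
  -- connected. It still avoids the drawing: a moved point lands on the border of the strip, and the
  -- drawing is strictly inside.
  let clamp : Plane → Plane := fun y => (max (-M) (min M y.1), y.2)
  have hcl : ∀ y : Plane, |y.1| ≤ M → clamp y = y := by
    intro y hy
    rw [abs_le] at hy
    exact Prod.ext (by simp [clamp, hy.1, hy.2]) rfl
  have hcl_le : ∀ y : Plane, |(clamp y).1| ≤ M := fun y =>
    abs_le.2 ⟨le_max_left _ _, max_le (by linarith) (min_le_left _ _)⟩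
  have hpre : IsPreconnected ((fun y => t + clamp y) '' E'.outerFace S') :=
    (E'.outerFace_isPreconnected S').image _ (by fun_prop)
  refine (E.outerFace_isFaceUnion S).subset_of_isPreconnected hpre ?_ ?_
    ⟨x, hx, by simp only [hcl x hxM]⟩
  · rw [Set.disjoint_left]
    rintro _ ⟨y, hy, rfl⟩ hmem
    have h1 := h _ (hcl_le y) hmem
    have h2 := hM _ h1
    have h3 : clamp y = y := by
      refine hcl y ?_
      rw [abs_lt] at h2
      simp only [clamp] at h2
      rw [abs_le]
      by_contra hcon
      rw [not_and_or, not_le, not_le] at hcon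
      rcases hcon with hcon | hcon
      · rw [min_eq_right (by linarith), max_eq_left hcon.le] at h2
        linarith
      · rw [min_eq_left hcon.le, max_eq_right (by linarith)] at h2
        linarith
    exact hy.1 (h3 ▸ h1)
  -- A border point of the strip belongs to the clamped face and can escape vertically along the
  -- border, so it is in the outer face of the large drawing.
  · refine ⟨t + (M, 0), ⟨(max M N, 0), ?_, ?_⟩, ?_⟩
    · exact E'.mem_outerFace_of_lt hN (Or.inl ((le_max_right _ _).trans (le_abs_self _)))
    · simp [clamp, hM0]
    · refine E.mem_outerFace_of_ray (d := ((0, 1) : Plane)) (by simp) fun s _ hs => ?_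
      rw [add_assoc] at hs
      have h1 : ((M, 0) + s • (0, 1) : Plane).1 = M := by simp
      have h2 := hM _ (h _ (by rw [h1, abs_of_nonneg hM0]) hs)
      rw [h1, abs_of_nonneg hM0] at h2
      exact lt_irrefl _ h2

theorem mem_closure_outerFace_of_strip [Finite V] [Finite W] {E : PlaneEmbedding G}
    {E' : PlaneEmbedding H} {S : Set V} {S' : Set W} {t : Plane} {M : ℝ}
    (hM : ∀ x ∈ E'.carrier S', |x.1| < M)
    (h : ∀ x : Plane, |x.1| ≤ M → t + x ∈ E.carrier S → x ∈ E'.carrier S') {x : Plane}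
    (hx : x ∈ closure (E'.outerFace S')) (hxM : |x.1| < M) : t + x ∈ closure (E.outerFace S) := by
  have hop : IsOpen {y : Plane | |y.1| < M} := isOpen_lt (by fun_prop) (by fun_prop)
  have h1 : x ∈ closure ({y : Plane | |y.1| < M} ∩ E'.outerFace S') :=
    hop.inter_closure ⟨hxM, hx⟩
  refine closure_mono ?_ (image_closure_subset_closure_image (f := (t + ·)) (by fun_prop)
    (Set.mem_image_of_mem _ h1))
  rintro _ ⟨y, ⟨hy, hy'⟩, rfl⟩
  exact add_mem_outerFace_of_strip hM h hy' (le_of_lt hy)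

variable (E : ∀ C : G.ConnectedComponent, PlaneEmbedding (G.induce C.supp))
  (t : G.ConnectedComponent → Plane)

/-- The arcs of a drawing that puts translates of drawings of the components together. -/
def glueArc (e : Sym2 V) : Set Plane :=
  {x | ∃ (C : G.ConnectedComponent) (f : Sym2 C.supp), f ∈ (G.induce C.supp).edgeSet ∧
    f.map Subtype.val = e ∧ ∃ y ∈ (E C).arc f, t C + y = x}

/-- The vertices of a drawing that puts translates of drawings of the components together. -/
def gluePt (v : V) : Plane :=
  t (G.connectedComponentMk v) + (E (G.connectedComponentMk v)).pt ⟨v, rfl⟩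

theorem gluePt_coe {C : G.ConnectedComponent} (v : C.supp) :
    gluePt E t v = t C + (E C).pt v := by
  obtain ⟨v, rfl⟩ := v
  rfl

theorem glueArc_map {C : G.ConnectedComponent} {f : Sym2 C.supp}
    (hf : f ∈ (G.induce C.supp).edgeSet) :
    glueArc E t (f.map Subtype.val) = (t C + ·) '' (E C).arc f := by
  ext x
  constructor
  · rintro ⟨D, g, hg, h, y, hy, rfl⟩
    obtain rfl : D = C := by
      induction f with
      | h u v =>
        obtain ⟨w, -, hw⟩ := Sym2.mem_map.1
          (h.symm ▸ Sym2.mem_mk_left u.1 v.1 : u.1 ∈ g.map Subtype.val)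
        have := w.2
        rw [hw] at this
        exact this.symm.trans u.2
    obtain rfl := Sym2.map.injective Subtype.val_injective h
    exact ⟨y, hy, rfl⟩
  · rintro ⟨y, hy, rfl⟩
    exact ⟨C, f, hf, rfl, y, hy, rfl⟩

/-- The drawing that puts translates of drawings of the components together. -/
def glue (hsep : ∀ C D, ∀ x ∈ (E C).carrier Set.univ, ∀ y ∈ (E D).carrier Set.univ,
    t C + x = t D + y → C = D) : PlaneEmbedding G where
  pt := gluePt E t
  arc := glueArc E t
  pt_injective u v h := by
    have hC := hsep _ _ _ ((E _).pt_mem_carrier (Set.mem_univ _)) _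
      ((E _).pt_mem_carrier (Set.mem_univ _)) h
    have h1 := gluePt_coe E t (⟨v, hC.symm⟩ : (G.connectedComponentMk u).supp)
    have h2 := gluePt_coe E t (⟨u, rfl⟩ : (G.connectedComponentMk u).supp)
    have := (E _).pt_injective (add_left_cancel (h2.symm.trans (h.trans h1)))
    exact congrArg Subtype.val this
  arc_isPolygonalArc u v h := by
    have hC := SimpleGraph.ConnectedComponent.connectedComponentMk_eq_of_adj h
    let u' : (G.connectedComponentMk u).supp := ⟨u, rfl⟩
    let v' : (G.connectedComponentMk u).supp := ⟨v, hC.symm⟩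
    have hadj : (G.induce _).Adj u' v' := h
    have h1 := gluePt_coe E t u'
    have h2 := gluePt_coe E t v'
    have h3 : glueArc E t s(u, v) = _ := glueArc_map E t (f := s(u', v')) hadj
    rw [h3, show gluePt E t u = _ from h1, show gluePt E t v = _ from h2]
    exact ((E _).arc_isPolygonalArc u' v' hadj).translate _
  mem_of_pt_mem_arc := by
    rintro _ - w ⟨C, f, hf, rfl, y, hy, h⟩
    obtain rfl := hsep C _ y ((E C).arc_subset_carrier_of_mem hf (fun _ _ => Set.mem_univ _) hy) _
      ((E _).pt_mem_carrier (Set.mem_univ _)) h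
    obtain rfl := add_left_cancel h
    exact Sym2.mem_map.2 ⟨_, (E _).mem_of_pt_mem_arc f hf _ hy, rfl⟩
  arc_inter_arc := by
    rintro _ - _ - hef x ⟨C, f, hf, rfl, y, hy, rfl⟩ ⟨D, g, hg, rfl, z, hz, h⟩
    obtain rfl := hsep D C z ((E D).arc_subset_carrier_of_mem hg (fun _ _ => Set.mem_univ _) hz) y
      ((E C).arc_subset_carrier_of_mem hf (fun _ _ => Set.mem_univ _) hy) h
    obtain rfl := add_left_cancel h
    obtain ⟨w, hw, hw', rfl⟩ := (E D).arc_inter_arc f hf g hg (fun h => hef (h ▸ rfl)) _ hy hz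
    exact ⟨w, Sym2.mem_map.2 ⟨w, hw, rfl⟩, Sym2.mem_map.2 ⟨w, hw', rfl⟩, (gluePt_coe E t w).symm⟩

variable {E t} {hsep : ∀ C D, ∀ x ∈ (E C).carrier Set.univ, ∀ y ∈ (E D).carrier Set.univ,
    t C + x = t D + y → C = D}

theorem exists_of_mem_carrier_glue {S : Set V} {x : Plane} (hx : x ∈ (glue E t hsep).carrier S) :
    ∃ C, ∃ y ∈ (E C).carrier (Subtype.val ⁻¹' S), t C + y = x := by
  rcases hx with ⟨v, hv, rfl⟩ | ⟨_, -, hS, ⟨C, f, hf, rfl, y, hy, rfl⟩⟩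
  · exact ⟨_, _, (E _).pt_mem_carrier (show (⟨v, rfl⟩ : (G.connectedComponentMk v).supp) ∈ _ from hv),
      rfl⟩
  · exact ⟨C, y, (E C).arc_subset_carrier_of_mem hf
      (fun w hw => hS w (Sym2.mem_map.2 ⟨w, hw, rfl⟩)) hy, rfl⟩

/-- Components in disjoint strips do not hide each other, so one round of the glued drawing contains
a round of every component. Some components may be exhausted early, whence the individual numbers `j
≤ n`. -/
theorem exists_peelsIn_glue [Finite V] {M : ℝ}
    (hM : ∀ C, ∀ x ∈ (E C).carrier Set.univ, |x.1| < M)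
    (hsep' : ∀ C D, ∀ x y : Plane, |x.1| ≤ M → |y.1| < M → t C + x = t D + y → C = D)
    {n : ℕ} {S : Set V} (h : ∀ C, ∃ j ≤ n, (E C).PeelsIn j (Subtype.val ⁻¹' S)) :
    ∃ j ≤ n, (glue E t hsep).PeelsIn j S := by
  induction n generalizing S with
  | zero =>
    refine ⟨0, le_rfl, Set.eq_empty_of_forall_notMem fun v hv => ?_⟩
    obtain ⟨j, hj, h'⟩ := h (G.connectedComponentMk v)
    obtain rfl : j = 0 := by omega
    have : (⟨v, rfl⟩ : (G.connectedComponentMk v).supp) ∈ Subtype.val ⁻¹' S := hv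
    rw [show Subtype.val ⁻¹' S = ∅ from h'] at this
    exact this
  | succ n ih =>
    rcases S.eq_empty_or_nonempty with rfl | hS
    · exact ⟨0, by omega, rfl⟩
    suffices key : ∀ C, ∃ j ≤ n, (E C).PeelsIn j
        (Subtype.val ⁻¹' (S \ (glue E t hsep).outerVertices S)) by
      obtain ⟨j, hj, h'⟩ := ih key
      exact ⟨j + 1, by omega, hS, h'⟩
    intro C
    obtain ⟨j, hj, h'⟩ := h C
    have hsub : (Subtype.val ⁻¹' (S \ (glue E t hsep).outerVertices S) : Set C.supp) ⊆
        (Subtype.val ⁻¹' S) \ (E C).outerVertices (Subtype.val ⁻¹' S) := by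
      rintro v ⟨hv, hv'⟩
      refine ⟨hv, fun hout => hv' ⟨hv, ?_⟩⟩
      have hMS : ∀ x ∈ (E C).carrier (Subtype.val ⁻¹' S), |x.1| < M := fun x hx =>
        hM C x ((E C).carrier_mono (Set.subset_univ _) hx)
      rw [show (glue E t hsep).pt v = _ from gluePt_coe E t v]
      refine mem_closure_outerFace_of_strip hMS (fun x hxM hx => ?_) hout.2
        (hMS _ ((E C).pt_mem_carrier hv))
      obtain ⟨D, y, hy, hxy⟩ := exists_of_mem_carrier_glue hx
      obtain rfl := hsep' C D x y hxM (hM D y ((E D).carrier_mono (Set.subset_univ _) hy)) hxy.symm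
      exact add_left_cancel hxy ▸ hy
    rcases j with _ | j
    · exact ⟨0, by omega, Set.subset_eq_empty (hsub.trans Set.sdiff_subset) h'⟩
    · obtain ⟨i, hi, h''⟩ := PeelsIn.exists_le (E C) h'.2 hsub
      exact ⟨i, by omega, h''⟩

end PlaneEmbedding

theorem IsOuterplanar.of_components {V : Type*} [Finite V] [Nonempty V] {G : SimpleGraph V} {k : ℕ}
    (h : ∀ C : G.ConnectedComponent, IsOuterplanar (G.induce C.supp) k) : IsOuterplanar G k := by
  have hlow : ∀ (E : PlaneEmbedding G) (j : ℕ), E.IsOuterplane j → k ≤ j := by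
    intro E j hj
    obtain ⟨v⟩ := ‹Nonempty V›
    obtain ⟨i, hi, h'⟩ := hj.exists_le_comap
      (SimpleGraph.Embedding.induce (G.connectedComponentMk v).supp)
    by_contra hlt
    exact (h (G.connectedComponentMk v)).2 i (by omega) ⟨_, h'⟩
  choose E hE using fun C => (h C).1
  choose M hM0 hM using fun C => (E C).exists_carrier_bound Set.univ
  obtain ⟨N, hN⟩ := (Set.finite_range M).bddAbove
  have hMN : ∀ C, M C ≤ N := fun C => hN ⟨C, rfl⟩
  obtain ⟨n, ⟨idx⟩⟩ := Finite.exists_equiv_fin G.ConnectedComponent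
  -- Shifts by multiples of `2N` keep the strips of half-width `N` from overlapping. The strips may
  -- share borders, which are free of any drawing; this is why `hsep'` has one weak and one strict
  -- inequality.
  let t : G.ConnectedComponent → Plane := fun C => (2 * N * ((idx C : ℕ) : ℝ), 0)
  have hsep' : ∀ C D, ∀ x y : Plane, |x.1| ≤ N → |y.1| < N → t C + x = t D + y → C = D := by
    intro C D x y hx hy hxy
    have h1 := congrArg Prod.fst hxy
    simp only [t, Prod.fst_add] at h1
    rw [abs_le] at hx
    rw [abs_lt] at hy
    have hN0 : 0 < N := by linarith
    refine idx.injective (Fin.ext (Nat.le_antisymm (not_lt.1 fun hlt => ?_)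
      (not_lt.1 fun hlt => ?_)))
    · have h2 : ((idx D : ℕ) : ℝ) + 1 ≤ (idx C : ℕ) := by exact_mod_cast hlt
      nlinarith
    · have h2 : ((idx C : ℕ) : ℝ) + 1 ≤ (idx D : ℕ) := by exact_mod_cast hlt
      nlinarith
  have hbd : ∀ C, ∀ x ∈ (E C).carrier Set.univ, |x.1| < N := fun C x hx =>
    ((hM C) x hx).1.trans_le (hMN C)
  obtain ⟨j, hj, h'⟩ := PlaneEmbedding.exists_peelsIn_glue (E := E) (t := t) (S := Set.univ) (n := k)
    (hsep := fun C D x hx y hy hxy => hsep' C D x y (hbd C x hx).le (hbd D y hy) hxy)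
    hbd hsep' fun C => ⟨k, le_rfl, hE C⟩
  obtain rfl : j = k := le_antisymm hj (hlow _ _ h')
  exact ⟨⟨_, h'⟩, fun k' hk' ⟨E', hE'⟩ => (hlow E' k' hE').not_gt hk'⟩

/-! ### Disjoint unions and lower bounds on sizes -/

theorem SimpleGraph.card_eq_sum_ncard_supp {V : Type*} [Fintype V] (G : SimpleGraph V)
    [Fintype G.ConnectedComponent] : Fintype.card V = ∑ C : G.ConnectedComponent, C.supp.ncard := by
  classical
  rw [Fintype.card_congr (Equiv.sigmaFiberEquiv G.connectedComponentMk).symm, Fintype.card_sigma]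
  refine Finset.sum_congr rfl fun C _ => ?_
  rw [← Nat.card_coe_set_eq, Nat.card_eq_fintype_card]
  exact Fintype.card_congr (Equiv.refl _)

/-- For `k ≥ 2` one has `4k² - 4k ≥ 2k²`, so with `c` components the size is at least `2k²c = (2 /
A) k (Akc)`, and `Akc` bounds the number of vertices. For `k = 1` the isoperimetric bound is void,
but every blob has a pixel. -/
theorem PixelRepresentation.mul_card_vertices_le_size {V : Type*} [Fintype V] {G : SimpleGraph V}
    {k : ℕ} {A : ℝ} (hA : 0 < A) (hk : 1 ≤ k)
    (h : ∀ C : G.ConnectedComponent,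
      IsOuterplanar (G.induce C.supp) k ∧ (C.supp.ncard : ℝ) ≤ A * k)
    (Γ : PixelRepresentation G) : min 1 (2 / A) * k * Fintype.card V ≤ (Γ.size : ℝ) := by
  rcases hk.eq_or_lt with rfl | hk
  · have h1 : (Fintype.card V : ℝ) ≤ Γ.size := by exact_mod_cast Γ.card_le_size
    have h2 : min 1 (2 / A) * (1 : ℕ) * (Fintype.card V : ℝ) ≤ 1 * (1 : ℕ) * Fintype.card V := by
      gcongr
      exact min_le_left _ _
    rw [Nat.cast_one, mul_one, mul_one, one_mul] at h2
    rw [Nat.cast_one, mul_one]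
    exact h2.trans h1
  · classical
    have := Fintype.ofFinite G.ConnectedComponent
    set c := Fintype.card G.ConnectedComponent with hc
    have h1 : (Fintype.card V : ℝ) ≤ c * (A * k) := by
      rw [G.card_eq_sum_ncard_supp, Nat.cast_sum, hc, ← nsmul_eq_mul, ← Finset.card_univ]
      exact Finset.sum_le_card_nsmul _ _ _ fun C _ => (h C).2
    have h2 : 2 * k ^ 2 * c ≤ Γ.size := by
      refine le_trans ?_ (Γ.mul_card_le_size fun C => (h C).1)
      rw [Nat.card_eq_fintype_card, ← hc]
      gcongr
      obtain ⟨k, rfl⟩ := Nat.exists_eq_add_of_le hk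
      rw [show 4 * (1 + 1 + k) ^ 2 = 4 * (1 + k) * (2 + k) + 4 * (2 + k) by ring]
      rw [show 4 * (1 + 1 + k) = 4 * (2 + k) by ring, Nat.add_sub_cancel]
      nlinarith
    have h3 : (2 * k ^ 2 * c : ℝ) ≤ Γ.size := by exact_mod_cast h2
    calc min 1 (2 / A) * k * (Fintype.card V : ℝ) ≤ 2 / A * k * (c * (A * k)) := by
          gcongr
          exact min_le_right _ _
      _ = 2 * k ^ 2 * c := by field_simp
      _ ≤ Γ.size := h3

theorem isOuterplanar_one_of_subsingleton {W : Type*} [Nonempty W] [Subsingleton W]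
    (H : SimpleGraph W) : IsOuterplanar H 1 := by
  have hadj : ∀ u v, ¬ H.Adj u v := fun u v h => h.ne (Subsingleton.elim u v)
  have hedge : ∀ e, e ∉ H.edgeSet := fun e => by
    induction e with
    | h u v => exact hadj u v
  let E : PlaneEmbedding H :=
    { pt := fun _ => 0
      arc := fun _ => ∅
      pt_injective := Function.injective_of_subsingleton _
      arc_isPolygonalArc := fun u v h => absurd h (hadj u v)
      mem_of_pt_mem_arc := fun e he => absurd he (hedge e)
      arc_inter_arc := fun e he => absurd he (hedge e) }
  have hpos : ∀ (E : PlaneEmbedding H) j, E.IsOuterplane j → 1 ≤ j := by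
    rintro E (_ | j) hj
    · exact absurd hj Set.univ_nonempty.ne_empty
    · omega
  obtain ⟨j, hj, h⟩ := E.exists_peelsIn Set.univ
  have h1 : (Set.univ : Set W).ncard ≤ 1 := Set.ncard_le_one_iff_subsingleton.2 Set.subsingleton_univ
  obtain rfl : j = 1 := le_antisymm (hj.trans h1) (hpos E j h)
  exact ⟨⟨E, h⟩, fun k' hk' ⟨E', hE'⟩ => (hpos E' k' hE').not_gt hk'⟩

namespace disjointCopies

variable {W : Type*} {c : ℕ} {H : SimpleGraph W}

theorem reachable_iff (hH : H.Preconnected) {x y : Fin c × W} :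
    (disjointCopies c H).Reachable x y ↔ x.1 = y.1 := by
  constructor
  · intro h
    rw [SimpleGraph.reachable_iff_reflTransGen] at h
    induction h with
    | refl => rfl
    | tail _ hab ih => exact ih.trans hab.1
  · obtain ⟨i, u⟩ := x
    obtain ⟨j, v⟩ := y
    rintro (rfl : i = j)
    exact (hH u v).map (⟨fun w => (i, w), fun h => ⟨rfl, h⟩⟩ : H →g disjointCopies c H)

theorem card_connectedComponent (hH : H.Connected) :
    Nat.card (disjointCopies c H).ConnectedComponent = c := by
  obtain ⟨w⟩ := hH.nonempty
  have : Function.Bijective fun i : Fin c => (disjointCopies c H).connectedComponentMk (i, w) := by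
    constructor
    · intro i j h
      exact (reachable_iff hH.preconnected).1 (SimpleGraph.ConnectedComponent.exact h)
    · intro C
      induction C using SimpleGraph.ConnectedComponent.ind with
      | h v =>
        exact ⟨v.1, SimpleGraph.ConnectedComponent.sound ((reachable_iff hH.preconnected).2 rfl)⟩
  rw [← Nat.card_eq_of_bijective _ this, Nat.card_fin]

theorem nonempty_iso (hH : H.Connected) (C : (disjointCopies c H).ConnectedComponent) :
    Nonempty ((disjointCopies c H).induce C.supp ≃g H) := by
  induction C using SimpleGraph.ConnectedComponent.ind with
  | h v =>
    have hmem : ∀ x, x ∈ ((disjointCopies c H).connectedComponentMk v).supp ↔ x.1 = v.1 := fun x =>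
      SimpleGraph.ConnectedComponent.eq.trans (reachable_iff hH.preconnected)
    refine ⟨⟨⟨fun x => x.1.2, fun w => ⟨(v.1, w), (hmem _).2 rfl⟩, ?_, fun _ => rfl⟩, ?_⟩⟩
    · rintro ⟨x, hx⟩
      exact Subtype.ext (Prod.ext ((hmem x).1 hx).symm rfl)
    · rintro ⟨x, hx⟩ ⟨y, hy⟩
      exact ⟨fun h => ⟨((hmem x).1 hx).trans ((hmem y).1 hy).symm, h⟩, fun h => h.2⟩

theorem isOuterplanar_induce_supp [Finite W] (hH : H.Connected) {k : ℕ} (h : IsOuterplanar H k)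
    (C : (disjointCopies c H).ConnectedComponent) :
    IsOuterplanar ((disjointCopies c H).induce C.supp) k := by
  obtain ⟨e⟩ := nonempty_iso hH C
  exact h.of_iso e

theorem ncard_supp (hH : H.Connected) (C : (disjointCopies c H).ConnectedComponent) :
    C.supp.ncard = Nat.card W := by
  obtain ⟨e⟩ := nonempty_iso hH C
  rw [← Nat.card_coe_set_eq]
  exact Nat.card_congr e.toEquiv

end disjointCopies

theorem nestedTriangles.connected {m : ℕ} (hm : 0 < m) : (nestedTriangles m).Connected := by
  have : Nonempty (Fin m × Fin 3) := ⟨(⟨0, hm⟩, 0)⟩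
  exact ⟨(nestedTriangles.induce_preconnected Set.ordConnected_univ).map
    (SimpleGraph.Embedding.induce (G := nestedTriangles m) (Prod.fst ⁻¹' Set.univ)).toHom
    fun x => ⟨⟨x, Set.mem_univ _⟩, rfl⟩⟩

/-- Supplies the case `k = 1` of the final statement, which the nested triangles do not cover. -/
theorem isOuterplanar_bot_and_le_size {n : ℕ} (hn : 1 ≤ n) :
    IsOuterplanar (⊥ : SimpleGraph (Fin n)) 1 ∧
      ∀ Γ : PixelRepresentation (⊥ : SimpleGraph (Fin n)), n ≤ Γ.size := by
  have : Nonempty (Fin n) := ⟨⟨0, hn⟩⟩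
  refine ⟨.of_components fun C => ?_, fun Γ => by simpa using Γ.card_le_size⟩
  have : Nonempty C.supp := C.nonempty_supp.to_subtype
  have : Subsingleton C.supp := ⟨fun x y => Subtype.ext (SimpleGraph.reachable_bot.1
    (SimpleGraph.ConnectedComponent.exact (x.2.trans y.2.symm)))⟩
  exact isOuterplanar_one_of_subsingleton _

/-! ### Assembly of the four statements -/

theorem mainTheorem2 :
    -- every `k`-outerplane pixel representation has at least `4k² - 4k` pixels
    (∀ (V : Type*) [Fintype V] (G : SimpleGraph V) (Γ : PixelRepresentation G) (k : ℕ),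
      Γ.IsOuterplane k → 4 * k ^ 2 - 4 * k ≤ Γ.size) ∧
    -- graphs all of whose components are `k`-outerplanar with `O(k)` vertices
    (∀ A : ℝ, 0 < A → ∃ δ : ℝ, 0 < δ ∧
      ∀ (k : ℕ) (V : Type*) [Fintype V] [Nonempty V] (G : SimpleGraph V), 1 ≤ k →
        (∀ C : G.ConnectedComponent,
          IsOuterplanar (G.induce C.supp) k ∧ (C.supp.ncard : ℝ) ≤ A * k) →
        IsOuterplanar G k ∧ ∀ Γ : PixelRepresentation G,
          (4 * k ^ 2 - 4 * k) * Nat.card G.ConnectedComponent ≤ Γ.size ∧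
          δ * k * Fintype.card V ≤ Γ.size) ∧
    -- disjoint unions of nested triangle graphs, with `n = 6kc` vertices
    (∀ k c : ℕ, 2 ≤ k → 1 ≤ c →
      IsOuterplanar (nestedTriangles (2 * k)) k ∧
      IsOuterplanar (disjointCopies c (nestedTriangles (2 * k))) k ∧
      Fintype.card (Fin c × (Fin (2 * k) × Fin 3)) = 6 * k * c ∧
      ∀ Γ : PixelRepresentation (disjointCopies c (nestedTriangles (2 * k))),
        (4 * k ^ 2 - 4 * k) * c ≤ Γ.size) ∧
    -- some `k`-outerplanar graphs with `n` vertices require `Ω(kn)` pixels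
    (∃ δ : ℝ, 0 < δ ∧ ∀ k n : ℕ, 1 ≤ k → 1 ≤ n → 6 * k ∣ n →
      ∃ G : SimpleGraph (Fin n), IsOuterplanar G k ∧
        ∀ Γ : PixelRepresentation G, δ * k * n ≤ Γ.size) := by

  have hcard : ∀ k : ℕ, Nat.card (Fin (2 * k) × Fin 3) = 6 * k := fun k => by
    rw [Nat.card_eq_fintype_card, Fintype.card_prod, Fintype.card_fin, Fintype.card_fin]
    ring
  have hcopies : ∀ k c : ℕ, Fintype.card (Fin c × (Fin (2 * k) × Fin 3)) = 6 * k * c := fun k c => by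
    rw [Fintype.card_prod, ← Nat.card_eq_fintype_card (α := Fin (2 * k) × Fin 3), hcard,
      Fintype.card_fin, mul_comm]
  have hconn : ∀ k : ℕ, 2 ≤ k → (nestedTriangles (2 * k)).Connected := fun k hk =>
    nestedTriangles.connected (by omega)
  have hunion : ∀ k c : ℕ, 2 ≤ k → 1 ≤ c →
      IsOuterplanar (disjointCopies c (nestedTriangles (2 * k))) k := by
    intro k c hk hc
    have : Nonempty (Fin c × (Fin (2 * k) × Fin 3)) := ⟨⟨0, hc⟩, ⟨0, by omega⟩, 0⟩
    exact .of_components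
      (disjointCopies.isOuterplanar_induce_supp (hconn k hk) (nestedTriangles.isOuterplanar hk))
  refine ⟨fun V _ G Γ k h => h.le_size, fun A hA => ⟨min 1 (2 / A), by positivity, ?_⟩, ?_, ?_⟩
  · intro k V _ _ G hk h
    exact ⟨.of_components fun C => (h C).1, fun Γ => ⟨Γ.mul_card_le_size fun C => (h C).1,
      Γ.mul_card_vertices_le_size hA hk h⟩⟩
  · intro k c hk hc
    refine ⟨nestedTriangles.isOuterplanar hk, hunion k c hk hc, hcopies k c, fun Γ => ?_⟩
    have := Γ.mul_card_le_size
      (disjointCopies.isOuterplanar_induce_supp (hconn k hk) (nestedTriangles.isOuterplanar hk))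
    rwa [disjointCopies.card_connectedComponent (hconn k hk)] at this
  -- The constant for `A = 6`: a copy of the nested triangle graph has `6k` vertices.
  · refine ⟨min 1 (2 / 6), by positivity, ?_⟩
    rintro k n hk hn ⟨c, rfl⟩
    have hc : 1 ≤ c := Nat.pos_of_mul_pos_left hn
    rcases hk.eq_or_lt with rfl | hk
    · obtain ⟨h1, h2⟩ := isOuterplanar_bot_and_le_size hn
      refine ⟨⊥, h1, fun Γ => ?_⟩
      have h3 : ((6 * 1 * c : ℕ) : ℝ) ≤ Γ.size := by exact_mod_cast h2 Γ
      refine le_trans ?_ h3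
      rw [Nat.cast_one, mul_one]
      exact mul_le_of_le_one_left (Nat.cast_nonneg _) (min_le_left _ _)
    -- Only the vertex set has to be relabelled: `k`-outerplanarity and sizes are transported along
    -- the isomorphism with the disjoint union of `c` copies.
    · let e := Fintype.equivFinOfCardEq (hcopies k c)
      let f := SimpleGraph.Iso.comap e.symm (disjointCopies c (nestedTriangles (2 * k)))
      refine ⟨_, (hunion k c hk hc).of_iso f, fun Γ => ?_⟩
      have h1 := PixelRepresentation.mul_card_vertices_le_size (A := 6) (by norm_num) (by omega)
        (fun C => ⟨disjointCopies.isOuterplanar_induce_supp (hconn k hk)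
          (nestedTriangles.isOuterplanar hk) C, by
            rw [disjointCopies.ncard_supp (hconn k hk), hcard]
            push_cast
            exact le_rfl⟩)
        (Γ.comap f.symm.toEmbedding)
      rw [hcopies] at h1
      have h2 : (Γ.comap f.symm.toEmbedding).size = Γ.size :=
        e.sum_comp fun v => (Γ.blob v).card
      rwa [h2] at h1
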